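/- \textbf{Setting.} Put $\epsilon_1=1$, $\epsilon_2=\epsilon_3=-1$, indices in $\{1,2,3\}$ modulo $3$. Let $(M,\sigma,g)$ be a paraquaternionic Kähler manifold: $g$ is a semi-Riemannian metric on the smooth manifold $M$ with Levi-Civita connection $\overline\nabla$; $\sigma\subset \mathrm{End}(TM)$ is a rank-$3$ subbundle with local bases $\{J_1,J_2,J_3\}$ (canonical local bases) such that $J_\alpha^2=-\epsilon_\alpha \mathrm{Id}$ and $J_\alpha J_{\alpha+1}=-J_{\alpha+1}J_\alpha=\epsilon_{\alpha+2}J_{\alpha+2}$; $g(J_\alpha X,J_\alpha Y)=\epsilon_\alpha g(X,Y)$ for all $\alpha$ and every canonical local basis; and $\sigma$ is parallel with respect to $\overline\nabla$. Let $N$ be an immersed submanifold of $M$ such that the restriction of $g$ to $TN$ is non-degenerate, with second fundamental form $B$, shape operators $A_\xi$ and normal connection $\nabla^\perp$, so that, for $X,Y\in\Gamma(TN)$ and $\xi\in\Gamma(TN^\perp)$, $B(X,Y)$ is the normal part of $\overline\nabla_XY$, and $-A_\xi X$ and $\nabla^\perp_X\xi$ are the tangential and the normal part of $\overline\nabla_X\xi$.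 Suppose that $N$ is a paraquaternionic CR-submanifold: there is a non-degenerate smooth distribution $\mathcal D\subseteq TN$ such that $J_\alpha\mathcal D_x=\mathcal D_x$ and $J_\alpha\mathcal D^\perp_x\subset T_xN^\perp$ for every $x\in N$, every canonical local basis near $x$ and every $\alpha$, where $\mathcal D^\perp$ is the orthogonal complement of $\mathcal D$ in $TN$. Let $\nu^\perp=J_1\mathcal D^\perp\oplus J_2\mathcal D^\perp\oplus J_3\mathcal D^\perp\subseteq TN^\perp$ (it does not depend on the canonical local basis), and let $\nu$ be its orthogonal complement in $TN^\perp$. \textbf{Theorem.} The following assertions are equivalent: (i) $N$ is totally real ruled: $\mathcal D^\perp$ is the tangent distribution of a foliation of $N$ (there is an integral manifold of $\mathcal D^\perp$ through each point of $N$) whose leaves are totally geodesic immersed submanifolds of $M$. (ii) $N$ is $\mathcal D^\perp$-geodesic, that is, $B(X,Y)=0$ for all $X,Y\in\Gamma(\mathcal D^\perp)$, and $B(X,Y)\in\Gamma(\nu)$ for all $X\in\Gamma(\mathcal D)$, $Y\in\Gamma(\mathcal D^\perp)$. (iii) The subbundle $\nu^\perp$ is $\mathcal D^\perp$-parallel,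 that is, $\nabla^\perp_XJ_\alpha Z\in\Gamma(\nu^\perp)$ for all $X,Z\in\Gamma(\mathcal D^\perp)$, $\alpha\in\{1,2,3\}$ and every canonical local basis, and $B(X,Y)\in\Gamma(\nu)$ for all $X\in\Gamma(\mathcal D^\perp)$, $Y\in\Gamma(TN)$. (iv) $A_{J_\alpha Z}X=0$ for all $X,Z\in\Gamma(\mathcal D^\perp)$, $\alpha\in\{1,2,3\}$ and every canonical local basis, and $A_\xi X\in\Gamma(\mathcal D)$ for all $X\in\Gamma(\mathcal D^\perp)$, $\xi\in\Gamma(\nu)$. Here $\Gamma$ denotes smooth local sections. -/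

import Mathlib

open scoped Manifold ContDiff Topology
open Bundle

noncomputable section

namespace PQ

universe u

/-! ### Semi-Riemannian metrics and the Levi-Civita connection -/

section Sharp

variable {V : Type*} [AddCommGroup V] [Module ℝ V] [FiniteDimensional ℝ V]

/-- The vector dual to the functional `l` with respect to a non-degenerate bilinear form `b`,
that is, the unique `v` with `b v w = l w` for all `w` (see `apply_sharp`). -/
def sharp (b : V →ₗ[ℝ] V →ₗ[ℝ] ℝ) (hb : ∀ v, (∀ w, b v w = 0) → v = 0) (l : V →ₗ[ℝ] ℝ) : V :=
  (LinearEquiv.ofInjectiveOfFinrankEq b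
    ((injective_iff_map_eq_zero b).2 fun v hv => hb v fun w => by simp [hv])
    (Subspace.dual_finrank_eq (K := ℝ) (V := V)).symm).symm l

theorem apply_sharp (b : V →ₗ[ℝ] V →ₗ[ℝ] ℝ) (hb : ∀ v, (∀ w, b v w = 0) → v = 0)
    (l : V →ₗ[ℝ] ℝ) (w : V) : b (sharp b hb l) w = l w := by
  have h : b (sharp b hb l) = l := LinearEquiv.apply_symm_apply
    (LinearEquiv.ofInjectiveOfFinrankEq b
      ((injective_iff_map_eq_zero b).2 fun v hv => hb v fun w => by simp [hv])
      (Subspace.dual_finrank_eq (K := ℝ) (V := V)).symm) l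
  rw [h]

end Sharp

section Metric

variable (E : Type*) [NormedAddCommGroup E] [NormedSpace ℝ E]
  (M : Type*) [TopologicalSpace M] [ChartedSpace E M] [IsManifold 𝓘(ℝ, E) ∞ M]

/-- A smooth semi-Riemannian metric on `M`: a smooth field of non-degenerate symmetric bilinear
forms on the tangent spaces. -/
structure SemiRiemannianMetric where
  val (p : M) : TangentSpace 𝓘(ℝ, E) p →L[ℝ] TangentSpace 𝓘(ℝ, E) p →L[ℝ] ℝ
  symm (p : M) (v w : TangentSpace 𝓘(ℝ, E) p) : val p v w = val p w v
  nondegenerate (p : M) (v : TangentSpace 𝓘(ℝ, E) p) (hv : ∀ w, val p v w = 0) : v = 0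
  contMDiff : ContMDiff 𝓘(ℝ, E) (𝓘(ℝ, E).prod 𝓘(ℝ, E →L[ℝ] E →L[ℝ] ℝ)) ∞
    (fun p ↦ TotalSpace.mk' (E →L[ℝ] E →L[ℝ] ℝ) p (val p))

end Metric

section Sections

variable {E : Type*} [NormedAddCommGroup E] [NormedSpace ℝ E]
  {M : Type*} [TopologicalSpace M] [ChartedSpace E M] [IsManifold 𝓘(ℝ, E) ∞ M]
  {F : Type*} [NormedAddCommGroup F] [NormedSpace ℝ F]
  {N : Type*} [TopologicalSpace N] [ChartedSpace F N]

/-- The vector field `X` on `M` is smooth on `U`. -/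
def SmoothOn (U : Set M) (X : ∀ p : M, TangentSpace 𝓘(ℝ, E) p) : Prop :=
  ContMDiffOn 𝓘(ℝ, E) 𝓘(ℝ, E).tangent ∞ (fun p ↦ (⟨p, X p⟩ : TangentBundle 𝓘(ℝ, E) M)) U

variable (F) in
/-- The vector field `ξ` along the map `φ : N → M` is smooth on `U`, where `N` is a manifold
modelled on `F`. -/
def SmoothAlongOn (φ : N → M) (U : Set N) (ξ : ∀ y : N, TangentSpace 𝓘(ℝ, E) (φ y)) : Prop :=
  ContMDiffOn 𝓘(ℝ, F) 𝓘(ℝ, E).tangent ∞ (fun y ↦ (⟨φ y, ξ y⟩ : TangentBundle 𝓘(ℝ, E) M)) U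

variable (F) in
/-- `ξ` is a smooth section over `U` of the family `S` of subspaces of the pull-back of `TM`
by `φ`. -/
structure IsSectionAlong (φ : N → M) (S : ∀ y : N, Submodule ℝ (TangentSpace 𝓘(ℝ, E) (φ y)))
    (U : Set N) (ξ : ∀ y : N, TangentSpace 𝓘(ℝ, E) (φ y)) : Prop where
  smooth : SmoothAlongOn F φ U ξ
  mem : ∀ y ∈ U, ξ y ∈ S y

/-- `X` is a smooth section over `U` of the family `D` of tangent subspaces. -/
structure IsSection (D : ∀ p : M, Submodule ℝ (TangentSpace 𝓘(ℝ, E) p)) (U : Set M)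
    (X : ∀ p : M, TangentSpace 𝓘(ℝ, E) p) : Prop where
  smooth : SmoothOn U X
  mem : ∀ p ∈ U, X p ∈ D p

/-- A smooth distribution (a smooth subbundle of the tangent bundle): near each point it has a
smooth frame. -/
def IsDistribution (D : ∀ p : M, Submodule ℝ (TangentSpace 𝓘(ℝ, E) p)) : Prop :=
  ∀ p : M, ∃ U : Set M, IsOpen U ∧ p ∈ U ∧
    ∃ (r : ℕ) (X : Fin r → ∀ q : M, TangentSpace 𝓘(ℝ, E) q),
      (∀ i, SmoothOn U (X i)) ∧
      ∀ q ∈ U, LinearIndependent ℝ (fun i ↦ X i q) ∧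
        Submodule.span ℝ (Set.range fun i ↦ X i q) = D q

end Sections

section LeviCivita

variable {E : Type*} [NormedAddCommGroup E] [NormedSpace ℝ E]
  {M : Type*} [TopologicalSpace M] [ChartedSpace E M] [IsManifold 𝓘(ℝ, E) ∞ M]
  {F : Type*} [NormedAddCommGroup F] [NormedSpace ℝ F]
  {N : Type*} [TopologicalSpace N] [ChartedSpace F N]

/-- The linear map `T_q M → E` reading tangent vectors at `q` in the preferred chart at `p`. -/
def toCoord (p q : M) : TangentSpace 𝓘(ℝ, E) q →L[ℝ] E :=
  (trivializationAt E (TangentSpace 𝓘(ℝ, E)) p).continuousLinearMapAt ℝ q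

/-- The linear map `E → T_q M`, inverse to `toCoord p q` for `q` in the domain of the preferred
chart at `p`. -/
def ofCoord (p q : M) : E →L[ℝ] TangentSpace 𝓘(ℝ, E) q :=
  (trivializationAt E (TangentSpace 𝓘(ℝ, E)) p).symmL ℝ q

namespace SemiRiemannianMetric

variable (g : SemiRiemannianMetric E M)

/-- The bilinear form on `T_p M`. -/
def form (p : M) : TangentSpace 𝓘(ℝ, E) p →ₗ[ℝ] TangentSpace 𝓘(ℝ, E) p →ₗ[ℝ] ℝ :=
  LinearMap.mk₂ ℝ (fun v w ↦ g.val p v w) (by simp) (by simp) (by simp) (by simp)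

/-- The matrix of the metric at `q` in the preferred chart at `p`. -/
def coeff (p q : M) : E →L[ℝ] E →L[ℝ] ℝ :=
  ((ofCoord p q).precomp ℝ).comp ((g.val q).comp (ofCoord p q))

/-- The derivative at `p`, in the direction `v`, of the matrix of the metric in the preferred
chart at `p`. -/
def dcoeff (p : M) : TangentSpace 𝓘(ℝ, E) p →L[ℝ] (E →L[ℝ] E →L[ℝ] ℝ) :=
  mvfderiv 𝓘(ℝ, E) (g.coeff p) p

/-- The functional
`z ↦ (∂_v g(w, z) + ∂_w g(v, z) - ∂_z g(v, w)) / 2` in the preferred chart at `p`. -/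
def koszul (p : M) (v w : TangentSpace 𝓘(ℝ, E) p) : TangentSpace 𝓘(ℝ, E) p →ₗ[ℝ] ℝ where
  toFun z := (g.dcoeff p v (toCoord p p w) (toCoord p p z)
    + g.dcoeff p w (toCoord p p v) (toCoord p p z)
    - g.dcoeff p z (toCoord p p v) (toCoord p p w)) / 2
  map_add' z z' := by
    rw [(toCoord p p).map_add, (g.dcoeff p).map_add, ContinuousLinearMap.map_add,
      ContinuousLinearMap.map_add, add_apply, add_apply]
    ring
  map_smul' c z := by
    rw [(toCoord p p).map_smul, (g.dcoeff p).map_smul, ContinuousLinearMap.map_smul,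
      ContinuousLinearMap.map_smul, smul_apply,
      smul_apply]
    simp only [smul_eq_mul, RingHom.id_apply]
    ring

variable [FiniteDimensional ℝ E]

instance (p : M) : FiniteDimensional ℝ (TangentSpace 𝓘(ℝ, E) p) :=
  inferInstanceAs (FiniteDimensional ℝ E)

/-- The Christoffel symbols `v^i w^j Γ^k_{ij}` at `p` in the preferred chart at `p`. -/
def christoffel (p : M) (v w : TangentSpace 𝓘(ℝ, E) p) : TangentSpace 𝓘(ℝ, E) p :=
  sharp (g.form p) (g.nondegenerate p) (g.koszul p v w)

/-- The Levi-Civita connection of `g` on vector fields along a map `φ : N → M`: the covariant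
derivative `∇_u ξ` at `x`, in the direction `u ∈ T_x N`, of the vector field `ξ` along `φ`. In the
preferred chart at `φ x` its components are `u(ξ^k) + (φ_* u)^i ξ^j Γ^k_{ij}`. -/
def covAlong (φ : N → M) (ξ : ∀ y : N, TangentSpace 𝓘(ℝ, E) (φ y)) (x : N)
    (u : TangentSpace 𝓘(ℝ, F) x) : TangentSpace 𝓘(ℝ, E) (φ x) :=
  ofCoord (φ x) (φ x)
      (mvfderiv 𝓘(ℝ, F) (fun y ↦ toCoord (φ x) (φ y) (ξ y)) x u)
    + g.christoffel (φ x) (mfderiv 𝓘(ℝ, F) 𝓘(ℝ, E) φ x u) (ξ x)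

/-- The Levi-Civita connection of `g`: the covariant derivative `∇_v Y` at `p` of the vector field
`Y` on `M`. -/
def cov (Y : ∀ q : M, TangentSpace 𝓘(ℝ, E) q) (p : M) (v : TangentSpace 𝓘(ℝ, E) p) :
    TangentSpace 𝓘(ℝ, E) p :=
  g.covAlong (id : M → M) Y p v

end SemiRiemannianMetric

end LeviCivita

/-! ### Paraquaternionic structures -/

section Paraquaternionic

variable {E : Type*} [NormedAddCommGroup E] [NormedSpace ℝ E]
  {M : Type*} [TopologicalSpace M] [ChartedSpace E M] [IsManifold 𝓘(ℝ, E) ∞ M]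

/-- The signs `ε₁ = 1`, `ε₂ = ε₃ = -1`; the indices `1, 2, 3` modulo `3` are written
`0, 1, 2 : Fin 3`. -/
def eps : Fin 3 → ℝ := ![1, -1, -1]

/-- The field `S` of endomorphisms of the tangent spaces is smooth on `U`. -/
def SmoothEndOn (U : Set M)
    (S : ∀ p : M, TangentSpace 𝓘(ℝ, E) p →L[ℝ] TangentSpace 𝓘(ℝ, E) p) : Prop :=
  ContMDiffOn 𝓘(ℝ, E) (𝓘(ℝ, E).prod 𝓘(ℝ, E →L[ℝ] E)) ∞
    (fun p ↦ TotalSpace.mk' (E →L[ℝ] E) (E := fun q : M ↦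
      TangentSpace 𝓘(ℝ, E) q →L[ℝ] TangentSpace 𝓘(ℝ, E) q) p (S p)) U

/-- `J 0, J 1, J 2` is a canonical local basis on the open set `U` of the family `σ` of spaces of
endomorphisms. -/
structure IsCanonicalBasis
    (σ : ∀ p : M, Submodule ℝ (TangentSpace 𝓘(ℝ, E) p →L[ℝ] TangentSpace 𝓘(ℝ, E) p))
    (U : Set M)
    (J : Fin 3 → ∀ p : M, TangentSpace 𝓘(ℝ, E) p →L[ℝ] TangentSpace 𝓘(ℝ, E) p) : Prop where
  isOpen : IsOpen U
  smooth : ∀ α, SmoothEndOn U (J α)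
  linearIndependent : ∀ p ∈ U, LinearIndependent ℝ (fun α ↦ J α p)
  span_eq : ∀ p ∈ U, Submodule.span ℝ (Set.range fun α ↦ J α p) = σ p
  sq : ∀ p ∈ U, ∀ α v, J α p (J α p v) = -(eps α • v)
  mul_succ : ∀ p ∈ U, ∀ α v, J α p (J (α + 1) p v) = eps (α + 2) • J (α + 2) p v
  succ_mul : ∀ p ∈ U, ∀ α v, J (α + 1) p (J α p v) = -(eps (α + 2) • J (α + 2) p v)

/-- `σ` is an almost paraquaternionic structure on `M`: a rank-3 subbundle of `End(TM)` with
canonical local bases. -/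
def IsAlmostParaquaternionic
    (σ : ∀ p : M, Submodule ℝ (TangentSpace 𝓘(ℝ, E) p →L[ℝ] TangentSpace 𝓘(ℝ, E) p)) : Prop :=
  ∀ p : M, ∃ U : Set M, p ∈ U ∧ ∃ J, IsCanonicalBasis σ U J

/-- The metric `g` is adapted to `σ`. -/
def IsAdapted (g : SemiRiemannianMetric E M)
    (σ : ∀ p : M, Submodule ℝ (TangentSpace 𝓘(ℝ, E) p →L[ℝ] TangentSpace 𝓘(ℝ, E) p)) : Prop :=
  ∀ U J, IsCanonicalBasis σ U J → ∀ p ∈ U, ∀ α v w,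
    g.val p (J α p v) (J α p w) = eps α * g.val p v w

variable [FiniteDimensional ℝ E]

/-- `σ` is parallel with respect to the Levi-Civita connection: for each local section `S` of `σ`
and each tangent vector `v` at `p`, the endomorphism `∇_v S`, given by
`(∇_v S) Y = ∇_v (S Y) - S (∇_v Y)`, belongs to `σ p`. -/
def IsParallel (g : SemiRiemannianMetric E M)
    (σ : ∀ p : M, Submodule ℝ (TangentSpace 𝓘(ℝ, E) p →L[ℝ] TangentSpace 𝓘(ℝ, E) p)) : Prop :=
  ∀ (U : Set M) (S : ∀ p : M, TangentSpace 𝓘(ℝ, E) p →L[ℝ] TangentSpace 𝓘(ℝ, E) p),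
    IsOpen U → SmoothEndOn U S → (∀ p ∈ U, S p ∈ σ p) →
    ∀ p ∈ U, ∀ v : TangentSpace 𝓘(ℝ, E) p, ∃ T ∈ σ p,
      ∀ (W : Set M) (Y : ∀ q : M, TangentSpace 𝓘(ℝ, E) q),
        IsOpen W → p ∈ W → SmoothOn W Y →
        g.cov (fun q ↦ S q (Y q)) p v - S p (g.cov Y p v) = T (Y p)

/-- `(M, σ, g)` is a paraquaternionic Kähler manifold. -/
structure IsParaquaternionicKahler (g : SemiRiemannianMetric E M)
    (σ : ∀ p : M, Submodule ℝ (TangentSpace 𝓘(ℝ, E) p →L[ℝ] TangentSpace 𝓘(ℝ, E) p)) :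
    Prop where
  almost : IsAlmostParaquaternionic σ
  adapted : IsAdapted g σ
  parallel : IsParallel g σ

end Paraquaternionic

/-! ### Non-degenerate submanifolds -/

section Submanifold

variable {E : Type*} [NormedAddCommGroup E] [NormedSpace ℝ E]
  {M : Type*} [TopologicalSpace M] [ChartedSpace E M] [IsManifold 𝓘(ℝ, E) ∞ M]

/-- `N` as a non-degenerate immersed submanifold of `(M, g)`, given by its immersion. -/
structure NondegSubmanifold (g : SemiRiemannianMetric E M)
    (F : Type*) [NormedAddCommGroup F] [NormedSpace ℝ F]
    (N : Type*) [TopologicalSpace N] [ChartedSpace F N] [IsManifold 𝓘(ℝ, F) ∞ N] where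
  toFun : N → M
  contMDiff : ContMDiff 𝓘(ℝ, F) 𝓘(ℝ, E) ∞ toFun
  immersion : ∀ x, Function.Injective (mfderiv 𝓘(ℝ, F) 𝓘(ℝ, E) toFun x)
  nondegenerate : ∀ x (u : TangentSpace 𝓘(ℝ, F) x),
    (∀ w : TangentSpace 𝓘(ℝ, F) x, g.val (toFun x) (mfderiv 𝓘(ℝ, F) 𝓘(ℝ, E) toFun x u)
      (mfderiv 𝓘(ℝ, F) 𝓘(ℝ, E) toFun x w) = 0) → u = 0

namespace NondegSubmanifold

variable {g : SemiRiemannianMetric E M}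
  {F : Type*} [NormedAddCommGroup F] [NormedSpace ℝ F]
  {N : Type*} [TopologicalSpace N] [ChartedSpace F N] [IsManifold 𝓘(ℝ, F) ∞ N]
  (f : NondegSubmanifold g F N)

/-- The differential of the immersion at `x`. -/
def d (x : N) : TangentSpace 𝓘(ℝ, F) x →L[ℝ] TangentSpace 𝓘(ℝ, E) (f.toFun x) :=
  mfderiv 𝓘(ℝ, F) 𝓘(ℝ, E) f.toFun x

/-- The induced metric on `N`. -/
def induced (x : N) : TangentSpace 𝓘(ℝ, F) x →ₗ[ℝ] TangentSpace 𝓘(ℝ, F) x →ₗ[ℝ] ℝ :=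
  LinearMap.mk₂ ℝ (fun u w ↦ g.val (f.toFun x) (f.d x u) (f.d x w))
    (by simp) (by simp) (by simp) (by simp)

/-- The normal space `T_x N^⊥`. -/
def normalSpace (x : N) : Submodule ℝ (TangentSpace 𝓘(ℝ, E) (f.toFun x)) where
  carrier := {ξ | ∀ u, g.val (f.toFun x) ξ (f.d x u) = 0}
  add_mem' ha hb u := by simp [ha u, hb u]
  zero_mem' u := by simp
  smul_mem' c ξ h u := by simp [h u]

variable [FiniteDimensional ℝ F]

/-- The tangential part of a vector `v` of `M` at a point of `N`: the vector of `T_x N` with the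
same scalar products as `v` with all vectors tangent to `N`. -/
def tangentPart (x : N) (v : TangentSpace 𝓘(ℝ, E) (f.toFun x)) : TangentSpace 𝓘(ℝ, F) x :=
  sharp (f.induced x) (f.nondegenerate x)
    ((g.val (f.toFun x) v).toLinearMap ∘ₗ (f.d x).toLinearMap)

/-- The normal part of a vector of `M` at a point of `N`. -/
def normalPart (x : N) (v : TangentSpace 𝓘(ℝ, E) (f.toFun x)) :
    TangentSpace 𝓘(ℝ, E) (f.toFun x) :=
  v - f.d x (f.tangentPart x v)

variable [FiniteDimensional ℝ E]

/-- The second fundamental form `B(X, Y)` at `x`: the normal part of `∇_X Y`, where `∇` is the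
Levi-Civita connection of `M`. -/
def secondFundamentalForm (X Y : ∀ y : N, TangentSpace 𝓘(ℝ, F) y) (x : N) :
    TangentSpace 𝓘(ℝ, E) (f.toFun x) :=
  f.normalPart x (g.covAlong f.toFun (fun y ↦ f.d y (Y y)) x (X x))

/-- The shape operator `A_ξ X` at `x`: minus the tangential part of `∇_X ξ`. -/
def shape (ξ : ∀ y : N, TangentSpace 𝓘(ℝ, E) (f.toFun y)) (X : ∀ y : N, TangentSpace 𝓘(ℝ, F) y)
    (x : N) : TangentSpace 𝓘(ℝ, F) x :=
  -f.tangentPart x (g.covAlong f.toFun ξ x (X x))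

/-- The normal connection `∇^⊥_X ξ` at `x`: the normal part of `∇_X ξ`. -/
def normalConnection (X : ∀ y : N, TangentSpace 𝓘(ℝ, F) y)
    (ξ : ∀ y : N, TangentSpace 𝓘(ℝ, E) (f.toFun y)) (x : N) :
    TangentSpace 𝓘(ℝ, E) (f.toFun x) :=
  f.normalPart x (g.covAlong f.toFun ξ x (X x))

/-- The submanifold is totally geodesic: its second fundamental form vanishes. -/
def IsTotallyGeodesic : Prop :=
  ∀ U : Set N, IsOpen U → ∀ X Y : ∀ y : N, TangentSpace 𝓘(ℝ, F) y,
    SmoothOn U X → SmoothOn U Y →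
    ∀ x ∈ U, f.secondFundamentalForm X Y x = 0

end NondegSubmanifold

end Submanifold

/-! ### Paraquaternionic CR-submanifolds -/

section CR

variable {E : Type*} [NormedAddCommGroup E] [NormedSpace ℝ E]
  {M : Type*} [TopologicalSpace M] [ChartedSpace E M] [IsManifold 𝓘(ℝ, E) ∞ M]
  {g : SemiRiemannianMetric E M}
  {F : Type*} [NormedAddCommGroup F] [NormedSpace ℝ F]
  {N : Type u} [TopologicalSpace N] [ChartedSpace F N] [IsManifold 𝓘(ℝ, F) ∞ N]

namespace NondegSubmanifold

variable (f : NondegSubmanifold g F N)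
  (σ : ∀ p : M, Submodule ℝ (TangentSpace 𝓘(ℝ, E) p →L[ℝ] TangentSpace 𝓘(ℝ, E) p))
  (D : ∀ x : N, Submodule ℝ (TangentSpace 𝓘(ℝ, F) x))

/-- `D^⊥`: the orthogonal complement of `D` in the tangent spaces of `N`. -/
def perp (x : N) : Submodule ℝ (TangentSpace 𝓘(ℝ, F) x) where
  carrier := {u | ∀ w ∈ D x, f.induced x u w = 0}
  add_mem' ha hb w hw := by simp [ha w hw, hb w hw]
  zero_mem' w _ := by simp
  smul_mem' c u h w hw := by simp [h w hw]

/-- `N` is a paraquaternionic CR-submanifold with paraquaternionic distribution `D`. -/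
structure IsParaquaternionicCR : Prop where
  isDistribution : IsDistribution D
  nondegenerate : ∀ x, ∀ u ∈ D x, (∀ w ∈ D x, f.induced x u w = 0) → u = 0
  paraquaternionic : ∀ U J, IsCanonicalBasis σ U J → ∀ x, f.toFun x ∈ U → ∀ α,
    ((D x).map (f.d x).toLinearMap).map (J α (f.toFun x)).toLinearMap
      = (D x).map (f.d x).toLinearMap
  totallyReal : ∀ U J, IsCanonicalBasis σ U J → ∀ x, f.toFun x ∈ U → ∀ α,
    ∀ z ∈ f.perp D x, J α (f.toFun x) (f.d x z) ∈ f.normalSpace x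

/-- `ν^⊥`: the space spanned by the vectors `S Z` with `S ∈ σ`, `Z ∈ D^⊥`, that is,
`J₁ D^⊥ + J₂ D^⊥ + J₃ D^⊥` for each canonical local basis. -/
def nuPerp (x : N) : Submodule ℝ (TangentSpace 𝓘(ℝ, E) (f.toFun x)) :=
  Submodule.span ℝ {η | ∃ S ∈ σ (f.toFun x), ∃ z ∈ f.perp D x, η = S (f.d x z)}

/-- `ν`: the orthogonal complement of `ν^⊥` in the normal space. -/
def nu (x : N) : Submodule ℝ (TangentSpace 𝓘(ℝ, E) (f.toFun x)) where
  carrier := {ξ | ξ ∈ f.normalSpace x ∧ ∀ η ∈ f.nuPerp σ D x, g.val (f.toFun x) ξ η = 0}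
  add_mem' ha hb := ⟨add_mem ha.1 hb.1, fun η hη => by simp [ha.2 η hη, hb.2 η hη]⟩
  zero_mem' := ⟨zero_mem _, fun η _ => by simp⟩
  smul_mem' c ξ h := ⟨Submodule.smul_mem _ c h.1, fun η hη => by simp [h.2 η hη]⟩

end NondegSubmanifold

/-- `ι : L → N` is a connected immersed integral manifold of the distribution `D` on `N`. -/
structure IsIntegralManifold (D : ∀ x : N, Submodule ℝ (TangentSpace 𝓘(ℝ, F) x))
    {G : Type*} [NormedAddCommGroup G] [NormedSpace ℝ G]
    {L : Type*} [TopologicalSpace L] [ChartedSpace G L] (ι : L → N) : Prop where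
  connected : ConnectedSpace L
  contMDiff : ContMDiff 𝓘(ℝ, G) 𝓘(ℝ, F) ∞ ι
  injective : Function.Injective ι
  immersion : ∀ y, Function.Injective (mfderiv 𝓘(ℝ, G) 𝓘(ℝ, F) ι y)
  range_eq : ∀ y, (mfderiv 𝓘(ℝ, G) 𝓘(ℝ, F) ι y).range = D (ι y)

namespace NondegSubmanifold

variable (f : NondegSubmanifold g F N)
  (σ : ∀ p : M, Submodule ℝ (TangentSpace 𝓘(ℝ, E) p →L[ℝ] TangentSpace 𝓘(ℝ, E) p))
  (D : ∀ x : N, Submodule ℝ (TangentSpace 𝓘(ℝ, F) x))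
  [FiniteDimensional ℝ E] [FiniteDimensional ℝ F]

/-- `N` is totally real ruled: `D^⊥` is the tangent distribution of a foliation of `N`, that is,
there is an integral manifold of `D^⊥` through each point, and the leaves of this foliation are
totally geodesic immersed submanifolds of `M`. The leaves are the maximal connected integral
manifolds; the condition is imposed on every connected integral manifold. -/
def IsTotallyRealRuled : Prop :=
  (∀ x : N, ∃ (s : ℕ) (L : Type u) (_ : TopologicalSpace L)
    (_ : ChartedSpace (EuclideanSpace ℝ (Fin s)) L)
    (_ : IsManifold 𝓘(ℝ, EuclideanSpace ℝ (Fin s)) ∞ L) (ι : L → N),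
    IsIntegralManifold (G := EuclideanSpace ℝ (Fin s)) (f.perp D) ι ∧ x ∈ Set.range ι) ∧
  ∀ (s : ℕ) (L : Type u) [TopologicalSpace L] [ChartedSpace (EuclideanSpace ℝ (Fin s)) L]
    [IsManifold 𝓘(ℝ, EuclideanSpace ℝ (Fin s)) ∞ L] (ι : L → N),
    IsIntegralManifold (G := EuclideanSpace ℝ (Fin s)) (f.perp D) ι →
    ∃ h : NondegSubmanifold g (EuclideanSpace ℝ (Fin s)) L,
      h.toFun = f.toFun ∘ ι ∧ h.IsTotallyGeodesic

/-- `B(X, Y) = 0` for all sections `X, Y` of `D^⊥`. -/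
def IsPerpGeodesic : Prop :=
  ∀ U : Set N, IsOpen U → ∀ X Y : ∀ y : N, TangentSpace 𝓘(ℝ, F) y,
    IsSection (f.perp D) U X → IsSection (f.perp D) U Y →
    ∀ x ∈ U, f.secondFundamentalForm X Y x = 0

end NondegSubmanifold

end CR

end PQ

end

open scoped Manifold ContDiff Topology
open Bundle

noncomputable section

/-! All four assertions are compared with one pointwise condition, `SecondFormCondition`: for `u` in
`D^⊥`, the map `B(u, ·)` has values in `ν` and vanishes on `D^⊥`.

Along `N` there is an orthogonal splitting `TM = D ⊕ D^⊥ ⊕ ν^⊥ ⊕ ν`, and each `J_α` preserves `D`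
and `ν` and sends `D^⊥` into `ν^⊥`. The form `B` is a symmetric tensor, and vectors of `D`, `D^⊥`
and `ν` extend to local sections, so conditions on sections are conditions at points.

Assertion (ii) is then the pointwise condition up to splitting the tangent argument. Assertion (iv)
is its dual under `g(A_ξ X, w) = g(ξ, B(X, w))`. For (iii), parallelism of `σ` gives `∇_X(J_α Z) =
J_α ∇_X Z` modulo `ν^⊥`; once `B(X, Z)` is in `ν`, the `ν`-component of `∇^⊥_X(J_α Z)` is `J_α B(X,
Z)`, which vanishes only with `B(X, Z)`.

For (i) the intermediate notion is `IsPerpParallel`: `∇_u Z` is in `D^⊥` for `u` in `D^⊥` and `Z` a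
section of `D^⊥`. It is tied to `B` by `val_covAlong_apply`, that is, `g(∇_u Z, J_α w) = g(J_α Z,
B(u, w))`: since `J_α D = D`, the `D`-component of `∇_u Z` is governed by the `ν^⊥`-component of
`B(u, ·)` on `D`. If `D^⊥` is parallel in this sense, it is involutive because the connection is
torsion-free, Frobenius' theorem gives the leaves, and derivatives along a leaf stay tangent to it,
so the leaves are totally geodesic. Conversely, sections of `D^⊥` restrict to the leaves, where
total geodesy keeps their derivatives tangent.

Frobenius' theorem is proved from the total differential equation `Du = A(u)`, solved along rays by
ordinary differential equations (`exists_hasFDerivAt_total`). -/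

namespace PQ

universe u

/-! ### Total differential equations `Du = A(u)`. -/

section TotalDifferentialEquation

open Metric Set

variable {V : Type*} [NormedAddCommGroup V] [NormedSpace ℝ V]
  {F : Type*} [NormedAddCommGroup F] [NormedSpace ℝ F]

/-- Linearity in the error `ε` turns an error of order `‖h‖²` in the equation into one of order
`‖h‖²` in the solution. -/
theorem gronwallBound_zero_left (K ε x : ℝ) :
    gronwallBound 0 K ε x = ε * gronwallBound 0 K 1 x := by
  unfold gronwallBound
  split_ifs <;> ring

/-- The Picard-Lindelöf theorem, with a solution that stays in the closed ball. -/
theorem exists_hasDerivWithinAt_mem_closedBall [CompleteSpace F] {f : ℝ → F → F} {tmin tmax : ℝ}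
    {t₀ : Icc tmin tmax} {x₀ : F} {a L K : NNReal} (hf : IsPicardLindelof f t₀ x₀ a 0 L K) :
    ∃ c : ℝ → F, c t₀ = x₀ ∧ (∀ t, c t ∈ closedBall x₀ a) ∧
      ∀ t ∈ Icc tmin tmax, HasDerivWithinAt c (f t (c t)) (Icc tmin tmax) t := by
  have hx : x₀ ∈ closedBall x₀ ((0 : NNReal) : ℝ) := mem_closedBall_self le_rfl
  obtain ⟨α, hα⟩ := ODE.FunSpace.exists_isFixedPt_next hf hx
  refine ⟨α.compProj, by rw [ODE.FunSpace.compProj_val, ← hα, ODE.FunSpace.next_apply₀],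
    fun t ↦ α.compProj_mem_closedBall hf.mul_max_le, fun t ht ↦ ?_⟩
  apply ODE.hasDerivWithinAt_picard_Icc t₀.2 hf.continuousOn_uncurry
    α.continuous_compProj.continuousOn (fun _ ht' ↦ α.compProj_mem_closedBall hf.mul_max_le)
    x₀ ht |>.congr_of_mem _ ht
  intro t' ht'
  nth_rw 1 [← hα]
  rw [ODE.FunSpace.compProj_of_mem ht', ODE.FunSpace.next_apply]

/-- The pointwise estimate behind the theorem of Frobenius: if `A` satisfies the integrability
condition at `q`, then `A q x + A q h + t A'(q)(A q x) h` is close to `A (q + t A q h) (x + h)`. -/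
theorem norm_total_error_le {A : F → V →L[ℝ] F} {q₀ q : F} {R C K K' : ℝ}
    (hd : ∀ p ∈ ball q₀ R, DifferentiableAt ℝ A p)
    (hC : ∀ p ∈ ball q₀ R, ‖A p‖ ≤ C) (hK : ∀ p ∈ ball q₀ R, ‖fderiv ℝ A p‖ ≤ K)
    (hK' : ∀ p ∈ ball q₀ R, ∀ p' ∈ ball q₀ R, ‖fderiv ℝ A p - fderiv ℝ A p'‖ ≤ K' * ‖p - p'‖)
    (hK'0 : 0 ≤ K')
    (hs : ∀ p ∈ ball q₀ R, ∀ h k, fderiv ℝ A p (A p h) k = fderiv ℝ A p (A p k) h)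
    (hq : q ∈ ball q₀ R) {t : ℝ} (ht : t ∈ Icc (0 : ℝ) 1) {x h : V}
    (hqh : q + t • A q h ∈ ball q₀ R) (hxh : ‖x + h‖ ≤ 1) :
    ‖(A q x + (A q h + t • fderiv ℝ A q (A q x) h)) - A (q + t • A q h) (x + h)‖
      ≤ (K * C + K' * C ^ 2) * ‖h‖ ^ 2 := by
  set w := t • A q h with hw
  have hC0 : 0 ≤ C := (norm_nonneg _).trans (hC q hq)
  have hK0 : 0 ≤ K := (norm_nonneg (fderiv ℝ A q)).trans (hK q hq)
  have hwn : ‖w‖ ≤ C * ‖h‖ := by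
    rw [hw, norm_smul, Real.norm_of_nonneg ht.1]
    calc t * ‖A q h‖ ≤ 1 * (C * ‖h‖) := by
          refine mul_le_mul ht.2 ((A q).le_of_opNorm_le (hC q hq) h) (norm_nonneg _) zero_le_one
      _ = _ := one_mul _
  have hseg : segment ℝ q (q + w) ⊆ ball q₀ R := (convex_ball q₀ R).segment_subset hq hqh
  have hT : ‖A (q + w) - A q - fderiv ℝ A q (q + w - q)‖ ≤ (K' * ‖w‖) * ‖q + w - q‖ := by
    refine Convex.norm_image_sub_le_of_norm_fderiv_le' (𝕜 := ℝ) (s := segment ℝ q (q + w))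
      (fun y hy ↦ hd y (hseg hy)) (fun y hy ↦ ?_) (convex_segment _ _)
      (left_mem_segment ℝ _ _) (right_mem_segment ℝ _ _)
    refine (hK' y (hseg hy) q hq).trans ?_
    gcongr
    obtain ⟨θ, hθ, rfl⟩ := (segment_eq_image' ℝ q (q + w)) ▸ hy
    rw [add_sub_cancel_left, add_sub_cancel_left, norm_smul, Real.norm_of_nonneg hθ.1]
    exact mul_le_of_le_one_left (norm_nonneg _) hθ.2
  rw [add_sub_cancel_left] at hT
  set ρ := A (q + w) - A q - fderiv ℝ A q w with hρ
  have hAqw : A (q + w) = A q + fderiv ℝ A q w + ρ := by rw [hρ]; abel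
  -- By the integrability condition the terms `t A'(q)(A q x) h` and `A'(q) w x` cancel; the two
  -- that remain are quadratic in `h`.
  have key : (A q x + (A q h + t • fderiv ℝ A q (A q x) h)) - A (q + w) (x + h)
      = -(fderiv ℝ A q w h + ρ (x + h)) := by
    rw [hAqw, hs q hq x h]
    simp only [add_apply, map_add, hw, map_smul, smul_apply]
    module
  rw [key, norm_neg]
  have h1 : ‖fderiv ℝ A q w h‖ ≤ K * C * ‖h‖ ^ 2 := by
    calc ‖fderiv ℝ A q w h‖ ≤ ‖fderiv ℝ A q w‖ * ‖h‖ := ContinuousLinearMap.le_opNorm _ _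
      _ ≤ (K * (C * ‖h‖)) * ‖h‖ := by
          gcongr
          exact ((fderiv ℝ A q).le_of_opNorm_le (hK q hq) w).trans (by gcongr)
      _ = _ := by ring
  have h2 : ‖ρ (x + h)‖ ≤ K' * C ^ 2 * ‖h‖ ^ 2 := by
    calc ‖ρ (x + h)‖ ≤ ‖ρ‖ * ‖x + h‖ := ContinuousLinearMap.le_opNorm _ _
      _ ≤ ‖ρ‖ * 1 := by gcongr
      _ = ‖ρ‖ := mul_one _
      _ ≤ _ := hT
      _ ≤ (K' * (C * ‖h‖)) * (C * ‖h‖) := by gcongr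
      _ = _ := by ring
  calc _ ≤ _ := norm_add_le _ _
    _ ≤ _ := add_le_add h1 h2
    _ = _ := by ring

/-- The value `u x` is the time-one value of the solution of `c' = A(c) x` starting at `q₀`. By
`norm_total_error_le` the curve `c + t A(c) h` solves the equation for `x + h` up to `O(‖h‖²)`, so
Gronwall's inequality gives `u (x + h) = u x + A(u x) h + O(‖h‖²)`. -/
theorem exists_hasFDerivAt_total_of_bounds [CompleteSpace F] {A : F → V →L[ℝ] F} {q₀ : F}
    {R : ℝ} (hR : 0 < R) {C K K' : NNReal}
    (hd : ∀ p ∈ ball q₀ (2 * R), DifferentiableAt ℝ A p)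
    (hC : ∀ p ∈ ball q₀ (2 * R), ‖A p‖ ≤ C) (hK : ∀ p ∈ ball q₀ (2 * R), ‖fderiv ℝ A p‖ ≤ K)
    (hK' : ∀ p ∈ ball q₀ (2 * R), ∀ p' ∈ ball q₀ (2 * R),
      ‖fderiv ℝ A p - fderiv ℝ A p'‖ ≤ K' * ‖p - p'‖)
    (hs : ∀ p ∈ ball q₀ (2 * R), ∀ h k, fderiv ℝ A p (A p h) k = fderiv ℝ A p (A p k) h) :
    ∃ r > 0, ∃ u : V → F, u 0 = q₀ ∧
      ∀ x ∈ ball (0 : V) r, u x ∈ ball q₀ (2 * R) ∧ HasFDerivAt u (A (u x)) x := by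
  have hsub : closedBall q₀ R ⊆ ball q₀ (2 * R) := closedBall_subset_ball (by linarith)
  have hLipA : ∀ p ∈ ball q₀ (2 * R), ∀ p' ∈ ball q₀ (2 * R), ‖A p - A p'‖ ≤ K * ‖p - p'‖ :=
    fun p hp p' hp' ↦ (convex_ball q₀ _).norm_image_sub_le_of_norm_fderiv_le (𝕜 := ℝ)
      (fun y hy ↦ hd y hy) (fun y hy ↦ hK y hy) hp' hp
  have hLip : ∀ x : V, ‖x‖ ≤ 1 → LipschitzOnWith K (fun p ↦ A p x) (ball q₀ (2 * R)) := by
    intro x hx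
    refine LipschitzOnWith.of_dist_le_mul fun p hp p' hp' ↦ ?_
    rw [dist_eq_norm, dist_eq_norm, ← sub_apply]
    calc ‖(A p - A p') x‖ ≤ ‖A p - A p'‖ * ‖x‖ := ContinuousLinearMap.le_opNorm _ _
      _ ≤ ‖A p - A p'‖ * 1 := by gcongr
      _ ≤ _ := by rw [mul_one]; exact hLipA p hp p' hp'
  -- Speed at most `C r` keeps the solutions within `R` of `q₀` during unit time, and `‖x‖ ≤ 1`
  -- makes `K` a Lipschitz constant of `p ↦ A p x`. The margin from `R` to `2 R` is for the
  -- perturbed curves `c + t A(c) h`.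
  obtain ⟨r, hr, hr1, hrC⟩ : ∃ r > 0, r ≤ 1 ∧ C * r ≤ R := by
    refine ⟨min 1 (R / (C + 1)), by positivity, min_le_left _ _, ?_⟩
    calc (C : ℝ) * min 1 (R / (C + 1)) ≤ (C + 1) * (R / (C + 1)) := by
          gcongr
          · linarith
          · exact min_le_right _ _
      _ = R := by field_simp
  have hsol : ∀ x : V, ∃ c : ℝ → F, ‖x‖ ≤ r → c 0 = q₀ ∧ (∀ t, c t ∈ closedBall q₀ R) ∧
      ∀ t ∈ Icc (0 : ℝ) 1, HasDerivWithinAt c (A (c t) x) (Icc 0 1) t := by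
    intro x
    by_cases hx : ‖x‖ ≤ r
    swap
    · exact ⟨fun _ ↦ q₀, fun h ↦ absurd h hx⟩
    have hPL : IsPicardLindelof (fun _ p ↦ A p x) (tmin := 0) (tmax := 1)
        ⟨0, by simp⟩ q₀ ⟨R, hR.le⟩ 0 ⟨C * r, by positivity⟩ K :=
      { lipschitzOnWith := fun t _ ↦ (hLip x (hx.trans hr1)).mono hsub
        continuousOn := fun p _ ↦ continuousOn_const
        norm_le := fun t _ p hp ↦ by
          change ‖A p x‖ ≤ C * r
          exact ((A p).le_of_opNorm_le (hC p (hsub hp)) x).trans (by gcongr)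
        mul_max_le := by
          change (C : ℝ) * r * max (1 - 0) (0 - 0) ≤ R - 0
          simpa using hrC }
    obtain ⟨c, h0, h1, h2⟩ := exists_hasDerivWithinAt_mem_closedBall hPL
    exact ⟨c, fun _ ↦ ⟨h0, h1, h2⟩⟩
  choose c hc using hsol
  refine ⟨r, hr, fun x ↦ c x 1, ?_, fun x hx ↦ ?_⟩
  · obtain ⟨h0, -, h2⟩ := hc 0 (by simpa using hr.le)
    have := constant_of_has_deriv_right_zero (f := c 0) (a := 0) (b := 1)
      (fun t ht ↦ (h2 t ht).continuousWithinAt)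
      (fun t ht ↦ by
        have := h2 t (Ico_subset_Icc_self ht)
        rw [map_zero] at this
        exact (this.mono_of_mem_nhdsWithin (Icc_mem_nhdsGE_of_mem ht)))
      1 (by simp)
    exact this.trans h0
  have hxr : ‖x‖ < r := by simpa using hx
  obtain ⟨h0, h1, h2⟩ := hc x hxr.le
  refine ⟨hsub (h1 1), ?_⟩
  set M : ℝ := K * C + K' * C ^ 2 with hM
  set G : ℝ := gronwallBound 0 K 1 1 with hG
  have hest : ∀ᶠ h in 𝓝 (0 : V), ‖c (x + h) 1 - c x 1 - A (c x 1) h‖ ≤ (M * G) * ‖h‖ ^ 2 := by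
    have e1 : ∀ᶠ h in 𝓝 (0 : V), ‖x + h‖ < r :=
      (Continuous.tendsto' (by fun_prop) _ _ (by simp)).eventually_lt_const hxr
    have e2 : ∀ᶠ h in 𝓝 (0 : V), C * ‖h‖ < R :=
      (Continuous.tendsto' (by fun_prop) _ _ (by simp)).eventually_lt_const hR
    filter_upwards [e1, e2] with h hxh hCh
    obtain ⟨k0, k1, k2⟩ := hc (x + h) hxh.le
    have hemem : ∀ t ∈ Icc (0 : ℝ) 1, c x t + t • A (c x t) h ∈ ball q₀ (2 * R) := by
      intro t ht
      rw [mem_ball_iff_norm]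
      have a1 : ‖c x t - q₀‖ ≤ R := mem_closedBall_iff_norm.1 (h1 t)
      have a2 : ‖t • A (c x t) h‖ ≤ C * ‖h‖ := by
        rw [norm_smul, Real.norm_of_nonneg ht.1]
        exact (mul_le_of_le_one_left (norm_nonneg _) ht.2).trans
          ((A _).le_of_opNorm_le (hC _ (hsub (h1 t))) h)
      calc ‖c x t + t • A (c x t) h - q₀‖ = ‖(c x t - q₀) + t • A (c x t) h‖ := by congr 1; abel
        _ ≤ _ := norm_add_le _ _
        _ < 2 * R := by linarith
    have hder : ∀ t ∈ Icc (0 : ℝ) 1, HasDerivWithinAt (fun t ↦ c x t + t • A (c x t) h)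
        (A (c x t) x + (A (c x t) h + t • fderiv ℝ A (c x t) (A (c x t) x) h)) (Icc 0 1) t := by
      intro t ht
      have hA : HasDerivWithinAt (fun t ↦ A (c x t) h) (fderiv ℝ A (c x t) (A (c x t) x) h)
          (Icc 0 1) t := by
        have := (hd _ (hsub (h1 t))).hasFDerivAt.comp_hasDerivWithinAt t (h2 t ht)
        simpa using this.clm_apply (hasDerivWithinAt_const t _ h)
      have := (h2 t ht).add ((hasDerivWithinAt_id t _).smul hA)
      refine this.congr_deriv ?_
      simp only [id, one_smul]
      abel
    -- Both curves start at `q₀`, hence `δ = 0`; the second is an exact solution, hence `εg = 0`.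
    have hgr := dist_le_of_approx_trajectories_ODE_of_mem (K := K) (a := 0) (b := 1)
      (v := fun _ p ↦ A p (x + h)) (s := fun _ ↦ ball q₀ (2 * R))
      (f := fun t ↦ c x t + t • A (c x t) h)
      (f' := fun t ↦ A (c x t) x + (A (c x t) h + t • fderiv ℝ A (c x t) (A (c x t) x) h))
      (g := c (x + h)) (g' := fun t ↦ A (c (x + h) t) (x + h)) (δ := 0) (εg := 0)
      (εf := M * ‖h‖ ^ 2)
      (fun t _ ↦ hLip _ (hxh.le.trans hr1))
      (fun t ht ↦ (hder t ht).continuousWithinAt)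
      (fun t ht ↦ (hder t (Ico_subset_Icc_self ht)).mono_of_mem_nhdsWithin
        (Icc_mem_nhdsGE_of_mem ht))
      (fun t ht ↦ by
        rw [dist_eq_norm]
        exact norm_total_error_le hd hC hK hK' K'.2 hs (hsub (h1 t)) (Ico_subset_Icc_self ht)
          (hemem t (Ico_subset_Icc_self ht)) (hxh.le.trans hr1))
      (fun t ht ↦ hemem t (Ico_subset_Icc_self ht))
      (fun t ht ↦ (k2 t ht).continuousWithinAt)
      (fun t ht ↦ (k2 t (Ico_subset_Icc_self ht)).mono_of_mem_nhdsWithin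
        (Icc_mem_nhdsGE_of_mem ht))
      (fun t _ ↦ by simp) (fun t _ ↦ hsub (k1 t)) (by simp [h0, k0]) 1 (by simp)
    rw [sub_zero, add_zero, gronwallBound_zero_left, ← hG, one_smul, dist_eq_norm,
      ← norm_neg] at hgr
    calc _ = ‖-(c x 1 + A (c x 1) h - c (x + h) 1)‖ := by congr 1; abel
      _ ≤ _ := hgr
      _ = _ := by ring
  rw [hasFDerivAt_iff_isLittleO_nhds_zero]
  have hbig : (fun h : V ↦ c (x + h) 1 - c x 1 - A (c x 1) h) =O[𝓝 0] fun h ↦ ‖h‖ ^ 2 :=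
    Asymptotics.IsBigO.of_bound (M * G) (hest.mono fun h hh ↦ by simpa using hh)
  exact hbig.trans_isLittleO (Asymptotics.isLittleO_norm_pow_id one_lt_two)

/-- **Frobenius' theorem** for a total differential equation `Du = A(u)` satisfying the
integrability condition. -/
theorem exists_hasFDerivAt_total [CompleteSpace F] {A : F → V →L[ℝ] F} {U : Set F} {q₀ : F}
    (hU : IsOpen U) (hq₀ : q₀ ∈ U) (hA : ContDiffOn ℝ ∞ A U)
    (hs : ∀ p ∈ U, ∀ h k, fderiv ℝ A p (A p h) k = fderiv ℝ A p (A p k) h) :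
    ∃ r > 0, ∃ u : V → F, u 0 = q₀ ∧ ContDiffOn ℝ ∞ u (ball 0 r) ∧
      ∀ x ∈ ball (0 : V) r, u x ∈ U ∧ HasFDerivAt u (A (u x)) x := by
  have hA₀ : ContDiffAt ℝ ∞ A q₀ := hA.contDiffAt (hU.mem_nhds hq₀)
  obtain ⟨K, s, hsn, hsK⟩ := (hA₀.of_le (by simp)  : ContDiffAt ℝ 1 A q₀).exists_lipschitzOnWith
  obtain ⟨K', s', hsn', hsK'⟩ :=
    (hA₀.fderiv_right (m := 1) (by norm_cast)).exists_lipschitzOnWith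
  obtain ⟨C, hC⟩ : ∃ C : NNReal, ∀ᶠ p in 𝓝 q₀, ‖A p‖ ≤ C := by
    refine ⟨⟨‖A q₀‖ + 1, by positivity⟩, ?_⟩
    exact (hA₀.continuousAt.norm.eventually_le_const (lt_add_one _))
  have hall : ∀ᶠ p in 𝓝 q₀, p ∈ U ∧ p ∈ interior s ∧ p ∈ s' ∧ ‖A p‖ ≤ C :=
    by
    filter_upwards [hU.mem_nhds hq₀, interior_mem_nhds.2 hsn, hsn', hC] with p h1 h2 h3 h4
    exact ⟨h1, h2, h3, h4⟩
  obtain ⟨ρ, hρ, hball⟩ := Metric.eventually_nhds_iff_ball.1 hall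
  have h2 : 2 * (ρ / 2) = ρ := by ring
  have hdU : ∀ p ∈ U, DifferentiableAt ℝ A p := fun p hp ↦
    (hA.contDiffAt (hU.mem_nhds hp)).differentiableAt (by simp)
  obtain ⟨r, hr, u, hu0, hu⟩ := exists_hasFDerivAt_total_of_bounds (A := A) (q₀ := q₀)
    (R := ρ / 2) (by positivity) (C := C) (K := K) (K' := K')
    (fun p hp ↦ hdU p (hball p (h2 ▸ hp)).1)
    (fun p hp ↦ (hball p (h2 ▸ hp)).2.2.2)
    (fun p hp ↦ norm_fderiv_le_of_lipschitzOn ℝ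
      (mem_interior_iff_mem_nhds.1 (hball p (h2 ▸ hp)).2.1) hsK)
    (fun p hp p' hp' ↦ by
      have := hsK'.dist_le_mul p (hball p (h2 ▸ hp)).2.2.1 p' (hball p' (h2 ▸ hp')).2.2.1
      simpa [dist_eq_norm] using this)
    (fun p hp ↦ hs p (hball p (h2 ▸ hp)).1)
  have hu' : ∀ x ∈ ball (0 : V) r, u x ∈ U ∧ HasFDerivAt u (A (u x)) x := fun x hx ↦
    ⟨(hball _ (h2 ▸ (hu x hx).1)).1, (hu x hx).2⟩
  refine ⟨r, hr, u, hu0, ?_, hu'⟩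
  -- Bootstrapping: if `u` is `C^n`, then so is `Du = A ∘ u`, and `u` is `C^(n+1)`.
  rw [contDiffOn_infty]
  intro n
  induction n with
  | zero =>
    rw [Nat.cast_zero, contDiffOn_zero]
    exact fun x hx ↦ (hu' x hx).2.continuousAt.continuousWithinAt
  | succ n ih =>
    rw [Nat.cast_succ, contDiffOn_succ_iff_fderiv_of_isOpen isOpen_ball]
    refine ⟨fun x hx ↦ (hu' x hx).2.differentiableAt.differentiableWithinAt, by simp, ?_⟩
    refine ContDiffOn.congr (f := fun x ↦ A (u x)) ?_ fun x hx ↦ (hu' x hx).2.fderiv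
    exact (hA.of_le (by exact_mod_cast le_top)).comp ih fun x hx ↦ (hu' x hx).1

end TotalDifferentialEquation

/-! ### Differentiation rules for vector-valued functions on manifolds. -/

section Calculus

variable {E : Type*} [NormedAddCommGroup E] [NormedSpace ℝ E]
  {M : Type*} [TopologicalSpace M] [ChartedSpace E M]
  {F : Type*} [NormedAddCommGroup F] [NormedSpace ℝ F]
  {N : Type*} [TopologicalSpace N] [ChartedSpace F N]
  {V W : Type*} [NormedAddCommGroup V] [NormedSpace ℝ V] [NormedAddCommGroup W] [NormedSpace ℝ W]

theorem mvfderiv_comp_map {φ : N → M} {h : M → V} {x : N} (hh : MDifferentiableAt 𝓘(ℝ, E) 𝓘(ℝ, V) h (φ x))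
    (hφ : MDifferentiableAt 𝓘(ℝ, F) 𝓘(ℝ, E) φ x) (u : TangentSpace 𝓘(ℝ, F) x) :
    mvfderiv 𝓘(ℝ, F) (fun y ↦ h (φ y)) x u
      = mvfderiv 𝓘(ℝ, E) h (φ x) (mfderiv 𝓘(ℝ, F) 𝓘(ℝ, E) φ x u) :=
  mfderiv_comp_apply x hh hφ u

theorem mvfderiv_comp_fderiv {h : N → V} {G : V → W} {x : N} (hG : DifferentiableAt ℝ G (h x))
    (hh : MDifferentiableAt 𝓘(ℝ, F) 𝓘(ℝ, V) h x) (u : TangentSpace 𝓘(ℝ, F) x) :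
    mvfderiv 𝓘(ℝ, F) (fun y ↦ G (h y)) x u = fderiv ℝ G (h x) (mvfderiv 𝓘(ℝ, F) h x u) := by
  have := mfderiv_comp_apply x (I'' := 𝓘(ℝ, W)) hG.mdifferentiableAt hh u
  rw [mfderiv_eq_fderiv] at this
  exact this

theorem mvfderiv_congr {h k : N → V} {x : N} (hk : h =ᶠ[𝓝 x] k) :
    mvfderiv 𝓘(ℝ, F) h x = mvfderiv 𝓘(ℝ, F) k x := by
  ext u
  have := congr($(hk.mfderiv_eq (I := 𝓘(ℝ, F)) (I' := 𝓘(ℝ, V))) u)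
  exact this

theorem mvfderiv_prodMk {h : N → V} {k : N → W} {x : N}
    (hh : MDifferentiableAt 𝓘(ℝ, F) 𝓘(ℝ, V) h x) (hk : MDifferentiableAt 𝓘(ℝ, F) 𝓘(ℝ, W) k x)
    (u : TangentSpace 𝓘(ℝ, F) x) :
    mvfderiv 𝓘(ℝ, F) (fun y ↦ (h y, k y)) x u
      = (mvfderiv 𝓘(ℝ, F) h x u, mvfderiv 𝓘(ℝ, F) k x u) := by
  have hp : MDifferentiableAt 𝓘(ℝ, F) 𝓘(ℝ, V × W) (fun y ↦ (h y, k y)) x := hh.prodMk_space hk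
  have h1 := mvfderiv_comp_fderiv (G := (Prod.fst : V × W → V)) differentiableAt_fst hp u
  have h2 := mvfderiv_comp_fderiv (G := (Prod.snd : V × W → W)) differentiableAt_snd hp u
  rw [fderiv_fst] at h1
  rw [fderiv_snd] at h2
  exact Prod.ext h1.symm h2.symm

theorem mvfderiv_clm_apply {B : N → V →L[ℝ] W} {w : N → V} {x : N}
    (hB : MDifferentiableAt 𝓘(ℝ, F) 𝓘(ℝ, V →L[ℝ] W) B x)
    (hw : MDifferentiableAt 𝓘(ℝ, F) 𝓘(ℝ, V) w x) (u : TangentSpace 𝓘(ℝ, F) x) :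
    mvfderiv 𝓘(ℝ, F) (fun y ↦ B y (w y)) x u
      = mvfderiv 𝓘(ℝ, F) B x u (w x) + B x (mvfderiv 𝓘(ℝ, F) w x u) := by
  have hG : DifferentiableAt ℝ (fun p : (V →L[ℝ] W) × V ↦ p.1 p.2) (B x, w x) :=
    (isBoundedBilinearMap_apply (𝕜 := ℝ) (E := V) (F := W)).differentiableAt _
  have h := mvfderiv_comp_fderiv (h := fun y ↦ (B y, w y)) (G := fun p ↦ p.1 p.2) hG
    (hB.prodMk_space hw) u
  rw [mvfderiv_prodMk hB hw] at h
  rw [h, (isBoundedBilinearMap_apply (𝕜 := ℝ) (E := V) (F := W)).fderiv]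
  simp [add_comm]

theorem mvfderiv_const_apply (c : V) (x : N) (u : TangentSpace 𝓘(ℝ, F) x) :
    mvfderiv 𝓘(ℝ, F) (fun _ : N ↦ c) x u = 0 := by
  rw [mvfderiv_const]; rfl

/-- A map to `E →L V` with `E` finite dimensional is smooth if its values are. -/
theorem contMDiffAt_clm_of_apply [FiniteDimensional ℝ V] {B : N → V →L[ℝ] W} {x : N}
    (h : ∀ v, ContMDiffAt 𝓘(ℝ, F) 𝓘(ℝ, W) ∞ (fun y ↦ B y v) x) :
    ContMDiffAt 𝓘(ℝ, F) 𝓘(ℝ, V →L[ℝ] W) ∞ B x := by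
  let b := Module.finBasis ℝ V
  have hB : B = fun y ↦ ∑ i, (ContinuousLinearMap.smulRightL ℝ V W
      (LinearMap.toContinuousLinearMap (b.coord i))) (B y (b i)) := by
    ext y v
    conv_lhs => rw [← b.sum_repr v, map_sum]
    simp
  rw [hB]
  refine ContMDiffAt.sum fun i _ ↦ ?_
  exact (ContinuousLinearMap.contMDiff _).contMDiffAt.comp x (h (b i))

end Calculus

/-! ### Vector fields along maps, in charts. -/

section Coordinates

variable {E : Type*} [NormedAddCommGroup E] [NormedSpace ℝ E]
  {M : Type*} [TopologicalSpace M] [ChartedSpace E M] [IsManifold 𝓘(ℝ, E) ∞ M]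
  {F : Type*} [NormedAddCommGroup F] [NormedSpace ℝ F]
  {N : Type*} [TopologicalSpace N] [ChartedSpace F N]

theorem toCoord_ofCoord {p q : M} (hq : q ∈ (chartAt E p).source) (b : E) :
    toCoord p q (ofCoord p q b) = b :=
  (trivializationAt E (TangentSpace 𝓘(ℝ, E)) p).continuousLinearMapAt_symmL hq b

theorem ofCoord_toCoord {p q : M} (hq : q ∈ (chartAt E p).source) (v : TangentSpace 𝓘(ℝ, E) q) :
    ofCoord p q (toCoord p q v) = v :=
  (trivializationAt E (TangentSpace 𝓘(ℝ, E)) p).symmL_continuousLinearMapAt hq v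

theorem toCoord_eq_mvfderiv {p q : M} (hq : q ∈ (chartAt E p).source) :
    toCoord p q = mvfderiv 𝓘(ℝ, E) (extChartAt 𝓘(ℝ, E) p) q :=
  TangentBundle.continuousLinearMapAt_trivializationAt hq

variable (F) in
/-- The vector field `ξ` along `φ : N → M` is smooth near `x`. -/
def SmoothAlongAt (φ : N → M) (x : N) (ξ : ∀ y : N, TangentSpace 𝓘(ℝ, E) (φ y)) : Prop :=
  ContMDiffAt 𝓘(ℝ, F) 𝓘(ℝ, E).tangent ∞ (fun y ↦ (⟨φ y, ξ y⟩ : TangentBundle 𝓘(ℝ, E) M)) x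

theorem SmoothAlongOn.at {φ : N → M} {U : Set N} {ξ : ∀ y : N, TangentSpace 𝓘(ℝ, E) (φ y)}
    (h : SmoothAlongOn F φ U ξ) (hU : IsOpen U) {x : N} (hx : x ∈ U) : SmoothAlongAt F φ x ξ :=
  ContMDiffOn.contMDiffAt h (hU.mem_nhds hx)

theorem SmoothOn.at {U : Set M} {X : ∀ p : M, TangentSpace 𝓘(ℝ, E) p}
    (h : SmoothOn U X) (hU : IsOpen U) {x : M} (hx : x ∈ U) : SmoothAlongAt E id x X :=
  ContMDiffOn.contMDiffAt h (hU.mem_nhds hx)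

theorem smoothAlongAt_iff {φ : N → M} {x : N} {ξ : ∀ y : N, TangentSpace 𝓘(ℝ, E) (φ y)} {p : M}
    (hp : φ x ∈ (chartAt E p).source) :
    SmoothAlongAt F φ x ξ ↔ ContMDiffAt 𝓘(ℝ, F) 𝓘(ℝ, E) ∞ φ x ∧
      ContMDiffAt 𝓘(ℝ, F) 𝓘(ℝ, E) ∞ (fun y ↦ toCoord p (φ y) (ξ y)) x := by
  rw [SmoothAlongAt, (trivializationAt E (TangentSpace 𝓘(ℝ, E)) p).contMDiffAt_iff (n := ∞)
    (f := fun y ↦ (⟨φ y, ξ y⟩ : TangentBundle 𝓘(ℝ, E) M))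
    ((trivializationAt E (TangentSpace 𝓘(ℝ, E)) p).mem_source.2 hp)]
  refine and_congr_right fun hφ ↦ ?_
  refine Filter.EventuallyEq.contMDiffAt_iff ?_
  filter_upwards [hφ.continuousAt.preimage_mem_nhds ((chartAt E p).open_source.mem_nhds hp)]
    with y hy
  exact ((trivializationAt E (TangentSpace 𝓘(ℝ, E)) p).continuousLinearMapAt_apply_of_mem ℝ hy _).symm

theorem smoothAlongAt_ofCoord {φ : N → M} {x : N} {p : M} (hp : φ x ∈ (chartAt E p).source)
    (hφ : ContMDiffAt 𝓘(ℝ, F) 𝓘(ℝ, E) ∞ φ x) {w : N → E}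
    (hw : ContMDiffAt 𝓘(ℝ, F) 𝓘(ℝ, E) ∞ w x) :
    SmoothAlongAt F φ x (fun y ↦ ofCoord p (φ y) (w y)) := by
  refine (smoothAlongAt_iff hp).2 ⟨hφ, hw.congr_of_eventuallyEq ?_⟩
  filter_upwards [hφ.continuousAt.preimage_mem_nhds ((chartAt E p).open_source.mem_nhds hp)]
    with y hy using toCoord_ofCoord hy _

theorem SmoothAlongAt.comp {G : Type*} [NormedAddCommGroup G] [NormedSpace ℝ G]
    {L : Type*} [TopologicalSpace L] [ChartedSpace G L] {φ : N → M} {ι : L → N} {y : L}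
    {ξ : ∀ y : N, TangentSpace 𝓘(ℝ, E) (φ y)} (hξ : SmoothAlongAt F φ (ι y) ξ)
    (hι : ContMDiffAt 𝓘(ℝ, G) 𝓘(ℝ, F) ∞ ι y) :
    SmoothAlongAt G (φ ∘ ι) y (fun z ↦ ξ (ι z)) :=
  ContMDiffAt.comp y hξ hι

/-- The push-forward of a vector field, in coordinates. -/
theorem toCoord_mfderiv [IsManifold 𝓘(ℝ, F) ∞ N] {φ : N → M} {x₀ z : N} {p : M}
    (hz : z ∈ (chartAt F x₀).source) (hp : φ z ∈ (chartAt E p).source)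
    (hφ : ContMDiffAt 𝓘(ℝ, F) 𝓘(ℝ, E) ∞ φ z) (u : TangentSpace 𝓘(ℝ, F) z) :
    toCoord p (φ z) (mfderiv 𝓘(ℝ, F) 𝓘(ℝ, E) φ z u)
      = fderiv ℝ (extChartAt 𝓘(ℝ, E) p ∘ φ ∘ (extChartAt 𝓘(ℝ, F) x₀).symm)
          (extChartAt 𝓘(ℝ, F) x₀ z) (toCoord x₀ z u) ∧
      ContDiffAt ℝ ∞ (extChartAt 𝓘(ℝ, E) p ∘ φ ∘ (extChartAt 𝓘(ℝ, F) x₀).symm)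
          (extChartAt 𝓘(ℝ, F) x₀ z) := by
  have hz' : z ∈ (extChartAt 𝓘(ℝ, F) x₀).source := by rwa [extChartAt_source]
  have hinv : (extChartAt 𝓘(ℝ, F) x₀).symm (extChartAt 𝓘(ℝ, F) x₀ z) = z :=
    (extChartAt 𝓘(ℝ, F) x₀).left_inv hz'
  have h1 : ContMDiffAt 𝓘(ℝ, F) 𝓘(ℝ, F) ∞ (extChartAt 𝓘(ℝ, F) x₀).symm
      (extChartAt 𝓘(ℝ, F) x₀ z) :=
    (contMDiffOn_extChartAt_symm x₀).contMDiffAt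
      (extChartAt_target_mem_nhds' ((extChartAt 𝓘(ℝ, F) x₀).map_source hz'))
  have h2 : ContMDiffAt 𝓘(ℝ, E) 𝓘(ℝ, E) ∞ (extChartAt 𝓘(ℝ, E) p) (φ z) := contMDiffAt_extChartAt' hp
  have h3 : ContMDiffAt 𝓘(ℝ, F) 𝓘(ℝ, F) ∞ (extChartAt 𝓘(ℝ, F) x₀) z := contMDiffAt_extChartAt' hz
  have hsm : ContDiffAt ℝ ∞ (extChartAt 𝓘(ℝ, E) p ∘ φ ∘ (extChartAt 𝓘(ℝ, F) x₀).symm)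
      (extChartAt 𝓘(ℝ, F) x₀ z) := by
    rw [← contMDiffAt_iff_contDiffAt]
    refine ContMDiffAt.comp (I' := 𝓘(ℝ, E)) _ (by rw [Function.comp_apply, hinv]; exact h2) ?_
    exact ContMDiffAt.comp (I' := 𝓘(ℝ, F)) _ (by rw [hinv]; exact hφ) h1
  refine ⟨?_, hsm⟩
  rw [toCoord_eq_mvfderiv hp, toCoord_eq_mvfderiv hz,
    ← mvfderiv_comp_map (h2.mdifferentiableAt (by simp)) (hφ.mdifferentiableAt (by simp)),
    ← mvfderiv_comp_fderiv (hsm.differentiableAt (by simp)) (h3.mdifferentiableAt (by simp))]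
  refine congr($(mvfderiv_congr ?_) u)
  filter_upwards [extChartAt_source_mem_nhds' (I := 𝓘(ℝ, F)) hz'] with y hy
  simp only [Function.comp_apply, (extChartAt 𝓘(ℝ, F) x₀).left_inv hy]

theorem smoothAlongAt_mfderiv [IsManifold 𝓘(ℝ, F) ∞ N] {φ : N → M} {x : N}
    (hφ : ContMDiff 𝓘(ℝ, F) 𝓘(ℝ, E) ∞ φ) {Y : ∀ y : N, TangentSpace 𝓘(ℝ, F) y}
    (hY : SmoothAlongAt F id x Y) :
    SmoothAlongAt F φ x (fun y ↦ mfderiv 𝓘(ℝ, F) 𝓘(ℝ, E) φ y (Y y)) :=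
  ContMDiffAt.comp x ((hφ.contMDiff_tangentMap (m := ∞) (by simp)).contMDiffAt) hY

end Coordinates

/-! ### The Levi-Civita connection along maps: compatibility, chain rule, absence of torsion. -/

section Metric

variable {E : Type*} [NormedAddCommGroup E] [NormedSpace ℝ E]
  {M : Type*} [TopologicalSpace M] [ChartedSpace E M] [IsManifold 𝓘(ℝ, E) ∞ M]
  {F : Type*} [NormedAddCommGroup F] [NormedSpace ℝ F]
  {N : Type*} [TopologicalSpace N] [ChartedSpace F N]
  (g : SemiRiemannianMetric E M)

theorem SemiRiemannianMetric.contMDiffAt_apply {φ : N → M} {x : N}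
    {ξ η : ∀ y : N, TangentSpace 𝓘(ℝ, E) (φ y)}
    (hξ : SmoothAlongAt F φ x ξ) (hη : SmoothAlongAt F φ x η) :
    ContMDiffAt 𝓘(ℝ, F) 𝓘(ℝ) ∞ (fun y ↦ g.val (φ y) (ξ y) (η y)) x := by
  have hφ : ContMDiffAt 𝓘(ℝ, F) 𝓘(ℝ, E) ∞ φ x :=
    ((smoothAlongAt_iff (mem_chart_source E (φ x))).1 hξ).1
  have h := ContMDiffAt.clm_bundle_apply₂ (F₁ := E) (F₂ := E) (F₃ := ℝ) (n := ∞)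
    (E₁ := fun p : M ↦ TangentSpace 𝓘(ℝ, E) p) (E₂ := fun p : M ↦ TangentSpace 𝓘(ℝ, E) p)
    (E₃ := Bundle.Trivial M ℝ) (b := φ) (v := ξ) (w := η) (ψ := fun y ↦ g.val (φ y))
    (g.contMDiff.contMDiffAt.comp x hφ) hξ hη
  exact (contMDiffAt_totalSpace.1 h).2

theorem SemiRiemannianMetric.coeff_toCoord {p q : M} (hq : q ∈ (chartAt E p).source)
    (v w : TangentSpace 𝓘(ℝ, E) q) :
    g.coeff p q (toCoord p q v) (toCoord p q w) = g.val q v w := by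
  change g.val q (ofCoord p q (toCoord p q v)) (ofCoord p q (toCoord p q w)) = _
  rw [ofCoord_toCoord hq, ofCoord_toCoord hq]

theorem SemiRiemannianMetric.coeff_symm (p q : M) (v w : E) :
    g.coeff p q v w = g.coeff p q w v :=
  g.symm q _ _

variable [FiniteDimensional ℝ E]

theorem SemiRiemannianMetric.contMDiffAt_coeff {p q : M} (hq : q ∈ (chartAt E p).source) :
    ContMDiffAt 𝓘(ℝ, E) 𝓘(ℝ, E →L[ℝ] E →L[ℝ] ℝ) ∞ (g.coeff p) q := by
  refine contMDiffAt_clm_of_apply fun v ↦ contMDiffAt_clm_of_apply fun w ↦ ?_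
  exact g.contMDiffAt_apply (φ := id)
    (smoothAlongAt_ofCoord hq contMDiffAt_id (contMDiffAt_const (c := v)))
    (smoothAlongAt_ofCoord hq contMDiffAt_id (contMDiffAt_const (c := w)))

theorem SemiRiemannianMetric.dcoeff_symm (p : M) (v : TangentSpace 𝓘(ℝ, E) p) (a b : E) :
    g.dcoeff p v a b = g.dcoeff p v b a := by
  have key : ∀ a b : E, g.dcoeff p v a b = mvfderiv 𝓘(ℝ, E) (fun q ↦ g.coeff p q a b) p v := by
    intro a b
    have h := (g.contMDiffAt_coeff (mem_chart_source E p)).mdifferentiableAt (by simp)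
    have h1 := mvfderiv_clm_apply h (mdifferentiableAt_const (c := a)) v
    have h' : MDifferentiableAt 𝓘(ℝ, E) 𝓘(ℝ, E →L[ℝ] ℝ) (fun q ↦ g.coeff p q a) p :=
      ((g.contMDiffAt_coeff (mem_chart_source E p)).clm_apply contMDiffAt_const).mdifferentiableAt
        (by simp)
    have h2 := mvfderiv_clm_apply h' (mdifferentiableAt_const (c := b)) v
    rw [h2, h1, mvfderiv_const_apply, mvfderiv_const_apply]
    simp [dcoeff]
  rw [key, key]
  simp only [g.coeff_symm p _ a b]

theorem SemiRiemannianMetric.val_christoffel (p : M) (v w z : TangentSpace 𝓘(ℝ, E) p) :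
    g.val p (g.christoffel p v w) z = (g.dcoeff p v (toCoord p p w) (toCoord p p z)
      + g.dcoeff p w (toCoord p p v) (toCoord p p z)
      - g.dcoeff p z (toCoord p p v) (toCoord p p w)) / 2 :=
  apply_sharp (g.form p) (g.nondegenerate p) (g.koszul p v w) z

theorem SemiRiemannianMetric.christoffel_symm (p : M) (v w : TangentSpace 𝓘(ℝ, E) p) :
    g.christoffel p v w = g.christoffel p w v := by
  rw [← sub_eq_zero]
  refine g.nondegenerate p _ fun z ↦ ?_
  rw [map_sub, sub_apply, g.val_christoffel, g.val_christoffel, g.dcoeff_symm p z]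
  ring

/-- In the sum of the two Koszul expressions the derivatives along `w` and `z` cancel in pairs, and
the two halves of the derivative along `v` add up. This is metric compatibility at the level of
Christoffel symbols. -/
theorem SemiRiemannianMetric.val_christoffel_add (p : M) (v w z : TangentSpace 𝓘(ℝ, E) p) :
    g.val p (g.christoffel p v w) z + g.val p w (g.christoffel p v z)
      = g.dcoeff p v (toCoord p p w) (toCoord p p z) := by
  rw [g.symm p w, g.val_christoffel, g.val_christoffel, g.dcoeff_symm p v (toCoord p p z),
    g.dcoeff_symm p w (toCoord p p v), g.dcoeff_symm p z (toCoord p p v)]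
  ring

/-- The Levi-Civita connection along a map is compatible with the metric. -/
theorem SemiRiemannianMetric.mvfderiv_val {φ : N → M} {x : N}
    {ξ η : ∀ y : N, TangentSpace 𝓘(ℝ, E) (φ y)}
    (hξ : SmoothAlongAt F φ x ξ) (hη : SmoothAlongAt F φ x η) (u : TangentSpace 𝓘(ℝ, F) x) :
    mvfderiv 𝓘(ℝ, F) (fun y ↦ g.val (φ y) (ξ y) (η y)) x u
      = g.val (φ x) (g.covAlong φ ξ x u) (η x) + g.val (φ x) (ξ x) (g.covAlong φ η x u) := by
  have hs := mem_chart_source E (φ x)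
  obtain ⟨hφ, hξ'⟩ := (smoothAlongAt_iff hs).1 hξ
  have hη' := ((smoothAlongAt_iff hs).1 hη).2
  have hφd := hφ.mdifferentiableAt (by simp)
  have e1 : (fun y ↦ g.val (φ y) (ξ y) (η y)) =ᶠ[𝓝 x] fun y ↦
      g.coeff (φ x) (φ y) (toCoord (φ x) (φ y) (ξ y)) (toCoord (φ x) (φ y) (η y)) := by
    filter_upwards [hφ.continuousAt.preimage_mem_nhds ((chartAt E (φ x)).open_source.mem_nhds hs)]
      with y hy using (g.coeff_toCoord hy _ _).symm
  have hc := (g.contMDiffAt_coeff hs)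
  have hc1 : ContMDiffAt 𝓘(ℝ, F) 𝓘(ℝ, E →L[ℝ] E →L[ℝ] ℝ) ∞ (fun y ↦ g.coeff (φ x) (φ y)) x :=
    hc.comp x hφ
  rw [mvfderiv_congr e1, mvfderiv_clm_apply ((hc1.clm_apply hξ').mdifferentiableAt (by simp))
    (hη'.mdifferentiableAt (by simp)), mvfderiv_clm_apply (hc1.mdifferentiableAt (by simp))
    (hξ'.mdifferentiableAt (by simp)), mvfderiv_comp_map (hc.mdifferentiableAt (by simp)) hφd]
  simp only [covAlong, map_add, add_apply]
  rw [← g.coeff_toCoord hs (ofCoord _ _ _), ← g.coeff_toCoord hs _ (ofCoord _ _ _),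
    toCoord_ofCoord hs, toCoord_ofCoord hs]
  have := g.val_christoffel_add (φ x) (mfderiv 𝓘(ℝ, F) 𝓘(ℝ, E) φ x u) (ξ x) (η x)
  rw [dcoeff] at this
  linarith

theorem SemiRiemannianMetric.covAlong_congr {φ : N → M} {x : N}
    {ξ η : ∀ y : N, TangentSpace 𝓘(ℝ, E) (φ y)} (h : ∀ᶠ y in 𝓝 x, ξ y = η y)
    (u : TangentSpace 𝓘(ℝ, F) x) : g.covAlong φ ξ x u = g.covAlong φ η x u := by
  have h1 : (fun y ↦ toCoord (φ x) (φ y) (ξ y)) =ᶠ[𝓝 x] fun y ↦ toCoord (φ x) (φ y) (η y) :=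
    h.mono fun y hy ↦ by simp only [hy]
  rw [covAlong, covAlong, mvfderiv_congr h1, h.self_of_nhds]

theorem SemiRiemannianMetric.covAlong_comp {G : Type*} [NormedAddCommGroup G] [NormedSpace ℝ G]
    {L : Type*} [TopologicalSpace L] [ChartedSpace G L] [IsManifold 𝓘(ℝ, F) ∞ N]
    {φ : N → M} {ι : L → N} {y : L}
    {ξ : ∀ y : N, TangentSpace 𝓘(ℝ, E) (φ y)} (hξ : SmoothAlongAt F φ (ι y) ξ)
    (hι : ContMDiffAt 𝓘(ℝ, G) 𝓘(ℝ, F) ∞ ι y) (u : TangentSpace 𝓘(ℝ, G) y) :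
    g.covAlong (φ ∘ ι) (fun z ↦ ξ (ι z)) y u
      = g.covAlong φ ξ (ι y) (mfderiv 𝓘(ℝ, G) 𝓘(ℝ, F) ι y u) := by
  obtain ⟨hφ, hξ'⟩ := (smoothAlongAt_iff (mem_chart_source E (φ (ι y)))).1 hξ
  have hιd := hι.mdifferentiableAt (by simp)
  have h1 := mvfderiv_comp_map (hξ'.mdifferentiableAt (by simp)) hιd u
  have h2 := mfderiv_comp_apply y (hφ.mdifferentiableAt (by simp)) hιd u
  simp only [covAlong, Function.comp_apply]
  rw [h1]
  exact congrArg (_ + ·) (congrArg (fun v ↦ g.christoffel (φ (ι y)) v (ξ (ι y))) h2)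

/-- The Hessian-type expression of a map in the chart at `x₀`. -/
theorem SemiRiemannianMetric.exists_symm_covAlong_mfderiv [IsManifold 𝓘(ℝ, F) ∞ N] {φ : N → M}
    (hφ : ContMDiff 𝓘(ℝ, F) 𝓘(ℝ, E) ∞ φ) {x₀ x : N} (hx : x ∈ (chartAt F x₀).source) :
    ∃ H : TangentSpace 𝓘(ℝ, F) x → TangentSpace 𝓘(ℝ, F) x → TangentSpace 𝓘(ℝ, E) (φ x),
      (∀ u w, H u w = H w u) ∧
      ∀ Y : ∀ y : N, TangentSpace 𝓘(ℝ, F) y, SmoothAlongAt F id x Y → ∀ u,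
        g.covAlong φ (fun y ↦ mfderiv 𝓘(ℝ, F) 𝓘(ℝ, E) φ y (Y y)) x u
          = H u (Y x) + mfderiv 𝓘(ℝ, F) 𝓘(ℝ, E) φ x
              (ofCoord x₀ x (mvfderiv 𝓘(ℝ, F) (fun y ↦ toCoord x₀ y (Y y)) x u)) := by
  have hs := mem_chart_source E (φ x)
  set Φ := extChartAt 𝓘(ℝ, E) (φ x) ∘ φ ∘ (extChartAt 𝓘(ℝ, F) x₀).symm with hΦ
  have hΦs : ContDiffAt ℝ ∞ Φ (extChartAt 𝓘(ℝ, F) x₀ x) :=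
    (toCoord_mfderiv hx hs hφ.contMDiffAt (0 : TangentSpace 𝓘(ℝ, F) x)).2
  -- `H` is the second derivative of the coordinate expression of `φ` plus the Christoffel term. It
  -- is symmetric by Schwarz's theorem and the symmetry of the Christoffel symbols; the rest of the
  -- covariant derivative is in the image of the differential of `φ`.
  refine ⟨fun u w ↦ ofCoord (φ x) (φ x)
      (fderiv ℝ (fderiv ℝ Φ) (extChartAt 𝓘(ℝ, F) x₀ x) (toCoord x₀ x u) (toCoord x₀ x w))
      + g.christoffel (φ x) (mfderiv 𝓘(ℝ, F) 𝓘(ℝ, E) φ x u) (mfderiv 𝓘(ℝ, F) 𝓘(ℝ, E) φ x w),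
    fun u w ↦ ?_, fun Y hY u ↦ ?_⟩
  · beta_reduce
    rw [g.christoffel_symm]
    have := hΦs.isSymmSndFDerivAt (by
      rw [minSmoothness_of_isRCLikeNormedField]
      exact (WithTop.coe_le_coe.2 le_top : ((2 : ℕ∞) : WithTop ℕ∞) ≤ ∞)) (toCoord x₀ x u) (toCoord x₀ x w)
    rw [this]
  · have hYs : ContMDiffAt 𝓘(ℝ, F) 𝓘(ℝ, F) ∞ (fun y ↦ toCoord x₀ y (Y y)) x :=
      ((smoothAlongAt_iff (φ := (id : N → N)) hx).1 hY).2
    have hchart : ContMDiffAt 𝓘(ℝ, F) 𝓘(ℝ, F) ∞ (extChartAt 𝓘(ℝ, F) x₀) x :=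
      contMDiffAt_extChartAt' hx
    have hfd : ContDiffAt ℝ ∞ (fderiv ℝ Φ) (extChartAt 𝓘(ℝ, F) x₀ x) :=
      hΦs.fderiv_right (by simp)
    have hfd' : ContMDiffAt 𝓘(ℝ, F) 𝓘(ℝ, F →L[ℝ] E) ∞
        (fun y ↦ fderiv ℝ Φ (extChartAt 𝓘(ℝ, F) x₀ y)) x :=
      ContMDiffAt.comp x hfd.contMDiffAt hchart
    have e1 : (fun y ↦ toCoord (φ x) (φ y) (mfderiv 𝓘(ℝ, F) 𝓘(ℝ, E) φ y (Y y))) =ᶠ[𝓝 x]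
        fun y ↦ fderiv ℝ Φ (extChartAt 𝓘(ℝ, F) x₀ y) (toCoord x₀ y (Y y)) := by
      filter_upwards [hφ.continuous.continuousAt.preimage_mem_nhds
        ((chartAt E (φ x)).open_source.mem_nhds hs), (chartAt F x₀).open_source.mem_nhds hx]
        with y hy hy'
      exact (toCoord_mfderiv hy' hy hφ.contMDiffAt (Y y)).1
    have e2 : ∀ b, mfderiv 𝓘(ℝ, F) 𝓘(ℝ, E) φ x (ofCoord x₀ x b)
        = ofCoord (φ x) (φ x) (fderiv ℝ Φ (extChartAt 𝓘(ℝ, F) x₀ x) b) := by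
      intro b
      have := (toCoord_mfderiv hx hs hφ.contMDiffAt (ofCoord x₀ x b)).1
      rw [toCoord_ofCoord hx] at this
      rw [← this, ofCoord_toCoord hs]
    rw [e2, covAlong, mvfderiv_congr e1, mvfderiv_clm_apply (hfd'.mdifferentiableAt (by simp))
      (hYs.mdifferentiableAt (by simp)), mvfderiv_comp_fderiv (hfd.differentiableAt (by simp))
      (hchart.mdifferentiableAt (by simp)), ← toCoord_eq_mvfderiv hx, map_add]
    exact add_right_comm _ _ _

end Metric

/-! ### Covariant derivatives of fields of endomorphisms. -/

section Parallel

variable {E : Type*} [NormedAddCommGroup E] [NormedSpace ℝ E] [FiniteDimensional ℝ E]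
  {M : Type*} [TopologicalSpace M] [ChartedSpace E M] [IsManifold 𝓘(ℝ, E) ∞ M]
  {F : Type*} [NormedAddCommGroup F] [NormedSpace ℝ F]
  {N : Type*} [TopologicalSpace N] [ChartedSpace F N]

omit [FiniteDimensional ℝ E] in
theorem SmoothEndOn.apply {U : Set M}
    {S : ∀ p : M, TangentSpace 𝓘(ℝ, E) p →L[ℝ] TangentSpace 𝓘(ℝ, E) p}
    (hS : SmoothEndOn U S) (hU : IsOpen U) {φ : N → M} {x : N} (hx : φ x ∈ U)
    {ξ : ∀ y : N, TangentSpace 𝓘(ℝ, E) (φ y)} (hξ : SmoothAlongAt F φ x ξ) :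
    SmoothAlongAt F φ x (fun y ↦ S (φ y) (ξ y)) := by
  have hφ := ((smoothAlongAt_iff (mem_chart_source E (φ x))).1 hξ).1
  exact ContMDiffAt.clm_bundle_apply (F₁ := E) (F₂ := E) (n := ∞)
    (E₁ := fun p : M ↦ TangentSpace 𝓘(ℝ, E) p) (E₂ := fun p : M ↦ TangentSpace 𝓘(ℝ, E) p)
    (b := φ) (v := ξ) (ϕ := fun y ↦ S (φ y))
    (ContMDiffAt.comp x (ContMDiffOn.contMDiffAt hS (hU.mem_nhds hx)) hφ) hξ

/-- The covariant derivative of a field of endomorphisms, in the preferred chart at `p`. -/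
def SemiRiemannianMetric.covEnd (g : SemiRiemannianMetric E M)
    (S : ∀ p : M, TangentSpace 𝓘(ℝ, E) p →L[ℝ] TangentSpace 𝓘(ℝ, E) p) (p : M)
    (v w : TangentSpace 𝓘(ℝ, E) p) : TangentSpace 𝓘(ℝ, E) p :=
  ofCoord p p (mvfderiv 𝓘(ℝ, E) (fun q ↦ (toCoord p q).comp ((S q).comp (ofCoord p q))) p v
      (toCoord p p w))
    + g.christoffel p v (S p w) - S p (g.christoffel p v w)

/-- The right-hand side involves `φ`, `u` and `ξ` only through `φ x`, the image of `u` and the value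
`ξ x`. This lets parallelism, which is stated for vector fields on `M`, be used for fields along any
map. -/
theorem SemiRiemannianMetric.covAlong_end (g : SemiRiemannianMetric E M) {U : Set M}
    {S : ∀ p : M, TangentSpace 𝓘(ℝ, E) p →L[ℝ] TangentSpace 𝓘(ℝ, E) p}
    (hS : SmoothEndOn U S) (hU : IsOpen U) {φ : N → M} {x : N} (hx : φ x ∈ U)
    {ξ : ∀ y : N, TangentSpace 𝓘(ℝ, E) (φ y)} (hξ : SmoothAlongAt F φ x ξ)
    (u : TangentSpace 𝓘(ℝ, F) x) :
    g.covAlong φ (fun y ↦ S (φ y) (ξ y)) x u - S (φ x) (g.covAlong φ ξ x u)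
      = g.covEnd S (φ x) (mfderiv 𝓘(ℝ, F) 𝓘(ℝ, E) φ x u) (ξ x) := by
  have hs := mem_chart_source E (φ x)
  obtain ⟨hφ, hξ'⟩ := (smoothAlongAt_iff hs).1 hξ
  have hφd := hφ.mdifferentiableAt (by simp)
  have hSc : ContMDiffAt 𝓘(ℝ, E) 𝓘(ℝ, E →L[ℝ] E) ∞
      (fun q ↦ (toCoord (φ x) q).comp ((S q).comp (ofCoord (φ x) q))) (φ x) := by
    refine contMDiffAt_clm_of_apply fun b ↦ ?_
    have := hS.apply hU (φ := id) (x := φ x) hx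
      (smoothAlongAt_ofCoord (φ := id) (x := φ x) hs contMDiffAt_id (contMDiffAt_const (c := b)))
    exact ((smoothAlongAt_iff (φ := id) (x := φ x) hs).1 this).2
  have hSc' : ContMDiffAt 𝓘(ℝ, F) 𝓘(ℝ, E →L[ℝ] E) ∞
      (fun y ↦ (toCoord (φ x) (φ y)).comp ((S (φ y)).comp (ofCoord (φ x) (φ y)))) x :=
    ContMDiffAt.comp x hSc hφ
  have e1 : (fun y ↦ toCoord (φ x) (φ y) (S (φ y) (ξ y))) =ᶠ[𝓝 x] fun y ↦
      ((toCoord (φ x) (φ y)).comp ((S (φ y)).comp (ofCoord (φ x) (φ y))))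
        (toCoord (φ x) (φ y) (ξ y)) := by
    filter_upwards [hφ.continuousAt.preimage_mem_nhds ((chartAt E (φ x)).open_source.mem_nhds hs)]
      with y hy
    simp only [ContinuousLinearMap.comp_apply]
    rw [ofCoord_toCoord hy]
  simp only [covAlong, covEnd]
  rw [mvfderiv_congr e1, mvfderiv_clm_apply (hSc'.mdifferentiableAt (by simp))
    (hξ'.mdifferentiableAt (by simp)), mvfderiv_comp_map (hSc.mdifferentiableAt (by simp)) hφd]
  simp only [ContinuousLinearMap.comp_apply, map_add]
  rw [ofCoord_toCoord hs]
  module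

/-- Along a map, the covariant derivative of a section of a parallel family of endomorphisms
is in the family. -/
theorem IsParallel.exists_covAlong {g : SemiRiemannianMetric E M}
    {σ : ∀ p : M, Submodule ℝ (TangentSpace 𝓘(ℝ, E) p →L[ℝ] TangentSpace 𝓘(ℝ, E) p)}
    (hσ : IsParallel g σ) {U : Set M}
    {S : ∀ p : M, TangentSpace 𝓘(ℝ, E) p →L[ℝ] TangentSpace 𝓘(ℝ, E) p}
    (hU : IsOpen U) (hS : SmoothEndOn U S) (hSσ : ∀ p ∈ U, S p ∈ σ p)
    {φ : N → M} {x : N} (hx : φ x ∈ U) (u : TangentSpace 𝓘(ℝ, F) x) :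
    ∃ T ∈ σ (φ x), ∀ ξ : ∀ y : N, TangentSpace 𝓘(ℝ, E) (φ y), SmoothAlongAt F φ x ξ →
      g.covAlong φ (fun y ↦ S (φ y) (ξ y)) x u
        = S (φ x) (g.covAlong φ ξ x u) + T (ξ x) := by
  have hs := mem_chart_source E (φ x)
  obtain ⟨T, hT, h⟩ := hσ U S hU hS hSσ (φ x) hx (mfderiv 𝓘(ℝ, F) 𝓘(ℝ, E) φ x u)
  refine ⟨T, hT, fun ξ hξ ↦ ?_⟩
  rw [← sub_eq_iff_eq_add', g.covAlong_end hS hU hx hξ u]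
  -- The test field on `M` is the one with constant components in the chart and value `ξ x` at `φ
  -- x`; by `covAlong_end` it gives the same tensor as `ξ`.
  have hsm : ∀ q ∈ (chartAt E (φ x)).source, SmoothAlongAt E id q
      (fun q ↦ ofCoord (φ x) q (toCoord (φ x) (φ x) (ξ x))) := fun q hq ↦
    smoothAlongAt_ofCoord (φ := id) (x := q) hq contMDiffAt_id contMDiffAt_const
  have h1 := h (chartAt E (φ x)).source
    (fun q ↦ ofCoord (φ x) q (toCoord (φ x) (φ x) (ξ x))) (chartAt E (φ x)).open_source hs
    (fun q hq ↦ (hsm q hq).contMDiffWithinAt)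
  have h2 := g.covAlong_end hS hU (φ := id) (x := φ x) hx (hsm _ hs)
    (mfderiv 𝓘(ℝ, F) 𝓘(ℝ, E) φ x u)
  rw [mfderiv_id] at h2
  have h3 := h2.symm.trans h1
  simp only [id] at h3
  rw [ofCoord_toCoord hs] at h3
  exact h3

end Parallel

/-! ### Smooth projections onto the kernels of a family of linear maps. -/

section Projection

variable {F : Type*} [NormedAddCommGroup F] [NormedSpace ℝ F]
  {N : Type*} [TopologicalSpace N] [ChartedSpace F N]
  {V R : Type*} [NormedAddCommGroup V] [NormedSpace ℝ V]
  [NormedAddCommGroup R] [NormedSpace ℝ R] [FiniteDimensional ℝ R]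

/-- The kernels of a smooth family of linear maps that are onto at `x` are, near `x`, the images
of a smooth family of projections with a common kernel. -/
theorem exists_smooth_projection {Λ : N → V →L[ℝ] R} {U₀ : Set N} {x : N} (hU₀ : IsOpen U₀)
    (hx : x ∈ U₀) (hΛ : ∀ y ∈ U₀, ContMDiffAt 𝓘(ℝ, F) 𝓘(ℝ, V →L[ℝ] R) ∞ Λ y)
    (hsurj : Function.Surjective (Λ x)) :
    ∃ (P : N → V →L[ℝ] V) (U : Set N), IsOpen U ∧ x ∈ U ∧ U ⊆ U₀ ∧
      ∀ y ∈ U, ContMDiffAt 𝓘(ℝ, F) 𝓘(ℝ, V →L[ℝ] V) ∞ P y ∧ (∀ v, Λ y (P y v) = 0) ∧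
        (∀ v, Λ y v = 0 → P y v = v) ∧ ∀ z ∈ U, ∀ v, P y (P z v) = P y v := by
  -- With `S` a right inverse of `Λ x`, the projection is `P y = 1 - S (Λ_y S)⁻¹ Λ_y` where `Λ_y S`
  -- is invertible. Its kernel is the range of `S` for every `y`, which yields `P y (P z v) = P y
  -- v`.
  obtain ⟨s, hs⟩ := (Λ x).toLinearMap.exists_rightInverse_of_surjective
    (LinearMap.range_eq_top.2 hsurj)
  set S : R →L[ℝ] V := LinearMap.toContinuousLinearMap s with hS
  have hxS : (Λ x).comp S = ContinuousLinearMap.id ℝ R := by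
    ext r
    exact LinearMap.congr_fun hs r
  have hO := ContinuousLinearEquiv.isOpen (𝕜 := ℝ) (E := R) (F := R)
  have hQ : ∀ y ∈ U₀, ContMDiffAt 𝓘(ℝ, F) 𝓘(ℝ, R →L[ℝ] R) ∞ (fun y ↦ (Λ y).comp S) y :=
    fun y hy ↦ (hΛ y hy).clm_comp contMDiffAt_const
  have hQc : ContinuousOn (fun y ↦ (Λ y).comp S) U₀ := fun y hy ↦
    (hQ y hy).continuousAt.continuousWithinAt
  refine ⟨fun y ↦ ContinuousLinearMap.id ℝ V
      - S.comp ((ContinuousLinearMap.inverse ((Λ y).comp S)).comp (Λ y)),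
    U₀ ∩ (fun y ↦ (Λ y).comp S) ⁻¹' Set.range ((↑) : (R ≃L[ℝ] R) → R →L[ℝ] R),
    hQc.isOpen_inter_preimage hU₀ hO,
    ⟨hx, ContinuousLinearEquiv.refl ℝ R, hxS.symm⟩, Set.inter_subset_left, ?_⟩
  rintro y ⟨hy, e, he⟩
  simp only at he
  have hinv1 : ∀ r, Λ y (S (ContinuousLinearMap.inverse ((Λ y).comp S) r)) = r := by
    intro r
    rw [← ContinuousLinearMap.comp_apply, ← he, ContinuousLinearMap.inverse_equiv]
    exact e.apply_symm_apply r
  have hinv2 : ∀ r, ContinuousLinearMap.inverse ((Λ y).comp S) (Λ y (S r)) = r := by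
    intro r
    rw [← ContinuousLinearMap.comp_apply (Λ y), ← he, ContinuousLinearMap.inverse_equiv]
    exact e.symm_apply_apply r
  refine ⟨?_, fun v ↦ ?_, fun v hv ↦ ?_, fun z hz v ↦ ?_⟩
  · refine contMDiffAt_const.sub (contMDiffAt_const.clm_comp (ContMDiffAt.clm_comp ?_ (hΛ y hy)))
    have hi : ContDiffAt ℝ ∞ ContinuousLinearMap.inverse ((Λ y).comp S) :=
      he ▸ contDiffAt_map_inverse e
    exact hi.contMDiffAt.comp y (hQ y hy)
  · simp [hinv1]
  · simp [hv]
  · simp [hinv2]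

end Projection

/-! ### Frobenius' theorem for distributions. -/

section Frobenius

variable {F : Type*} [NormedAddCommGroup F] [NormedSpace ℝ F] [FiniteDimensional ℝ F]
  {N : Type*} [TopologicalSpace N] [ChartedSpace F N] [IsManifold 𝓘(ℝ, F) ∞ N]
  {W : Type*} [NormedAddCommGroup W] [NormedSpace ℝ W]

omit [FiniteDimensional ℝ F] in
theorem fderiv_comp_extChartAt_symm {h : N → W} {x₀ y : N} (hy : y ∈ (chartAt F x₀).source)
    (hh : ContMDiffAt 𝓘(ℝ, F) 𝓘(ℝ, W) ∞ h y) (b : F) :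
    ContDiffAt ℝ ∞ (h ∘ (extChartAt 𝓘(ℝ, F) x₀).symm) (extChartAt 𝓘(ℝ, F) x₀ y) ∧
    fderiv ℝ (h ∘ (extChartAt 𝓘(ℝ, F) x₀).symm) (extChartAt 𝓘(ℝ, F) x₀ y) b
      = mvfderiv 𝓘(ℝ, F) h y (ofCoord x₀ y b) := by
  have hy' : y ∈ (extChartAt 𝓘(ℝ, F) x₀).source := by rwa [extChartAt_source]
  have hinv : (extChartAt 𝓘(ℝ, F) x₀).symm (extChartAt 𝓘(ℝ, F) x₀ y) = y :=
    (extChartAt 𝓘(ℝ, F) x₀).left_inv hy'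
  have h1 : ContMDiffAt 𝓘(ℝ, F) 𝓘(ℝ, F) ∞ (extChartAt 𝓘(ℝ, F) x₀).symm
      (extChartAt 𝓘(ℝ, F) x₀ y) :=
    (contMDiffOn_extChartAt_symm x₀).contMDiffAt
      (extChartAt_target_mem_nhds' ((extChartAt 𝓘(ℝ, F) x₀).map_source hy'))
  have hs : ContDiffAt ℝ ∞ (h ∘ (extChartAt 𝓘(ℝ, F) x₀).symm) (extChartAt 𝓘(ℝ, F) x₀ y) := by
    rw [← contMDiffAt_iff_contDiffAt]
    exact ContMDiffAt.comp (I' := 𝓘(ℝ, F)) _ (by rw [hinv]; exact hh) h1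
  refine ⟨hs, ?_⟩
  have h3 : ContMDiffAt 𝓘(ℝ, F) 𝓘(ℝ, F) ∞ (extChartAt 𝓘(ℝ, F) x₀) y := contMDiffAt_extChartAt' hy
  have h4 := mvfderiv_comp_fderiv (hs.differentiableAt (by simp)) (h3.mdifferentiableAt (by simp))
    (ofCoord x₀ y b)
  rw [← toCoord_eq_mvfderiv hy, toCoord_ofCoord hy] at h4
  rw [← h4]
  refine congr($(mvfderiv_congr ?_) _)
  filter_upwards [extChartAt_source_mem_nhds' (I := 𝓘(ℝ, F)) hy'] with z hz
  simp only [Function.comp_apply, (extChartAt 𝓘(ℝ, F) x₀).left_inv hz]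

/-- The integral manifolds of a family of projections satisfying the involutivity condition, in a
chart. -/
theorem exists_total_of_involutive {x₀ : N} {U : Set N} (hU : IsOpen U) (hx₀ : x₀ ∈ U)
    (hUs : U ⊆ (chartAt F x₀).source) {P : N → F →L[ℝ] F}
    (hP : ∀ y ∈ U, ContMDiffAt 𝓘(ℝ, F) 𝓘(ℝ, F →L[ℝ] F) ∞ P y)
    (hPP : ∀ y ∈ U, ∀ z ∈ U, ∀ v, P y (P z v) = P y v)
    (hinv : ∀ y ∈ U, ∀ v w, P y
      (mvfderiv 𝓘(ℝ, F) (fun z ↦ P z w) y (ofCoord x₀ y (P y v))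
        - mvfderiv 𝓘(ℝ, F) (fun z ↦ P z v) y (ofCoord x₀ y (P y w)))
      = mvfderiv 𝓘(ℝ, F) (fun z ↦ P z w) y (ofCoord x₀ y (P y v))
        - mvfderiv 𝓘(ℝ, F) (fun z ↦ P z v) y (ofCoord x₀ y (P y w)))
    {G : Type*} [NormedAddCommGroup G] [NormedSpace ℝ G] (j : G →L[ℝ] F) :
    ∃ r > 0, ∃ k : G → N, k 0 = x₀ ∧ ∀ v ∈ Metric.ball (0 : G) r, k v ∈ U ∧
      ContMDiffAt 𝓘(ℝ, G) 𝓘(ℝ, F) ∞ k v ∧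
      P x₀ (extChartAt 𝓘(ℝ, F) x₀ (k v)) = P x₀ (extChartAt 𝓘(ℝ, F) x₀ x₀) + P x₀ (j v) ∧
      ∀ t : G, toCoord x₀ (k v) (mfderiv 𝓘(ℝ, G) 𝓘(ℝ, F) k v t) = P (k v) (j t) := by
  set ψ := extChartAt 𝓘(ℝ, F) x₀ with hψ
  have hUs' : U ⊆ ψ.source := by rwa [hψ, extChartAt_source]
  -- The fields `P v` and `P w` commute. Their bracket is fixed by `P y` by involutivity. But `P x₀
  -- (P z w) = P x₀ w` does not depend on `z`, so `P x₀` annihilates the bracket, and so does `P y`,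
  -- which is `P y` composed with `P x₀`. This is the integrability condition for `A`.
  have hcomm : ∀ y ∈ U, ∀ v w, mvfderiv 𝓘(ℝ, F) (fun z ↦ P z w) y (ofCoord x₀ y (P y v))
      = mvfderiv 𝓘(ℝ, F) (fun z ↦ P z v) y (ofCoord x₀ y (P y w)) := by
    intro y hy v w
    have h0 : ∀ w (t : TangentSpace 𝓘(ℝ, F) y),
        P x₀ (mvfderiv 𝓘(ℝ, F) (fun z ↦ P z w) y t) = 0 := by
      intro w t
      have hPw : ContMDiffAt 𝓘(ℝ, F) 𝓘(ℝ, F) ∞ (fun z ↦ P z w) y :=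
        (hP y hy).clm_apply contMDiffAt_const
      have h1 := mvfderiv_comp_fderiv (P x₀).differentiableAt (hPw.mdifferentiableAt (by simp)) t
      rw [ContinuousLinearMap.fderiv] at h1
      rw [← h1, ← mvfderiv_const_apply (P x₀ w) y t]
      refine congr($(mvfderiv_congr ?_) t)
      filter_upwards [hU.mem_nhds hy] with z hz using hPP x₀ hx₀ z hz w
    rw [← sub_eq_zero, ← hinv y hy, ← hPP y hy x₀ hx₀, map_sub, h0, h0, sub_zero, map_zero]
  have hψU : IsOpen (ψ.target ∩ ψ.symm ⁻¹' U) :=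
    (continuousOn_extChartAt_symm x₀).isOpen_inter_preimage (isOpen_extChartAt_target x₀) hU
  set A : F → G →L[ℝ] F := (fun y ↦ (P y).comp j) ∘ ψ.symm with hA
  have hPj : ∀ y ∈ U, ContMDiffAt 𝓘(ℝ, F) 𝓘(ℝ, G →L[ℝ] F) ∞ (fun y ↦ (P y).comp j) y :=
    fun y hy ↦ (hP y hy).clm_comp contMDiffAt_const
  have hAU : ∀ q ∈ ψ.target ∩ ψ.symm ⁻¹' U, ContDiffAt ℝ ∞ A q ∧
      ∀ h k, fderiv ℝ A q (A q h) k = mvfderiv 𝓘(ℝ, F) (fun z ↦ P z (j k)) (ψ.symm q)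
        (ofCoord x₀ (ψ.symm q) (P (ψ.symm q) (j h))) := by
    rintro q ⟨hq, hqU⟩
    have hqU' : ψ.symm q ∈ U := hqU
    have hq' : ψ (ψ.symm q) = q := ψ.right_inv hq
    have h1 : ∀ b, _ := fun b ↦ fderiv_comp_extChartAt_symm (hUs hqU) (hPj _ hqU) b
    rw [← hψ, hq'] at h1
    refine ⟨(h1 0).1, fun h k ↦ ?_⟩
    rw [(h1 _).2]
    have h2 := mvfderiv_clm_apply ((hPj _ hqU').mdifferentiableAt (by simp))
      (mdifferentiableAt_const (c := k)) (ofCoord x₀ (ψ.symm q) (A q h))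
    rw [mvfderiv_const_apply, map_zero, add_zero] at h2
    exact h2.symm
  obtain ⟨r, hr, u, hu0, hus, hu⟩ := exists_hasFDerivAt_total (A := A) (q₀ := ψ x₀) hψU
    ⟨ψ.map_source (hUs' hx₀), by rwa [Set.mem_preimage, ψ.left_inv (hUs' hx₀)]⟩
    (fun q hq ↦ (hAU q hq).1.contDiffWithinAt)
    (fun q hq h k ↦ by
      rw [(hAU q hq).2, (hAU q hq).2]
      exact hcomm _ hq.2 _ _)
  refine ⟨r, hr, fun v ↦ ψ.symm (u v), by simp only [hu0, ψ.left_inv (hUs' hx₀)], ?_⟩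
  intro v hv
  obtain ⟨⟨hut, huU⟩, hud⟩ := hu v hv
  have huU' : ψ.symm (u v) ∈ U := huU
  have hsm : ContMDiffAt 𝓘(ℝ, G) 𝓘(ℝ, F) ∞ (fun v ↦ ψ.symm (u v)) v := by
    refine ContMDiffAt.comp v ((contMDiffOn_extChartAt_symm x₀).contMDiffAt
      (extChartAt_target_mem_nhds' hut)) ?_
    exact (hus.contDiffAt (Metric.isOpen_ball.mem_nhds hv)).contMDiffAt
  refine ⟨huU, hsm, ?_, fun t ↦ ?_⟩
  -- `P x₀ (u w) - P x₀ (j w)` has derivative zero because `P x₀ (P y (j t)) = P x₀ (j t)`, hence it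
  -- is constant on the ball. The formula is what makes the parametrization `k` injective when `P
  -- x₀` fixes the image of an injective `j`.
  · have hd : ∀ w ∈ Metric.ball (0 : G) r,
        HasFDerivAt (fun w ↦ P x₀ (u w) - P x₀ (j w)) (0 : G →L[ℝ] F) w := by
      intro w hw
      have h6 : HasFDerivAt (fun w ↦ P x₀ (u w) - P x₀ (j w)) _ w :=
        ((P x₀).hasFDerivAt.comp w (hu w hw).2).sub ((P x₀).comp j).hasFDerivAt
      refine h6.congr_fderiv ?_
      ext t
      have h7 : P x₀ (A (u w) t) = P x₀ (j t) := hPP x₀ hx₀ _ (hu w hw).1.2 _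
      simp [h7]
    have h8 := (convex_ball (0 : G) r).is_const_of_fderivWithin_eq_zero (𝕜 := ℝ)
      (fun w hw ↦ (hd w hw).differentiableAt.differentiableWithinAt)
      (fun w hw ↦ by
        rw [fderivWithin_of_isOpen Metric.isOpen_ball hw, (hd w hw).fderiv]) hv
      (Metric.mem_ball_self hr)
    simp only [hu0, map_zero, sub_zero] at h8
    beta_reduce
    rw [ψ.right_inv hut, ← h8]
    abel
  have h3 : ContMDiffAt 𝓘(ℝ, F) 𝓘(ℝ, F) ∞ ψ (ψ.symm (u v)) := contMDiffAt_extChartAt' (hUs huU')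
  have h4 : (fun v ↦ ψ (ψ.symm (u v))) =ᶠ[𝓝 v] u := by
    filter_upwards [Metric.isOpen_ball.mem_nhds hv] with w hw using ψ.right_inv (hu w hw).1.1
  have h5 := mvfderiv_comp_map (φ := fun v ↦ ψ.symm (u v)) (h3.mdifferentiableAt (by simp))
    (hsm.mdifferentiableAt (by simp)) t
  rw [mvfderiv_congr h4, mvfderiv, mfderiv_eq_fderiv, hud.fderiv] at h5
  rw [toCoord_eq_mvfderiv (hUs huU')]
  exact h5.symm

variable {N : Type u} [TopologicalSpace N] [ChartedSpace F N] [IsManifold 𝓘(ℝ, F) ∞ N]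

/-- The local **Frobenius theorem**: a distribution that is locally the image of a smooth family of
projections satisfying the involutivity condition has integral manifolds. -/
theorem exists_isIntegralManifold {D : ∀ x : N, Submodule ℝ (TangentSpace 𝓘(ℝ, F) x)}
    {x₀ : N} {U : Set N} (hU : IsOpen U) (hx₀ : x₀ ∈ U)
    (hUs : U ⊆ (chartAt F x₀).source) {P : N → F →L[ℝ] F}
    (hP : ∀ y ∈ U, ContMDiffAt 𝓘(ℝ, F) 𝓘(ℝ, F →L[ℝ] F) ∞ P y)
    (hPP : ∀ y ∈ U, ∀ z ∈ U, ∀ v, P y (P z v) = P y v)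
    (hPD : ∀ y ∈ U, ∀ v, ofCoord x₀ y (P y v) ∈ D y)
    (hDP : ∀ y ∈ U, ∀ v ∈ D y, P y (toCoord x₀ y v) = toCoord x₀ y v)
    (hinv : ∀ y ∈ U, ∀ v w, ofCoord x₀ y
      (mvfderiv 𝓘(ℝ, F) (fun z ↦ P z w) y (ofCoord x₀ y (P y v))
        - mvfderiv 𝓘(ℝ, F) (fun z ↦ P z v) y (ofCoord x₀ y (P y w))) ∈ D y) :
    ∃ (s : ℕ) (L : Type u) (_ : TopologicalSpace L)
      (_ : ChartedSpace (EuclideanSpace ℝ (Fin s)) L)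
      (_ : IsManifold 𝓘(ℝ, EuclideanSpace ℝ (Fin s)) ∞ L) (ι : L → N),
      IsIntegralManifold (G := EuclideanSpace ℝ (Fin s)) D ι ∧ x₀ ∈ Set.range ι := by
  set s := Module.finrank ℝ (P x₀).range with hs
  let G := EuclideanSpace ℝ (Fin s)
  let j₀ : G ≃ₗ[ℝ] (P x₀).range := LinearEquiv.ofFinrankEq _ _ (by simp [G, hs])
  let j : G →L[ℝ] F := LinearMap.toContinuousLinearMap ((P x₀).range.subtype ∘ₗ j₀.toLinearMap)
  have hj : ∀ t, P x₀ (j t) = j t := by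
    intro t
    obtain ⟨b, hb⟩ := (j₀ t).2
    have : j t = P x₀ b := hb.symm
    rw [this, hPP x₀ hx₀ x₀ hx₀]
  have hjinj : Function.Injective j := fun a b h ↦ j₀.injective (Subtype.ext h)
  have hjr : ∀ b, ∃ t, j t = P x₀ b := fun b ↦
    ⟨j₀.symm ⟨P x₀ b, ⟨b, rfl⟩⟩, congrArg Subtype.val (j₀.apply_symm_apply _)⟩
  obtain ⟨r, hr, k, hk0, hk⟩ := exists_total_of_involutive hU hx₀ hUs hP hPP (fun y hy v w ↦ by
    have := hDP y hy _ (hinv y hy v w)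
    rwa [toCoord_ofCoord (hUs hy)] at this) j
  -- A diffeomorphism of `G` onto the ball where `k` is a solution, so that the leaf is parametrized
  -- by all of `G`.
  let κ : G → G := OpenPartialHomeomorph.univBall (0 : G) r
  have hκs : ContDiff ℝ ∞ κ := OpenPartialHomeomorph.contDiff_univBall
  have hκb : ∀ v, κ v ∈ Metric.ball (0 : G) r := fun v ↦ by
    rw [← OpenPartialHomeomorph.univBall_target (0 : G) hr]
    exact (OpenPartialHomeomorph.univBall (0 : G) r).map_source (by simp)
  have hκl : ∀ v, (OpenPartialHomeomorph.univBall (0 : G) r).symm (κ v) = v := fun v ↦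
    (OpenPartialHomeomorph.univBall (0 : G) r).left_inv (by simp)
  have hκd : ∀ v, Function.Injective (fderiv ℝ κ v) := by
    intro v
    have h1 : DifferentiableAt ℝ (OpenPartialHomeomorph.univBall (0 : G) r).symm (κ v) :=
      ((OpenPartialHomeomorph.contDiffOn_univBall_symm (n := ⊤)).contDiffAt
        (Metric.isOpen_ball.mem_nhds (hκb v))).differentiableAt (by simp)
    have h2 := fderiv_comp v h1 (hκs.differentiable (by simp) v)
    have h3 : (OpenPartialHomeomorph.univBall (0 : G) r).symm ∘ κ = id := funext hκl
    rw [h3, fderiv_id] at h2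
    intro a b hab
    have ha := congr($h2 a)
    have hb := congr($h2 b)
    simp only [ContinuousLinearMap.comp_apply, ContinuousLinearMap.id_apply] at ha hb
    rw [ha, hb, hab]
  have hkinj : Set.InjOn k (Metric.ball (0 : G) r) := by
    intro a ha b hb hab
    have h1 := (hk a ha).2.2.1
    rw [hab, (hk b hb).2.2.1, hj, hj] at h1
    exact (hjinj (add_left_cancel h1)).symm
  -- The leaf is `G` itself with a single global chart, lifted to the universe of `N`.
  let L := ULift.{u} G
  let e : OpenPartialHomeomorph L G := (Homeomorph.ulift : L ≃ₜ G).toOpenPartialHomeomorph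
  let : ChartedSpace G L := e.singletonChartedSpace rfl
  have : IsManifold 𝓘(ℝ, G) ∞ L := e.isManifold_singleton rfl
  have hchart : ∀ l : L, (extChartAt 𝓘(ℝ, G) l : L → G) = ULift.down := fun l ↦ rfl
  have hdown : ContMDiff 𝓘(ℝ, G) 𝓘(ℝ, G) ∞ (ULift.down : L → G) := fun l ↦
    contMDiffAt_extChartAt
  have hcs : ∀ l : L, ContMDiffAt 𝓘(ℝ, G) 𝓘(ℝ, F) ∞ (fun l : L ↦ k (κ l.down)) l := fun l ↦
    ContMDiffAt.comp l (hk _ (hκb l.down)).2.1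
      (ContMDiffAt.comp l hκs.contMDiff.contMDiffAt hdown.contMDiffAt)
  have hder : ∀ (l : L) (t : TangentSpace 𝓘(ℝ, G) l), toCoord x₀ (k (κ l.down))
      (mfderiv 𝓘(ℝ, G) 𝓘(ℝ, F) (fun l : L ↦ k (κ l.down)) l t)
      = P (k (κ l.down)) (j (fderiv ℝ κ l.down (toCoord l l t))) := by
    intro l t
    rw [toCoord_eq_mvfderiv (mem_chart_source G l), hchart,
      ← mvfderiv_comp_fderiv (hκs.differentiable (by simp) _)
        (hdown.mdifferentiableAt (by simp)), ← (hk _ (hκb l.down)).2.2.2]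
    refine congrArg (toCoord x₀ (k (κ l.down))) ?_
    exact mfderiv_comp_apply l ((hk _ (hκb l.down)).2.1.mdifferentiableAt (by simp))
      ((ContMDiffAt.comp l hκs.contMDiff.contMDiffAt hdown.contMDiffAt).mdifferentiableAt
        (by simp)) t
  have hPj : ∀ y ∈ U, Function.Injective fun t ↦ P y (j t) := fun y hy a b hab ↦ by
    have := congrArg (P x₀) hab
    simp only [hPP x₀ hx₀ y hy, hj] at this
    exact hjinj this
  refine ⟨s, L, inferInstance, inferInstance, inferInstance, fun l ↦ k (κ l.down),
    { connected := ?_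
      contMDiff := hcs
      injective := ?_
      immersion := ?_
      range_eq := ?_ }, ⟨⟨0⟩, ?_⟩⟩
  · exact (Homeomorph.ulift : L ≃ₜ G).symm.surjective.connectedSpace
      (Homeomorph.ulift : L ≃ₜ G).symm.continuous
  · intro a b hab
    have := hkinj (hκb a.down) (hκb b.down) hab
    have h2 := congrArg (OpenPartialHomeomorph.univBall (0 : G) r).symm this
    rw [hκl, hκl] at h2
    exact ULift.down_injective h2
  · intro l a b hab
    have h1 := hder l a
    rw [hab, hder l b] at h1
    have h2 := hκd _ (hPj _ (hk _ (hκb l.down)).1 h1)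
    rw [← ofCoord_toCoord (mem_chart_source G l) a, ← ofCoord_toCoord (mem_chart_source G l) b, h2]
  · intro l
    have hyU := (hk _ (hκb l.down)).1
    refine le_antisymm ?_ fun v hv ↦ ?_
    · rintro _ ⟨t, rfl⟩
      have h1 := hPD _ hyU (j (fderiv ℝ κ l.down (toCoord l l t)))
      rw [← hder l t, ofCoord_toCoord (hUs hyU)] at h1
      exact h1
    -- For `v` in the distribution, the parameter direction `t` with `j t = P x₀ v` works, as `P y
    -- (j t) = P y (P x₀ v) = P y v = v`, with `v` read in the chart.
    · obtain ⟨t, ht⟩ := hjr (toCoord x₀ (k (κ l.down)) v)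
      obtain ⟨t', ht'⟩ := (LinearMap.injective_iff_surjective
        (f := (fderiv ℝ κ l.down).toLinearMap)).1 (hκd l.down) t
      refine ⟨ofCoord l l t', ?_⟩
      have h1 := hder l (ofCoord l l t')
      rw [toCoord_ofCoord (mem_chart_source G l)] at h1
      have h2 : fderiv ℝ κ l.down t' = t := ht'
      rw [h2, ht, hPP _ hyU _ hx₀, hDP _ hyU v hv] at h1
      have h3 := congrArg (ofCoord x₀ (k (κ l.down))) h1
      rw [ofCoord_toCoord (hUs hyU), ofCoord_toCoord (hUs hyU)] at h3
      exact h3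
  · simp only [κ, OpenPartialHomeomorph.univBall_apply_zero, hk0]

end Frobenius

/-! ### Pointwise linear algebra of paraquaternionic CR-submanifolds. -/

section Algebra

variable {E : Type*} [NormedAddCommGroup E] [NormedSpace ℝ E]
  {M : Type*} [TopologicalSpace M] [ChartedSpace E M] [IsManifold 𝓘(ℝ, E) ∞ M]
  {g : SemiRiemannianMetric E M}
  {F : Type*} [NormedAddCommGroup F] [NormedSpace ℝ F]
  {N : Type*} [TopologicalSpace N] [ChartedSpace F N] [IsManifold 𝓘(ℝ, F) ∞ N]
  (f : NondegSubmanifold g F N)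
  {σ : ∀ p : M, Submodule ℝ (TangentSpace 𝓘(ℝ, E) p →L[ℝ] TangentSpace 𝓘(ℝ, E) p)}
  {D : ∀ x : N, Submodule ℝ (TangentSpace 𝓘(ℝ, F) x)}

namespace NondegSubmanifold

theorem induced_apply (x : N) (u w : TangentSpace 𝓘(ℝ, F) x) :
    f.induced x u w = g.val (f.toFun x) (f.d x u) (f.d x w) := rfl

theorem induced_symm (x : N) (u w : TangentSpace 𝓘(ℝ, F) x) :
    f.induced x u w = f.induced x w u := g.symm _ _ _

variable [FiniteDimensional ℝ F]

/-- Riesz representation on a non-degenerate subspace. -/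
theorem exists_induced_eq {x : N} {K : Submodule ℝ (TangentSpace 𝓘(ℝ, F) x)}
    (hK : ∀ u ∈ K, (∀ w ∈ K, f.induced x u w = 0) → u = 0)
    (l : TangentSpace 𝓘(ℝ, F) x →ₗ[ℝ] ℝ) : ∃ u ∈ K, ∀ w ∈ K, f.induced x u w = l w := by
  have hb : ∀ v : K, (∀ w : K, (f.induced x).domRestrict₁₂ K K v w = 0) → v = 0 :=
    fun v hv ↦ Subtype.ext (hK v v.2 fun w hw ↦ hv ⟨w, hw⟩)
  let v : K := sharp ((f.induced x).domRestrict₁₂ K K) hb (l ∘ₗ K.subtype)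
  exact ⟨v, v.2, fun w hw ↦ apply_sharp _ hb (l ∘ₗ K.subtype) ⟨w, hw⟩⟩

/-- Since `D` is non-degenerate, some `w` in `D` has the same products with `D` as `u`; then `u - w`
is orthogonal to `D`. -/
theorem exists_mem_add_mem_perp
    (hD : ∀ x, ∀ u ∈ D x, (∀ w ∈ D x, f.induced x u w = 0) → u = 0) {x : N}
    (u : TangentSpace 𝓘(ℝ, F) x) : ∃ w ∈ D x, ∃ z ∈ f.perp D x, u = w + z := by
  obtain ⟨w, hw, h⟩ := f.exists_induced_eq (hD x) (f.induced x u)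
  refine ⟨w, hw, u - w, fun w' hw' ↦ ?_, (add_sub_cancel w u).symm⟩
  rw [map_sub, LinearMap.sub_apply, h w' hw', sub_self]

theorem perp_nondegenerate
    (hD : ∀ x, ∀ u ∈ D x, (∀ w ∈ D x, f.induced x u w = 0) → u = 0) {x : N}
    {u : TangentSpace 𝓘(ℝ, F) x} (hu : u ∈ f.perp D x)
    (h : ∀ z ∈ f.perp D x, f.induced x u z = 0) : u = 0 := by
  refine f.nondegenerate x u fun v ↦ ?_
  obtain ⟨w, hw, z, hz, rfl⟩ := f.exists_mem_add_mem_perp hD v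
  change f.induced x u (w + z) = 0
  rw [map_add, hu w hw, h z hz, add_zero]

theorem mem_of_perp_perp
    (hD : ∀ x, ∀ u ∈ D x, (∀ w ∈ D x, f.induced x u w = 0) → u = 0) {x : N}
    {u : TangentSpace 𝓘(ℝ, F) x} (h : ∀ z ∈ f.perp D x, f.induced x u z = 0) : u ∈ D x := by
  obtain ⟨w, hw, z, hz, rfl⟩ := f.exists_mem_add_mem_perp hD u
  suffices z = 0 by rwa [this, add_zero]
  refine f.perp_nondegenerate hD hz fun z' hz' ↦ ?_
  have := h z' hz'
  rwa [map_add, LinearMap.add_apply, f.induced_symm x w, hz' w hw, zero_add] at this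

theorem induced_tangentPart (x : N) (v : TangentSpace 𝓘(ℝ, E) (f.toFun x))
    (w : TangentSpace 𝓘(ℝ, F) x) :
    f.induced x (f.tangentPart x v) w = g.val (f.toFun x) v (f.d x w) :=
  apply_sharp (f.induced x) (f.nondegenerate x) _ w

theorem normalPart_mem (x : N) (v : TangentSpace 𝓘(ℝ, E) (f.toFun x)) :
    f.normalPart x v ∈ f.normalSpace x := fun w ↦ by
  rw [normalPart, map_sub, sub_apply, ← f.induced_tangentPart, f.induced_apply, sub_self]

theorem tangentPart_add_normalPart (x : N) (v : TangentSpace 𝓘(ℝ, E) (f.toFun x)) :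
    f.d x (f.tangentPart x v) + f.normalPart x v = v := add_sub_cancel _ _

/-- The tangential and normal parts of a vector are determined by a decomposition. -/
theorem normalPart_eq {x : N} {t : TangentSpace 𝓘(ℝ, F) x}
    {ξ : TangentSpace 𝓘(ℝ, E) (f.toFun x)} (hξ : ξ ∈ f.normalSpace x) :
    f.normalPart x (f.d x t + ξ) = ξ := by
  have h : f.tangentPart x (f.d x t + ξ) = t := by
    rw [← sub_eq_zero]
    refine f.nondegenerate x _ fun w ↦ ?_
    change f.induced x _ w = 0
    rw [map_sub, LinearMap.sub_apply, f.induced_tangentPart, map_add, add_apply,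
      hξ w, f.induced_apply, add_zero, sub_self]
  rw [normalPart, h, add_sub_cancel_left]

theorem normalPart_d {x : N} (t : TangentSpace 𝓘(ℝ, F) x) : f.normalPart x (f.d x t) = 0 := by
  have := f.normalPart_eq (t := t) (zero_mem (f.normalSpace x))
  rwa [add_zero] at this

theorem normalPart_add (x : N) (v w : TangentSpace 𝓘(ℝ, E) (f.toFun x)) :
    f.normalPart x (v + w) = f.normalPart x v + f.normalPart x w := by
  have h : v + w = f.d x (f.tangentPart x v + f.tangentPart x w)
      + (f.normalPart x v + f.normalPart x w) := by
    rw [map_add]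
    conv_lhs => rw [← f.tangentPart_add_normalPart x v, ← f.tangentPart_add_normalPart x w]
    exact add_add_add_comm _ _ _ _
  conv_lhs => rw [h]
  exact f.normalPart_eq (add_mem (f.normalPart_mem x v) (f.normalPart_mem x w))

end NondegSubmanifold

theorem eps_mul_self (α : Fin 3) : eps α * eps α = 1 := by
  fin_cases α <;> simp [eps]

theorem eps_ne_zero (α : Fin 3) : eps α ≠ 0 := fun h ↦ by
  have := eps_mul_self α
  simp [h] at this

namespace IsCanonicalBasis

variable {U : Set M} {J : Fin 3 → ∀ p : M, TangentSpace 𝓘(ℝ, E) p →L[ℝ] TangentSpace 𝓘(ℝ, E) p}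
  (hJ : IsCanonicalBasis σ U J)

include hJ

theorem mem {p : M} (hp : p ∈ U) (α : Fin 3) : J α p ∈ σ p := by
  rw [← hJ.span_eq p hp]
  exact Submodule.subset_span ⟨α, rfl⟩

/-- The product of two distinct members of a canonical basis is a multiple of the third. -/
theorem exists_mul_eq {p : M} (hp : p ∈ U) {α β : Fin 3} (h : α ≠ β) :
    ∃ (γ : Fin 3) (c : ℝ), ∀ v, J α p (J β p v) = c • J γ p v := by
  have : β = α + 1 ∨ α = β + 1 := by revert α β; decide
  obtain rfl | rfl := this
  · exact ⟨α + 2, eps (α + 2), hJ.mul_succ p hp α⟩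
  · exact ⟨β + 2, -eps (β + 2), fun v ↦ by rw [hJ.succ_mul p hp β, neg_smul]⟩

/-- Putting `J_α w` for `w` in the compatibility of `g` with `J_α` and using `J_α² = -ε_α` gives
skewness for all three signs at once. -/
theorem val_skew (hg : IsAdapted g σ) {p : M} (hp : p ∈ U) (α : Fin 3)
    (v w : TangentSpace 𝓘(ℝ, E) p) : g.val p (J α p v) w = -g.val p v (J α p w) := by
  have h := hg U J hJ p hp α v (J α p w)
  rw [hJ.sq p hp, map_neg, map_smul, smul_eq_mul] at h
  have h2 : eps α * (g.val p (J α p v) w + g.val p v (J α p w)) = 0 := by linarith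
  have := (mul_eq_zero.1 h2).resolve_left (eps_ne_zero α)
  linarith

end IsCanonicalBasis

section Bundles

variable {f}

namespace IsCanonicalBasis

variable {U : Set M} {J : Fin 3 → ∀ p : M, TangentSpace 𝓘(ℝ, E) p →L[ℝ] TangentSpace 𝓘(ℝ, E) p}
  (hJ : IsCanonicalBasis σ U J)

include hJ

theorem exists_eq_sum {p : M} (hp : p ∈ U)
    {S : TangentSpace 𝓘(ℝ, E) p →L[ℝ] TangentSpace 𝓘(ℝ, E) p} (hS : S ∈ σ p) :
    ∃ c : Fin 3 → ℝ, ∀ v, S v = ∑ α, c α • J α p v := by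
  rw [← hJ.span_eq p hp, Submodule.mem_span_range_iff_exists_fun] at hS
  obtain ⟨c, rfl⟩ := hS
  exact ⟨c, fun v ↦ by simp⟩

theorem injective {p : M} (hp : p ∈ U) (α : Fin 3) : Function.Injective (J α p) := by
  refine (injective_iff_map_eq_zero (J α p)).2 fun v hv ↦ ?_
  have h := hJ.sq p hp α v
  rw [hv, map_zero, eq_comm, neg_eq_zero] at h
  exact (smul_eq_zero.1 h).resolve_left (eps_ne_zero α)

theorem apply_mem_nuPerp {x : N} (hx : f.toFun x ∈ U) (α : Fin 3) {z : TangentSpace 𝓘(ℝ, F) x}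
    (hz : z ∈ f.perp D x) : J α (f.toFun x) (f.d x z) ∈ f.nuPerp σ D x :=
  Submodule.subset_span ⟨_, hJ.mem hx α, z, hz, rfl⟩

/-- `nuPerp` is defined with all of `σ`; by linearity the members of one canonical basis suffice. -/
theorem nuPerp_le {x : N} (hx : f.toFun x ∈ U)
    {K : Submodule ℝ (TangentSpace 𝓘(ℝ, E) (f.toFun x))}
    (h : ∀ α, ∀ z ∈ f.perp D x, J α (f.toFun x) (f.d x z) ∈ K) : f.nuPerp σ D x ≤ K := by
  refine Submodule.span_le.2 ?_
  rintro _ ⟨S, hS, z, hz, rfl⟩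
  obtain ⟨c, hc⟩ := hJ.exists_eq_sum hx hS
  rw [hc]
  exact sum_mem fun α _ ↦ K.smul_mem _ (h α z hz)

theorem mem_nu_iff {x : N} (hx : f.toFun x ∈ U) {ξ : TangentSpace 𝓘(ℝ, E) (f.toFun x)} :
    ξ ∈ f.nu σ D x ↔ ξ ∈ f.normalSpace x ∧
      ∀ α, ∀ z ∈ f.perp D x, g.val (f.toFun x) ξ (J α (f.toFun x) (f.d x z)) = 0 := by
  refine ⟨fun h ↦ ⟨h.1, fun α z hz ↦ h.2 _ (hJ.apply_mem_nuPerp hx α hz)⟩, fun h ↦ ⟨h.1, ?_⟩⟩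
  exact fun η hη ↦ hJ.nuPerp_le hx (K := LinearMap.ker (g.val (f.toFun x) ξ).toLinearMap)
    (fun α z hz ↦ h.2 α z hz) hη

end IsCanonicalBasis

namespace NondegSubmanifold.IsParaquaternionicCR

variable (hN : f.IsParaquaternionicCR σ D) {U : Set M}
  {J : Fin 3 → ∀ p : M, TangentSpace 𝓘(ℝ, E) p →L[ℝ] TangentSpace 𝓘(ℝ, E) p}
  (hJ : IsCanonicalBasis σ U J) {x : N} (hx : f.toFun x ∈ U)

include hN hJ hx

theorem nuPerp_le_normalSpace : f.nuPerp σ D x ≤ f.normalSpace x :=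
  hJ.nuPerp_le hx fun α z hz ↦ hN.totallyReal U J hJ x hx α z hz

theorem exists_apply_eq (α : Fin 3) {w : TangentSpace 𝓘(ℝ, F) x} (hw : w ∈ D x) :
    ∃ w' ∈ D x, J α (f.toFun x) (f.d x w) = f.d x w' := by
  have h : J α (f.toFun x) (f.d x w) ∈ (D x).map (f.d x).toLinearMap := by
    rw [← hN.paraquaternionic U J hJ x hx α]
    exact ⟨_, ⟨w, hw, rfl⟩, rfl⟩
  obtain ⟨w', hw', h⟩ := h
  exact ⟨w', hw', h.symm⟩

theorem exists_eq_apply (α : Fin 3) {w : TangentSpace 𝓘(ℝ, F) x} (hw : w ∈ D x) :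
    ∃ w' ∈ D x, f.d x w = J α (f.toFun x) (f.d x w') := by
  have h : f.d x w ∈ (D x).map (f.d x).toLinearMap := ⟨w, hw, rfl⟩
  rw [← hN.paraquaternionic U J hJ x hx α] at h
  obtain ⟨_, ⟨w', hw', rfl⟩, h⟩ := h
  exact ⟨w', hw', h.symm⟩

variable (hg : IsAdapted g σ)

include hg

/-- By skewness the product is `-g(w, J_α J_β z)`, and `J_α J_β z` is a multiple of a third `J_γ z`,
hence normal. In particular the three spaces `J_α D^⊥` are mutually orthogonal. -/
theorem val_apply_apply_of_ne {α β : Fin 3} (h : α ≠ β) {z : TangentSpace 𝓘(ℝ, F) x}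
    (w : TangentSpace 𝓘(ℝ, F) x) (hz : z ∈ f.perp D x) :
    g.val (f.toFun x) (J α (f.toFun x) (f.d x w)) (J β (f.toFun x) (f.d x z)) = 0 := by
  obtain ⟨γ, c, hc⟩ := hJ.exists_mul_eq hx h
  rw [hJ.val_skew hg hx, hc, map_smul, g.symm, hN.totallyReal U J hJ x hx γ z hz w, smul_zero,
    neg_zero]

variable [FiniteDimensional ℝ F]

/-- The normal space is the sum of `ν` and `ν^⊥`. -/
theorem exists_sub_mem_nu {η : TangentSpace 𝓘(ℝ, E) (f.toFun x)} (hη : η ∈ f.normalSpace x) :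
    ∃ m ∈ f.nuPerp σ D x, η - m ∈ f.nu σ D x := by
  -- The vector `z α` represents `w ↦ g(η, J_α w)` on `D^⊥`. As `J_α` multiplies `g` by `ε_α` and
  -- the `J_α D^⊥` are mutually orthogonal, `∑ ε_α J_α z_α` has the same products with `ν^⊥` as `η`.
  have hz : ∀ α, ∃ z ∈ f.perp D x, ∀ w ∈ f.perp D x, f.induced x z w
      = g.val (f.toFun x) η (J α (f.toFun x) (f.d x w)) := fun α ↦
    f.exists_induced_eq (fun u hu h ↦ f.perp_nondegenerate hN.nondegenerate hu h)
      ((g.val (f.toFun x) η).toLinearMap ∘ₗ (J α (f.toFun x)).toLinearMap ∘ₗ (f.d x).toLinearMap)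
  choose z hz hzw using hz
  have hm : ∑ α, eps α • J α (f.toFun x) (f.d x (z α)) ∈ f.nuPerp σ D x :=
    sum_mem fun α _ ↦ Submodule.smul_mem _ _ (hJ.apply_mem_nuPerp hx α (hz α))
  refine ⟨_, hm, (hJ.mem_nu_iff hx).2
    ⟨sub_mem hη (hN.nuPerp_le_normalSpace hJ hx hm), fun α w hw ↦ ?_⟩⟩
  rw [map_sub, sub_apply, map_sum, sum_apply,
    Finset.sum_eq_single α, map_smul, smul_apply, hg U J hJ _ hx, ← f.induced_apply,
    hzw α w hw, smul_eq_mul, ← mul_assoc, eps_mul_self, one_mul, sub_self]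
  · intro β _ h
    rw [map_smul, smul_apply, hN.val_apply_apply_of_ne hJ hx hg h _ hw, smul_zero]
  · simp

/-- The tangent space of `N`, `ν^⊥` and `ν` together span the tangent space of `M`, on which `g` is
non-degenerate. -/
theorem eq_zero_of_mem_normalSpace {ξ : TangentSpace 𝓘(ℝ, E) (f.toFun x)}
    (h : ξ ∈ f.normalSpace x) (h1 : ∀ η ∈ f.nuPerp σ D x, g.val (f.toFun x) ξ η = 0)
    (h2 : ∀ η ∈ f.nu σ D x, g.val (f.toFun x) ξ η = 0) : ξ = 0 := by
  refine g.nondegenerate _ ξ fun v ↦ ?_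
  obtain ⟨m, hm, hn⟩ := hN.exists_sub_mem_nu hJ hx hg (f.normalPart_mem x v)
  rw [← f.tangentPart_add_normalPart x v, ← sub_add_cancel (f.normalPart x v) m, map_add, map_add,
    h, h1 m hm, h2 _ hn, add_zero, add_zero]

theorem eq_zero_of_mem_nu_of_mem_nuPerp {ξ : TangentSpace 𝓘(ℝ, E) (f.toFun x)}
    (h : ξ ∈ f.nu σ D x) (h' : ξ ∈ f.nuPerp σ D x) : ξ = 0 :=
  hN.eq_zero_of_mem_normalSpace hJ hx hg h.1 h.2 fun η hη ↦ by rw [g.symm, hη.2 ξ h']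

/-- By skewness it is enough that `J_α` maps `TN ⊕ ν^⊥` into itself: `D` goes to `D`, `D^⊥` to
`ν^⊥`, and `J_α J_β z` is a multiple of `z` or of some `J_γ z`. -/
theorem apply_mem_nu (α : Fin 3) {ξ : TangentSpace 𝓘(ℝ, E) (f.toFun x)} (h : ξ ∈ f.nu σ D x) :
    J α (f.toFun x) ξ ∈ f.nu σ D x := by
  refine (hJ.mem_nu_iff hx).2 ⟨fun u ↦ ?_, fun β z hz ↦ ?_⟩
  · obtain ⟨w, hw, z, hz, rfl⟩ := f.exists_mem_add_mem_perp hN.nondegenerate u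
    obtain ⟨w', -, hw'⟩ := hN.exists_apply_eq hJ hx α hw
    rw [hJ.val_skew hg hx, map_add, map_add, map_add, hw', h.1,
      h.2 _ (hJ.apply_mem_nuPerp hx α hz), add_zero, neg_zero]
  · rw [hJ.val_skew hg hx]
    rcases eq_or_ne α β with rfl | hne
    · rw [hJ.sq _ hx, map_neg, map_smul, h.1, smul_zero, neg_zero, neg_zero]
    · obtain ⟨γ, c, hc⟩ := hJ.exists_mul_eq hx hne
      rw [hc, map_smul, h.2 _ (hJ.apply_mem_nuPerp hx γ hz), smul_zero, neg_zero]

end NondegSubmanifold.IsParaquaternionicCR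

end Bundles

end Algebra

/-! ### The second fundamental form as a tensor, and the key identity for `J_α Z`. -/

section SecondForm

variable {E : Type*} [NormedAddCommGroup E] [NormedSpace ℝ E] [FiniteDimensional ℝ E]
  {M : Type*} [TopologicalSpace M] [ChartedSpace E M] [IsManifold 𝓘(ℝ, E) ∞ M]
  {g : SemiRiemannianMetric E M}
  {F : Type*} [NormedAddCommGroup F] [NormedSpace ℝ F]
  {N : Type*} [TopologicalSpace N] [ChartedSpace F N]

theorem SemiRiemannianMetric.christoffel_add (g : SemiRiemannianMetric E M) (p : M)
    (v v' w : TangentSpace 𝓘(ℝ, E) p) :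
    g.christoffel p (v + v') w = g.christoffel p v w + g.christoffel p v' w := by
  rw [← sub_eq_zero]
  refine g.nondegenerate p _ fun z ↦ ?_
  rw [map_sub, map_add, sub_apply, add_apply, g.val_christoffel, g.val_christoffel,
    g.val_christoffel]
  rw [(g.dcoeff p).map_add, (toCoord p p).map_add, ContinuousLinearMap.map_add,
    ContinuousLinearMap.map_add, add_apply, add_apply, add_apply, add_apply]
  ring

theorem SemiRiemannianMetric.covAlong_add (g : SemiRiemannianMetric E M) (φ : N → M)
    (ξ : ∀ y : N, TangentSpace 𝓘(ℝ, E) (φ y)) (x : N) (u u' : TangentSpace 𝓘(ℝ, F) x) :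
    g.covAlong φ ξ x (u + u') = g.covAlong φ ξ x u + g.covAlong φ ξ x u' := by
  simp only [covAlong, map_add, g.christoffel_add]
  abel

omit [FiniteDimensional ℝ E] in
theorem smoothAlongAt_const {p q : M} (hq : q ∈ (chartAt E p).source) (b : E) :
    SmoothAlongAt E id q (fun r : M ↦ ofCoord p r b) :=
  smoothAlongAt_ofCoord (φ := id) (x := q) hq contMDiffAt_id contMDiffAt_const

variable [FiniteDimensional ℝ F] [IsManifold 𝓘(ℝ, F) ∞ N] (f : NondegSubmanifold g F N)

namespace NondegSubmanifold

/-- The second fundamental form as a tensor. -/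
def secondForm (x : N) (u w : TangentSpace 𝓘(ℝ, F) x) : TangentSpace 𝓘(ℝ, E) (f.toFun x) :=
  f.normalPart x (g.covAlong f.toFun (fun y ↦ f.d y (ofCoord x y (toCoord x x w))) x u)

theorem secondForm_mem (x : N) (u w : TangentSpace 𝓘(ℝ, F) x) :
    f.secondForm x u w ∈ f.normalSpace x := f.normalPart_mem x _

/-- The only part of the covariant derivative that differentiates `Y` is tangent to `N`, so taking
normal parts leaves a symmetric expression in the values at `x`. -/
theorem exists_symm_normalPart (x : N) :
    ∃ H : TangentSpace 𝓘(ℝ, F) x → TangentSpace 𝓘(ℝ, F) x → TangentSpace 𝓘(ℝ, E) (f.toFun x),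
      (∀ u w, H u w = H w u) ∧
      ∀ Y : ∀ y : N, TangentSpace 𝓘(ℝ, F) y, SmoothAlongAt F id x Y → ∀ u,
        f.normalPart x (g.covAlong f.toFun (fun y ↦ f.d y (Y y)) x u) = H u (Y x) := by
  obtain ⟨H, hH, h⟩ := g.exists_symm_covAlong_mfderiv f.contMDiff (mem_chart_source F x)
  refine ⟨fun u w ↦ f.normalPart x (H u w), fun u w ↦ congrArg _ (hH u w), fun Y hY u ↦ ?_⟩
  have h1 := h Y hY u
  change g.covAlong f.toFun (fun y ↦ f.d y (Y y)) x u = _ + f.d x _ at h1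
  rw [h1, f.normalPart_add, f.normalPart_d, add_zero]

theorem normalPart_covAlong {x : N} {Y : ∀ y : N, TangentSpace 𝓘(ℝ, F) y}
    (hY : SmoothAlongAt F id x Y) (u : TangentSpace 𝓘(ℝ, F) x) :
    f.normalPart x (g.covAlong f.toFun (fun y ↦ f.d y (Y y)) x u) = f.secondForm x u (Y x) := by
  obtain ⟨H, -, h⟩ := f.exists_symm_normalPart x
  rw [h Y hY, secondForm, h _ (smoothAlongAt_const (mem_chart_source F x) _),
    ofCoord_toCoord (mem_chart_source F x)]

theorem secondForm_symm (x : N) (u w : TangentSpace 𝓘(ℝ, F) x) :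
    f.secondForm x u w = f.secondForm x w u := by
  obtain ⟨H, hH, h⟩ := f.exists_symm_normalPart x
  have hc := mem_chart_source F x
  rw [secondForm, secondForm, h _ (smoothAlongAt_const hc _), h _ (smoothAlongAt_const hc _),
    ofCoord_toCoord hc, ofCoord_toCoord hc, hH]

theorem secondForm_add (x : N) (u u' w : TangentSpace 𝓘(ℝ, F) x) :
    f.secondForm x (u + u') w = f.secondForm x u w + f.secondForm x u' w := by
  rw [secondForm, g.covAlong_add, f.normalPart_add]; rfl

omit [FiniteDimensional ℝ E] in
theorem val_normalPart {x : N} {ξ v : TangentSpace 𝓘(ℝ, E) (f.toFun x)}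
    (hξ : ξ ∈ f.normalSpace x) :
    g.val (f.toFun x) ξ (f.normalPart x v) = g.val (f.toFun x) ξ v := by
  rw [normalPart, map_sub, hξ, sub_zero]

/-- The Weingarten equation. -/
theorem val_covAlong_normal {x : N} {ξ : ∀ y : N, TangentSpace 𝓘(ℝ, E) (f.toFun y)}
    (hξ : SmoothAlongAt F f.toFun x ξ) (hn : ∀ᶠ y in 𝓝 x, ξ y ∈ f.normalSpace y)
    (u w : TangentSpace 𝓘(ℝ, F) x) :
    g.val (f.toFun x) (g.covAlong f.toFun ξ x u) (f.d x w)
      = -g.val (f.toFun x) (ξ x) (f.secondForm x u w) := by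
  have hc := mem_chart_source F x
  have hW := smoothAlongAt_const hc (toCoord x x w)
  have h := g.mvfderiv_val hξ (smoothAlongAt_mfderiv f.contMDiff hW) u
  change mvfderiv 𝓘(ℝ, F) (fun y ↦ g.val (f.toFun y) (ξ y)
    (f.d y (ofCoord x y (toCoord x x w)))) x u = _ at h
  rw [mvfderiv_congr (k := fun _ ↦ 0) (hn.mono fun y hy ↦ hy _), mvfderiv_const_apply] at h
  have h1 := f.normalPart_covAlong hW u
  rw [ofCoord_toCoord hc] at h h1
  rw [← h1, f.val_normalPart hn.self_of_nhds]
  exact eq_neg_of_add_eq_zero_left h.symm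

theorem induced_shape {x : N} {ξ : ∀ y : N, TangentSpace 𝓘(ℝ, E) (f.toFun y)}
    (hξ : SmoothAlongAt F f.toFun x ξ) (hn : ∀ᶠ y in 𝓝 x, ξ y ∈ f.normalSpace y)
    (X : ∀ y : N, TangentSpace 𝓘(ℝ, F) y) (w : TangentSpace 𝓘(ℝ, F) x) :
    f.induced x (f.shape ξ X x) w = g.val (f.toFun x) (ξ x) (f.secondForm x (X x) w) := by
  rw [shape, map_neg, LinearMap.neg_apply, f.induced_tangentPart, f.val_covAlong_normal hξ hn,
    neg_neg]

end NondegSubmanifold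

namespace NondegSubmanifold.IsParaquaternionicCR

variable {f} {σ : ∀ p : M, Submodule ℝ (TangentSpace 𝓘(ℝ, E) p →L[ℝ] TangentSpace 𝓘(ℝ, E) p)}
  {D : ∀ x : N, Submodule ℝ (TangentSpace 𝓘(ℝ, F) x)}
  (hN : f.IsParaquaternionicCR σ D) {U : Set M}
  {J : Fin 3 → ∀ p : M, TangentSpace 𝓘(ℝ, E) p →L[ℝ] TangentSpace 𝓘(ℝ, E) p}
  (hJ : IsCanonicalBasis σ U J) {x : N} (hx : f.toFun x ∈ U)
  {Z : ∀ y : N, TangentSpace 𝓘(ℝ, F) y} (hZ : SmoothAlongAt F id x Z)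

include hN hJ hx hZ

omit hN [FiniteDimensional ℝ E] [FiniteDimensional ℝ F] in
theorem smoothAlongAt_apply (α : Fin 3) :
    SmoothAlongAt F f.toFun x (fun y ↦ J α (f.toFun y) (f.d y (Z y))) :=
  (hJ.smooth α).apply hJ.isOpen hx (smoothAlongAt_mfderiv f.contMDiff hZ)

variable (hZp : ∀ᶠ y in 𝓝 x, Z y ∈ f.perp D y)

include hZp

omit hZ [FiniteDimensional ℝ E] [FiniteDimensional ℝ F] in
theorem eventually_apply_mem (α : Fin 3) :
    ∀ᶠ y in 𝓝 x, J α (f.toFun y) (f.d y (Z y)) ∈ f.normalSpace y := by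
  filter_upwards [hZp, f.contMDiff.continuous.continuousAt.preimage_mem_nhds
    (hJ.isOpen.mem_nhds hx)] with y hy hyU using hN.totallyReal U J hJ y hyU α _ hy

omit hN [FiniteDimensional ℝ F] in
-- The error term comes from the covariant derivative of `J_α`: it is `T Z` with `T` in `σ`, by
-- parallelism, hence a vector of `ν^⊥`.
theorem exists_covAlong_apply (hM : IsParaquaternionicKahler g σ) (α : Fin 3)
    (u : TangentSpace 𝓘(ℝ, F) x) : ∃ η ∈ f.nuPerp σ D x,
      g.covAlong f.toFun (fun y ↦ J α (f.toFun y) (f.d y (Z y))) x u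
        = J α (f.toFun x) (g.covAlong f.toFun (fun y ↦ f.d y (Z y)) x u) + η := by
  obtain ⟨T, hT, h⟩ := hM.parallel.exists_covAlong hJ.isOpen (hJ.smooth α)
    (fun p hp ↦ hJ.mem hp α) hx u
  exact ⟨T (f.d x (Z x)), Submodule.subset_span ⟨T, hT, Z x, hZp.self_of_nhds, rfl⟩,
    h _ (smoothAlongAt_mfderiv f.contMDiff hZ)⟩

/-- The Weingarten equation for the normal field `J_α Z` gives `g(∇_u(J_α Z), w) = -g(J_α Z, B(u,
w))`. On the left, `∇_u(J_α Z)` may be replaced by `J_α ∇_u Z`, because the difference is in `ν^⊥`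
and so normal; skewness of `J_α` finishes. -/
theorem val_covAlong_apply (hM : IsParaquaternionicKahler g σ) (α : Fin 3)
    (u w : TangentSpace 𝓘(ℝ, F) x) :
    g.val (f.toFun x) (g.covAlong f.toFun (fun y ↦ f.d y (Z y)) x u) (J α (f.toFun x) (f.d x w))
      = g.val (f.toFun x) (J α (f.toFun x) (f.d x (Z x))) (f.secondForm x u w) := by
  obtain ⟨η, hη, h⟩ := exists_covAlong_apply hJ hx hZ hZp hM α u
  have h1 := f.val_covAlong_normal (smoothAlongAt_apply hJ hx hZ α)
    (hN.eventually_apply_mem hJ hx hZp α) u w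
  have h2 := hJ.val_skew hM.adapted hx α
    (g.covAlong f.toFun (fun y ↦ f.d y (Z y)) x u) (f.d x w)
  rw [h, map_add, add_apply, hN.nuPerp_le_normalSpace hJ hx hη w] at h1
  linarith

end NondegSubmanifold.IsParaquaternionicCR

end SecondForm

/-! ### Extension of vectors to local sections of `D`, `D^⊥` and `ν`. -/

section Extension

variable {E : Type*} [NormedAddCommGroup E] [NormedSpace ℝ E]
  {M : Type*} [TopologicalSpace M] [ChartedSpace E M] [IsManifold 𝓘(ℝ, E) ∞ M]
  {g : SemiRiemannianMetric E M}
  {F : Type*} [NormedAddCommGroup F] [NormedSpace ℝ F] [FiniteDimensional ℝ F]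
  {N : Type*} [TopologicalSpace N] [ChartedSpace F N] [IsManifold 𝓘(ℝ, F) ∞ N]
  {f : NondegSubmanifold g F N}
  {σ : ∀ p : M, Submodule ℝ (TangentSpace 𝓘(ℝ, E) p →L[ℝ] TangentSpace 𝓘(ℝ, E) p)}
  {D : ∀ x : N, Submodule ℝ (TangentSpace 𝓘(ℝ, F) x)}

/-- A projection factors through a Euclidean space. -/
theorem exists_factorization {P : F →L[ℝ] F} (hP : ∀ v, P (P v) = P v) :
    ∃ (s : ℕ) (j : EuclideanSpace ℝ (Fin s) →L[ℝ] F) (k : F →L[ℝ] EuclideanSpace ℝ (Fin s)),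
      (∀ t, k (j t) = t) ∧ ∀ v, j (k v) = P v := by
  let e : EuclideanSpace ℝ (Fin (Module.finrank ℝ P.range)) ≃ₗ[ℝ] P.range :=
    LinearEquiv.ofFinrankEq _ _ (by simp)
  refine ⟨_, LinearMap.toContinuousLinearMap (P.range.subtype ∘ₗ e.toLinearMap),
    LinearMap.toContinuousLinearMap (e.symm.toLinearMap ∘ₗ P.toLinearMap.rangeRestrict),
    fun t ↦ ?_, fun v ↦ ?_⟩
  · refine (e.symm_apply_eq).2 (Subtype.ext ?_)
    obtain ⟨v, hv⟩ := (e t).2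
    have hv : P v = e t := hv
    change P (e t) = e t
    rw [← hv, hP]
  · exact congrArg Subtype.val (e.apply_symm_apply _)

omit [FiniteDimensional ℝ F] in
theorem IsDistribution.exists_isSection (hD : IsDistribution D) {x : N}
    {w : TangentSpace 𝓘(ℝ, F) x} (hw : w ∈ D x) :
    ∃ (U : Set N) (Y : ∀ y : N, TangentSpace 𝓘(ℝ, F) y), IsOpen U ∧ x ∈ U ∧
      IsSection D U Y ∧ Y x = w := by
  obtain ⟨U, hU, hx, r, X, hX, hs⟩ := hD x
  rw [← (hs x hx).2, Submodule.mem_span_range_iff_exists_fun] at hw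
  obtain ⟨c, hc⟩ := hw
  refine ⟨U, fun y ↦ ∑ i, c i • X i y, hU, hx, ⟨fun y hy ↦ ?_, fun y hy ↦ ?_⟩, hc⟩
  · have hc := mem_chart_source F y
    refine ContMDiffAt.contMDiffWithinAt ?_
    refine (smoothAlongAt_iff (φ := id) hc).2 ⟨contMDiffAt_id, ?_⟩
    simp only [map_sum, map_smul]
    refine ContMDiffAt.sum fun i _ ↦ ?_
    have h := ((smoothAlongAt_iff (φ := id) hc).1 ((hX i).at hU hy)).2
    exact (contMDiffAt_const (I := 𝓘(ℝ, F)) (I' := 𝓘(ℝ)) (c := c i)).smul h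
  · rw [← (hs y hy).2]
    exact sum_mem fun i _ ↦ Submodule.smul_mem _ _ (Submodule.subset_span ⟨i, rfl⟩)

namespace NondegSubmanifold

/-- Near each point `D^⊥` is the image of a smooth family of projections with a common kernel. -/
theorem exists_perp_projection (f : NondegSubmanifold g F N) (hD : IsDistribution D) (x : N) :
    ∃ (P : N → F →L[ℝ] F) (U : Set N), IsOpen U ∧ x ∈ U ∧ U ⊆ (chartAt F x).source ∧
      (∀ y ∈ U, ContMDiffAt 𝓘(ℝ, F) 𝓘(ℝ, F →L[ℝ] F) ∞ P y) ∧
      (∀ y ∈ U, ∀ z ∈ U, ∀ v, P y (P z v) = P y v) ∧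
      (∀ y ∈ U, ∀ v, ofCoord x y (P y v) ∈ f.perp D y) ∧
      ∀ y ∈ U, ∀ v ∈ f.perp D y, P y (toCoord x y v) = toCoord x y v := by
  obtain ⟨U₁, hU₁, hx, r, X, hX, hs⟩ := hD x
  have hc := mem_chart_source F x
  -- The products with a local frame of `D`; the kernel is `D^⊥`.
  let Λ : N → F →L[ℝ] (Fin r → ℝ) := fun y ↦ ContinuousLinearMap.pi fun i ↦
    (g.val (f.toFun y) (f.d y (X i y))).comp ((f.d y).comp (ofCoord x y))
  have hΛ : ∀ y v i, Λ y v i = f.induced y (X i y) (ofCoord x y v) := fun _ _ _ ↦ rfl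
  have hΛs : ∀ y ∈ U₁ ∩ (chartAt F x).source,
      ContMDiffAt 𝓘(ℝ, F) 𝓘(ℝ, F →L[ℝ] (Fin r → ℝ)) ∞ Λ y := fun y hy ↦ by
    refine contMDiffAt_clm_of_apply fun v ↦ contMDiffAt_pi_space.2 fun i ↦ ?_
    exact g.contMDiffAt_apply (smoothAlongAt_mfderiv f.contMDiff ((hX i).at hU₁ hy.1))
      (smoothAlongAt_mfderiv f.contMDiff (smoothAlongAt_const hy.2 v))
  -- Prescribed values on the independent vectors `X i x` extend to a functional, which the
  -- non-degenerate induced metric represents by a vector.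
  have hsurj : Function.Surjective (Λ x) := fun c ↦ by
    obtain ⟨l, hl⟩ := LinearMap.exists_extend
      ((Module.Basis.span (hs x hx).1).constr ℝ c : _ →ₗ[ℝ] ℝ)
    refine ⟨toCoord x x (sharp (f.induced x) (f.nondegenerate x) l), funext fun i ↦ ?_⟩
    rw [hΛ, ofCoord_toCoord hc, f.induced_symm]
    refine (apply_sharp (f.induced x) (f.nondegenerate x) l _).trans ?_
    have h1 := LinearMap.congr_fun hl (Module.Basis.span (hs x hx).1 i)
    rw [Module.Basis.constr_basis, LinearMap.comp_apply, Submodule.subtype_apply,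
      Module.Basis.span_apply] at h1
    exact h1
  have hker : ∀ y ∈ U₁, ∀ v, Λ y v = 0 ↔ ofCoord x y v ∈ f.perp D y := fun y hy v ↦ by
    constructor
    · intro h w hw
      rw [← (hs y hy).2] at hw
      refine Submodule.span_induction (p := fun w _ ↦ f.induced y (ofCoord x y v) w = 0)
        ?_ (by simp) (fun a b _ _ ha hb ↦ by rw [map_add, ha, hb, add_zero])
        (fun c a _ ha ↦ by rw [map_smul, ha, smul_zero]) hw
      rintro _ ⟨i, rfl⟩
      rw [f.induced_symm, ← hΛ, h]; rfl
    · intro h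
      funext i
      rw [hΛ, f.induced_symm]
      exact h _ ((hs y hy).2 ▸ Submodule.subset_span ⟨i, rfl⟩)
  obtain ⟨P, U, hU, hxU, hUU, hP⟩ := exists_smooth_projection
    (hU₁.inter (chartAt F x).open_source) ⟨hx, hc⟩ hΛs hsurj
  exact ⟨P, U, hU, hxU, fun y hy ↦ (hUU hy).2, fun y hy ↦ (hP y hy).1,
    fun y hy ↦ (hP y hy).2.2.2, fun y hy v ↦ (hker y (hUU hy).1 _).1 ((hP y hy).2.1 v),
    fun y hy v hv ↦ (hP y hy).2.2.1 _
      ((hker y (hUU hy).1 _).2 (by rwa [ofCoord_toCoord (hUU hy).2]))⟩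

theorem exists_isSection_perp (f : NondegSubmanifold g F N) (hD : IsDistribution D) {x : N}
    {v : TangentSpace 𝓘(ℝ, F) x} (hv : v ∈ f.perp D x) :
    ∃ (U : Set N) (Y : ∀ y : N, TangentSpace 𝓘(ℝ, F) y), IsOpen U ∧ x ∈ U ∧
      IsSection (f.perp D) U Y ∧ Y x = v := by
  obtain ⟨P, U, hU, hx, hUs, hP, -, hPD, hDP⟩ := f.exists_perp_projection hD x
  refine ⟨U, fun y ↦ ofCoord x y (P y (toCoord x x v)), hU, hx, ⟨fun y hy ↦ ?_,
    fun y hy ↦ hPD y hy _⟩, ?_⟩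
  · exact ContMDiffAt.contMDiffWithinAt (smoothAlongAt_ofCoord (φ := id) (x := y) (hUs hy)
      contMDiffAt_id ((hP y hy).clm_apply contMDiffAt_const))
  · beta_reduce
    rw [hDP x hx v hv, ofCoord_toCoord (hUs hx)]

variable [FiniteDimensional ℝ E]

/-- Vectors of `ν` extend to sections of `ν`. -/
theorem IsParaquaternionicCR.exists_isSectionAlong_nu (hN : f.IsParaquaternionicCR σ D)
    (hg : IsAdapted g σ) {V : Set M}
    {J : Fin 3 → ∀ p : M, TangentSpace 𝓘(ℝ, E) p →L[ℝ] TangentSpace 𝓘(ℝ, E) p}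
    (hJ : IsCanonicalBasis σ V J) {x : N} (hxV : f.toFun x ∈ V)
    {η : TangentSpace 𝓘(ℝ, E) (f.toFun x)} (hη : η ∈ f.nu σ D x) :
    ∃ (U : Set N) (ξ : ∀ y : N, TangentSpace 𝓘(ℝ, E) (f.toFun y)), IsOpen U ∧ x ∈ U ∧
      IsSectionAlong F f.toFun (f.nu σ D) U ξ ∧ ξ x = η := by
  obtain ⟨P, U₁, hU₁, hx, hUs, hP, hPP, hPD, hDP⟩ := f.exists_perp_projection hN.isDistribution x
  have hc := mem_chart_source E (f.toFun x)
  have hcF := mem_chart_source F x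
  have hfc := f.contMDiff.continuous
  obtain ⟨s, j, k, hkj, hjk⟩ := exists_factorization fun v ↦ hPP x hx x hx v
  -- The first component records products with `TN`, the second those with the `J_α D^⊥`; the kernel
  -- is `ν`. Parametrizing `D^⊥` at `y` by `t ↦ P y (j t)` from a space of its own dimension gives a
  -- fixed target on which `Λ x` is onto; all of `F` in place of it would be too large in general.
  let Λ : N → E →L[ℝ] ((F →L[ℝ] ℝ) × (Fin 3 → EuclideanSpace ℝ (Fin s) →L[ℝ] ℝ)) := fun y ↦
    ((((f.d y).comp (ofCoord x y)).precomp ℝ).comp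
      ((g.val (f.toFun y)).comp (ofCoord (f.toFun x) (f.toFun y)))).prod
    (ContinuousLinearMap.pi fun α ↦
      ((((J α (f.toFun y)).comp ((f.d y).comp ((ofCoord x y).comp (P y)))).comp
        j).precomp ℝ).comp
      ((g.val (f.toFun y)).comp (ofCoord (f.toFun x) (f.toFun y))))
  have hΛ1 : ∀ y b t, (Λ y b).1 t = g.val (f.toFun y) (ofCoord (f.toFun x) (f.toFun y) b)
    (f.d y (ofCoord x y t)) := fun _ _ _ ↦ rfl
  have hΛ2 : ∀ y b α t, (Λ y b).2 α t
    = g.val (f.toFun y) (ofCoord (f.toFun x) (f.toFun y) b)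
      (J α (f.toFun y) (f.d y (ofCoord x y (P y (j t))))) := fun _ _ _ _ ↦ rfl
  set U₂ := U₁ ∩ f.toFun ⁻¹' (V ∩ (chartAt E (f.toFun x)).source) with hU₂
  have hU₂o : IsOpen U₂ :=
    hU₁.inter ((hJ.isOpen.inter (chartAt E (f.toFun x)).open_source).preimage hfc)
  have hΛs : ∀ y ∈ U₂, ContMDiffAt 𝓘(ℝ, F)
      𝓘(ℝ, E →L[ℝ] ((F →L[ℝ] ℝ) × (Fin 3 → EuclideanSpace ℝ (Fin s) →L[ℝ] ℝ))) ∞ Λ y := by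
    rintro y ⟨hy, hyV, hyc⟩
    refine contMDiffAt_clm_of_apply fun b ↦ ?_
    have hb : SmoothAlongAt F f.toFun y (fun y ↦ ofCoord (f.toFun x) (f.toFun y) b) :=
      smoothAlongAt_ofCoord hyc f.contMDiff.contMDiffAt contMDiffAt_const
    refine ContMDiffAt.prodMk_space ?_ (contMDiffAt_pi_space.2 fun α ↦ ?_)
    · refine contMDiffAt_clm_of_apply fun t ↦ ?_
      exact g.contMDiffAt_apply hb
        (smoothAlongAt_mfderiv f.contMDiff (smoothAlongAt_const (hUs hy) t))
    · refine contMDiffAt_clm_of_apply fun t ↦ ?_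
      exact g.contMDiffAt_apply hb (smoothAlongAt_apply hJ hyV
        (smoothAlongAt_ofCoord (φ := id) (x := y) (hUs hy) contMDiffAt_id
          ((hP y hy).clm_apply contMDiffAt_const)) α)
  have hsurj : Function.Surjective (Λ x) := by
    rintro ⟨l, l'⟩
    have hz : ∀ α, ∃ z ∈ f.perp D x, ∀ w ∈ f.perp D x, f.induced x z w
        = l' α (k (toCoord x x w)) := fun α ↦
      f.exists_induced_eq (fun u hu h ↦ f.perp_nondegenerate hN.nondegenerate hu h)
        ((l' α).toLinearMap ∘ₗ k.toLinearMap ∘ₗ (toCoord x x).toLinearMap)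
    choose z hz hzw using hz
    have hm : ∑ α, eps α • J α (f.toFun x) (f.d x (z α)) ∈ f.normalSpace x :=
      sum_mem fun α _ ↦ Submodule.smul_mem _ _ (hN.totallyReal V J hJ x hxV α _ (hz α))
    let t₀ := sharp (f.induced x) (f.nondegenerate x) (l.toLinearMap ∘ₗ (toCoord x x).toLinearMap)
    refine ⟨toCoord (f.toFun x) (f.toFun x)
      (f.d x t₀ + ∑ α, eps α • J α (f.toFun x) (f.d x (z α))), Prod.ext ?_ (funext fun α ↦ ?_)⟩
    · ext t
      rw [hΛ1, ofCoord_toCoord hc, map_add, add_apply, hm, add_zero]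
      refine (apply_sharp (f.induced x) (f.nondegenerate x) _ _).trans ?_
      exact congrArg l (toCoord_ofCoord hcF t)
    · ext t
      have ht : P x (j t) = j t := by rw [← hjk, hkj]
      have hw : ofCoord x x (j t) ∈ f.perp D x := ht ▸ hPD x hx (j t)
      rw [hΛ2, ofCoord_toCoord hc, ht, map_add, add_apply, g.symm _ (f.d x t₀),
        hN.totallyReal V J hJ x hxV α _ hw, zero_add, map_sum, sum_apply,
        Finset.sum_eq_single α, map_smul, smul_apply, hg V J hJ _ hxV, ← f.induced_apply,
        hzw α _ hw, smul_eq_mul, ← mul_assoc, eps_mul_self, one_mul,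
        toCoord_ofCoord hcF, hkj]
      · intro β _ h
        rw [map_smul, smul_apply, hN.val_apply_apply_of_ne hJ hxV hg h _ hw, smul_zero]
      · simp
  have hker : ∀ y ∈ U₂, ∀ b, Λ y b = 0 ↔ ofCoord (f.toFun x) (f.toFun y) b ∈ f.nu σ D y := by
    rintro y ⟨hy, hyV, hyc⟩ b
    rw [hJ.mem_nu_iff hyV]
    constructor
    · refine fun h ↦ ⟨fun u ↦ ?_, fun α z hz ↦ ?_⟩
      · rw [← ofCoord_toCoord (hUs hy) u, ← hΛ1, h]; rfl
      · rw [← ofCoord_toCoord (hUs hy) z, ← hDP y hy z hz, ← hPP y hy x hx, ← hjk, ← hΛ2, h]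
        rfl
    · refine fun h ↦ Prod.ext ?_ (funext fun α ↦ ?_)
      · ext t
        rw [hΛ1, h.1]; rfl
      · ext t
        rw [hΛ2, h.2 α _ (hPD y hy _)]; rfl
  obtain ⟨Q, U, hU, hxU, hUU, hQ⟩ := exists_smooth_projection hU₂o ⟨hx, hxV, hc⟩ hΛs hsurj
  refine ⟨U, fun y ↦ ofCoord (f.toFun x) (f.toFun y) (Q y (toCoord (f.toFun x) (f.toFun x) η)),
    hU, hxU, ⟨fun y hy ↦ ?_, fun y hy ↦ (hker y (hUU hy) _).1 ((hQ y hy).2.1 _)⟩, ?_⟩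
  · exact ContMDiffAt.contMDiffWithinAt (smoothAlongAt_ofCoord (hUU hy).2.2
      f.contMDiff.contMDiffAt ((hQ y hy).1.clm_apply contMDiffAt_const))
  · beta_reduce
    rw [(hQ x hxU).2.2.1 _ ((hker x (hUU hxU) _).2 (by rwa [ofCoord_toCoord hc])),
      ofCoord_toCoord hc]

end NondegSubmanifold

end Extension

/-! ### Restriction of vector fields to integral manifolds. -/

section PullBack

variable {E : Type*} [NormedAddCommGroup E] [NormedSpace ℝ E]
  {M : Type*} [TopologicalSpace M] [ChartedSpace E M] [IsManifold 𝓘(ℝ, E) ∞ M]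
  {F : Type*} [NormedAddCommGroup F] [NormedSpace ℝ F]
  {N : Type*} [TopologicalSpace N] [ChartedSpace F N] [IsManifold 𝓘(ℝ, F) ∞ N]
  {G : Type*} [NormedAddCommGroup G] [NormedSpace ℝ G] [FiniteDimensional ℝ G]
  {L : Type*} [TopologicalSpace L] [ChartedSpace G L] [IsManifold 𝓘(ℝ, G) ∞ L]

/-- A vector field tangent to an immersed submanifold restricts to a smooth vector field on it. -/
theorem exists_pullback [FiniteDimensional ℝ F] {ι : L → N} (hι : ContMDiff 𝓘(ℝ, G) 𝓘(ℝ, F) ∞ ι)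
    {l : L} (hl : Function.Injective (mfderiv 𝓘(ℝ, G) 𝓘(ℝ, F) ι l))
    {Z : ∀ y : N, TangentSpace 𝓘(ℝ, F) y} (hZ : SmoothAlongAt F id (ι l) Z)
    (hr : ∀ᶠ l' in 𝓝 l, Z (ι l') ∈ (mfderiv 𝓘(ℝ, G) 𝓘(ℝ, F) ι l').range) :
    ∃ Y : ∀ l' : L, TangentSpace 𝓘(ℝ, G) l', SmoothAlongAt G id l Y ∧
      ∀ᶠ l' in 𝓝 l, mfderiv 𝓘(ℝ, G) 𝓘(ℝ, F) ι l' (Y l') = Z (ι l') := by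
  have hc := mem_chart_source F (ι l)
  have hcl := mem_chart_source G l
  let B : L → G →L[ℝ] F := fun l' ↦
    (toCoord (ι l) (ι l')).comp ((mfderiv 𝓘(ℝ, G) 𝓘(ℝ, F) ι l').comp (ofCoord l l'))
  have hB : ContMDiffAt 𝓘(ℝ, G) 𝓘(ℝ, G →L[ℝ] F) ∞ B l := contMDiffAt_clm_of_apply fun v ↦
    ((smoothAlongAt_iff hc).1 (smoothAlongAt_mfderiv hι (smoothAlongAt_const hcl v))).2
  have hBl : Function.Injective (B l) := fun a b hab ↦ by
    have h1 := congrArg (ofCoord (ι l) (ι l)) hab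
    simp only [B, ContinuousLinearMap.comp_apply] at h1
    rw [ofCoord_toCoord hc, ofCoord_toCoord hc] at h1
    have h2 := congrArg (toCoord l l) (hl h1)
    rwa [toCoord_ofCoord hcl, toCoord_ofCoord hcl] at h2
  obtain ⟨r, hr'⟩ := (B l).toLinearMap.exists_leftInverse_of_injective
    (LinearMap.ker_eq_bot.2 hBl)
  set R : F →L[ℝ] G := LinearMap.toContinuousLinearMap r with hR
  have hRB : R.comp (B l) = ContinuousLinearMap.id ℝ G := by
    ext v
    exact LinearMap.congr_fun hr' v
  have hQ : ContMDiffAt 𝓘(ℝ, G) 𝓘(ℝ, G →L[ℝ] G) ∞ (fun l' ↦ R.comp (B l')) l :=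
    contMDiffAt_const.clm_comp hB
  have hζ : ContMDiffAt 𝓘(ℝ, G) 𝓘(ℝ, F) ∞ (fun l' ↦ toCoord (ι l) (ι l') (Z (ι l'))) l :=
    ((smoothAlongAt_iff (φ := id ∘ ι) hc).1 (hZ.comp hι.contMDiffAt)).2
  -- With `R` a left inverse of the differential `B l`, the candidate is `(R B)⁻¹ R Z`. It is smooth
  -- because `R B` is the identity at `l`, and it is the preimage of `Z` wherever one exists and `R
  -- B` is invertible.
  refine ⟨fun l' ↦ ofCoord l l' (ContinuousLinearMap.inverse (R.comp (B l'))
    (R (toCoord (ι l) (ι l') (Z (ι l'))))), ?_, ?_⟩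
  · refine smoothAlongAt_ofCoord (φ := id) (x := l) hcl contMDiffAt_id ?_
    refine ContMDiffAt.clm_apply ?_ (contMDiffAt_const.clm_apply hζ)
    have hi : ContDiffAt ℝ ∞ ContinuousLinearMap.inverse (R.comp (B l)) := by
      rw [hRB]
      exact contDiffAt_map_inverse (ContinuousLinearEquiv.refl ℝ G)
    exact hi.contMDiffAt.comp l hQ
  · filter_upwards [hr, (chartAt G l).open_source.mem_nhds hcl,
      hQ.continuousAt.preimage_mem_nhds ((ContinuousLinearEquiv.isOpen (𝕜 := ℝ)).mem_nhds
        ⟨ContinuousLinearEquiv.refl ℝ G, hRB.symm⟩)]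
    rintro l' ⟨t, ht⟩ hl' ⟨e, he⟩
    simp only at he
    have h1 : R (toCoord (ι l) (ι l') (Z (ι l'))) = e (toCoord l l' t) := by
      have h2 : e (toCoord l l' t) = R (B l' (toCoord l l' t)) := congr($he (toCoord l l' t))
      rw [h2, ← ht]
      simp only [B, ContinuousLinearMap.comp_apply]
      rw [ofCoord_toCoord hl']
      rfl
    rw [h1, ← he, ContinuousLinearMap.inverse_equiv]
    refine (congrArg (fun s ↦ mfderiv 𝓘(ℝ, G) 𝓘(ℝ, F) ι l' (ofCoord l l' s))
      (e.symm_apply_apply _)).trans ?_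
    rw [ofCoord_toCoord hl']
    exact ht

end PullBack

/-! ### The pointwise condition on `B` against (ii), (iii), (iv) and parallelism of `D^⊥`. -/

section Equivalences

variable {E : Type*} [NormedAddCommGroup E] [NormedSpace ℝ E] [FiniteDimensional ℝ E]
  {M : Type*} [TopologicalSpace M] [ChartedSpace E M] [IsManifold 𝓘(ℝ, E) ∞ M]
  {g : SemiRiemannianMetric E M}
  {F : Type*} [NormedAddCommGroup F] [NormedSpace ℝ F] [FiniteDimensional ℝ F]
  {N : Type u} [TopologicalSpace N] [ChartedSpace F N] [IsManifold 𝓘(ℝ, F) ∞ N]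
  {σ : ∀ p : M, Submodule ℝ (TangentSpace 𝓘(ℝ, E) p →L[ℝ] TangentSpace 𝓘(ℝ, E) p)}

omit [FiniteDimensional ℝ E] [FiniteDimensional ℝ F] in
theorem IsSection.eventually_mem {D : ∀ x : N, Submodule ℝ (TangentSpace 𝓘(ℝ, F) x)} {U : Set N}
    {Y : ∀ y : N, TangentSpace 𝓘(ℝ, F) y} (h : IsSection D U Y) (hU : IsOpen U) {x : N}
    (hx : x ∈ U) : ∀ᶠ y in 𝓝 x, Y y ∈ D y :=
  Filter.eventually_of_mem (hU.mem_nhds hx) h.mem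

namespace NondegSubmanifold

theorem secondFundamentalForm_eq (f : NondegSubmanifold g F N)
    (X : ∀ y : N, TangentSpace 𝓘(ℝ, F) y) {Y : ∀ y : N, TangentSpace 𝓘(ℝ, F) y} {U : Set N}
    (hY : SmoothOn U Y) (hU : IsOpen U) {x : N} (hx : x ∈ U) :
    f.secondFundamentalForm X Y x = f.secondForm x (X x) (Y x) :=
  f.normalPart_covAlong (hY.at hU hx) (X x)

theorem isTotallyGeodesic_iff (f : NondegSubmanifold g F N) :
    f.IsTotallyGeodesic ↔ ∀ x u w, f.secondForm x u w = 0 := by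
  constructor
  · intro h x u w
    have hc := mem_chart_source F x
    have hs : ∀ b, SmoothOn (chartAt F x).source (fun y ↦ ofCoord x y b) := fun b y hy ↦
      (smoothAlongAt_const hy b).contMDiffWithinAt
    have h1 := h _ (chartAt F x).open_source _ _ (hs (toCoord x x u)) (hs (toCoord x x w)) x hc
    rwa [f.secondFundamentalForm_eq _ (hs _) (chartAt F x).open_source hc, ofCoord_toCoord hc,
      ofCoord_toCoord hc] at h1
  · intro h U hU X Y hX hY x hx
    rw [f.secondFundamentalForm_eq X hY hU hx, h]

variable (f : NondegSubmanifold g F N)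
  (σ : ∀ p : M, Submodule ℝ (TangentSpace 𝓘(ℝ, E) p →L[ℝ] TangentSpace 𝓘(ℝ, E) p))
  (D : ∀ x : N, Submodule ℝ (TangentSpace 𝓘(ℝ, F) x))

/-- Pointwise form of: `B(X, Z) = 0` and `B(X, Y) ∈ Γ(ν)` for `X, Z ∈ Γ(D^⊥)`, `Y ∈ Γ(TN)`. -/
def SecondFormCondition : Prop :=
  ∀ x, ∀ u ∈ f.perp D x, (∀ z ∈ f.perp D x, f.secondForm x u z = 0) ∧
    ∀ w, f.secondForm x u w ∈ f.nu σ D x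

/-- The covariant derivatives in `M` of sections of `D^⊥`, in the directions of `D^⊥`, are in
`D^⊥`. -/
def IsPerpParallel : Prop :=
  ∀ (Z : ∀ y : N, TangentSpace 𝓘(ℝ, F) y) (x : N), SmoothAlongAt F id x Z →
    (∀ᶠ y in 𝓝 x, Z y ∈ f.perp D y) → ∀ u ∈ f.perp D x, ∃ t ∈ f.perp D x,
      g.covAlong f.toFun (fun y ↦ f.d y (Z y)) x u = f.d x t

variable {f σ D}

/-- For the membership in `ν`, the tangent argument is split along `D ⊕ D^⊥`; the `D^⊥` part
contributes zero. -/
theorem secondFormCondition_iff_isPerpGeodesic (hN : f.IsParaquaternionicCR σ D) :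
    f.SecondFormCondition σ D ↔ f.IsPerpGeodesic D ∧
      ∀ U : Set N, IsOpen U → ∀ X Y : ∀ y : N, TangentSpace 𝓘(ℝ, F) y,
        IsSection D U X → IsSection (f.perp D) U Y →
        ∀ x ∈ U, f.secondFundamentalForm X Y x ∈ f.nu σ D x := by
  constructor
  · refine fun h ↦ ⟨fun U hU X Y hX hY x hx ↦ ?_, fun U hU X Y hX hY x hx ↦ ?_⟩
    · rw [f.secondFundamentalForm_eq X hY.smooth hU hx]
      exact (h x _ (hX.mem x hx)).1 _ (hY.mem x hx)
    · rw [f.secondFundamentalForm_eq X hY.smooth hU hx, f.secondForm_symm]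
      exact (h x _ (hY.mem x hx)).2 _
  · rintro ⟨h1, h2⟩ x u hu
    obtain ⟨U, X, hU, hxU, hX, rfl⟩ := f.exists_isSection_perp hN.isDistribution hu
    have h0 : ∀ z ∈ f.perp D x, f.secondForm x (X x) z = 0 := by
      intro z hz
      obtain ⟨U', Z, hU', hxU', hZ, rfl⟩ := f.exists_isSection_perp hN.isDistribution hz
      have h3 := h1 (U ∩ U') (hU.inter hU') X Z
        ⟨hX.smooth.mono Set.inter_subset_left, fun y hy ↦ hX.mem y hy.1⟩
        ⟨hZ.smooth.mono Set.inter_subset_right, fun y hy ↦ hZ.mem y hy.2⟩ x ⟨hxU, hxU'⟩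
      rwa [f.secondFundamentalForm_eq X hZ.smooth hU' hxU'] at h3
    refine ⟨h0, fun w ↦ ?_⟩
    obtain ⟨w, hw, z, hz, rfl⟩ := f.exists_mem_add_mem_perp hN.nondegenerate w
    obtain ⟨U', W, hU', hxU', hW, rfl⟩ := hN.isDistribution.exists_isSection hw
    have h3 := h2 (U ∩ U') (hU.inter hU') W X
      ⟨hW.smooth.mono Set.inter_subset_right, fun y hy ↦ hW.mem y hy.2⟩
      ⟨hX.smooth.mono Set.inter_subset_left, fun y hy ↦ hX.mem y hy.1⟩ x ⟨hxU, hxU'⟩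
    rw [f.secondFundamentalForm_eq W hX.smooth hU hxU] at h3
    rwa [f.secondForm_symm, f.secondForm_add, f.secondForm_symm x z, h0 z hz, add_zero]

variable (hM : IsParaquaternionicKahler g σ) (hN : f.IsParaquaternionicCR σ D)

include hM hN

/-- If `B(X, Z)` is in `ν`, then `∇^⊥_X(J_α Z)` equals `J_α B(X, Z)` modulo `ν^⊥`, and `J_α B(X, Z)`
is in `ν`. As `ν ∩ ν^⊥ = 0` and `J_α` is injective, it lies in `ν^⊥` exactly when `B(X, Z) = 0`. -/
theorem secondFormCondition_iff_nuPerp_parallel : f.SecondFormCondition σ D ↔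
      (∀ (V : Set M) (J : Fin 3 → ∀ p : M, TangentSpace 𝓘(ℝ, E) p →L[ℝ] TangentSpace 𝓘(ℝ, E) p),
        IsCanonicalBasis σ V J →
        ∀ U : Set N, IsOpen U → U ⊆ f.toFun ⁻¹' V → ∀ X Z : ∀ y : N, TangentSpace 𝓘(ℝ, F) y,
          IsSection (f.perp D) U X → IsSection (f.perp D) U Z →
          ∀ α : Fin 3, ∀ x ∈ U,
            f.normalConnection X (fun y ↦ J α (f.toFun y) (f.d y (Z y))) x ∈ f.nuPerp σ D x) ∧
        (∀ U : Set N, IsOpen U → ∀ X Y : ∀ y : N, TangentSpace 𝓘(ℝ, F) y,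
          IsSection (f.perp D) U X → SmoothOn U Y →
          ∀ x ∈ U, f.secondFundamentalForm X Y x ∈ f.nu σ D x) := by
  have key : ∀ (V : Set M)
      (J : Fin 3 → ∀ p : M, TangentSpace 𝓘(ℝ, E) p →L[ℝ] TangentSpace 𝓘(ℝ, E) p),
      IsCanonicalBasis σ V J → ∀ U : Set N, IsOpen U → ∀ X Z : ∀ y : N, TangentSpace 𝓘(ℝ, F) y,
      IsSection (f.perp D) U Z → ∀ α : Fin 3, ∀ x ∈ U, f.toFun x ∈ V →
      f.secondForm x (X x) (Z x) ∈ f.nu σ D x →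
      ∃ m ∈ f.nuPerp σ D x, f.normalConnection X (fun y ↦ J α (f.toFun y) (f.d y (Z y))) x
        = m + J α (f.toFun x) (f.secondForm x (X x) (Z x)) := by
    intro V J hJ U hU X Z hZ α x hx hxV hb
    have hZs := hZ.smooth.at hU hx
    obtain ⟨η, hη, h⟩ := NondegSubmanifold.IsParaquaternionicCR.exists_covAlong_apply hJ hxV hZs
      (hZ.eventually_mem hU hx) hM α (X x)
    have h1 := f.tangentPart_add_normalPart x
      (g.covAlong f.toFun (fun y ↦ f.d y (Z y)) x (X x))
    rw [f.normalPart_covAlong hZs] at h1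
    obtain ⟨w, hw, z, hz, hwz⟩ := f.exists_mem_add_mem_perp hN.nondegenerate
      (f.tangentPart x (g.covAlong f.toFun (fun y ↦ f.d y (Z y)) x (X x)))
    obtain ⟨w', -, hw'⟩ := hN.exists_apply_eq hJ hxV α hw
    have hz' := hJ.apply_mem_nuPerp hxV α hz
    refine ⟨J α (f.toFun x) (f.d x z) + η, add_mem hz' hη, ?_⟩
    rw [normalConnection, h, ← h1, hwz, map_add, map_add, map_add, hw', add_assoc, add_assoc,
      f.normalPart_eq]
    · abel
    · exact add_mem (hN.nuPerp_le_normalSpace hJ hxV hz')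
        (add_mem (hN.apply_mem_nu hJ hxV hM.adapted α hb).1 (hN.nuPerp_le_normalSpace hJ hxV hη))
  constructor
  · refine fun h ↦ ⟨fun V J hJ U hU hUV X Z hX hZ α x hx ↦ ?_, fun U hU X Y hX hY x hx ↦ ?_⟩
    · have h0 := (h x _ (hX.mem x hx)).1 _ (hZ.mem x hx)
      obtain ⟨m, hm, h1⟩ := key V J hJ U hU X Z hZ α x hx (hUV hx) (by rw [h0]; exact zero_mem _)
      rwa [h1, h0, map_zero, add_zero]
    · rw [f.secondFundamentalForm_eq X hY hU hx]
      exact (h x _ (hX.mem x hx)).2 _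
  · rintro ⟨h1, h2⟩ x u hu
    obtain ⟨U, X, hU, hxU, hX, rfl⟩ := f.exists_isSection_perp hN.isDistribution hu
    have hnu : ∀ w, f.secondForm x (X x) w ∈ f.nu σ D x := by
      intro w
      have hc := mem_chart_source F x
      have hs : SmoothOn (chartAt F x).source (fun y ↦ ofCoord x y (toCoord x x w)) := fun y hy ↦
        (smoothAlongAt_const hy _).contMDiffWithinAt
      have h3 := h2 (U ∩ (chartAt F x).source) (hU.inter (chartAt F x).open_source) X _
        ⟨hX.smooth.mono Set.inter_subset_left, fun y hy ↦ hX.mem y hy.1⟩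
        (hs.mono Set.inter_subset_right) x ⟨hxU, hc⟩
      rwa [f.secondFundamentalForm_eq X hs (chartAt F x).open_source hc,
        ofCoord_toCoord hc] at h3
    refine ⟨fun z hz ↦ ?_, hnu⟩
    obtain ⟨U', Z, hU', hxU', hZ, rfl⟩ := f.exists_isSection_perp hN.isDistribution hz
    obtain ⟨V, hxV, J, hJ⟩ := hM.almost (f.toFun x)
    have hVo := hJ.isOpen.preimage f.contMDiff.continuous
    -- A single index `α` already forces `B(X, Z) = 0`.
    obtain ⟨m, hm, h3⟩ := key V J hJ U' hU' X Z hZ 0 x hxU' hxV (hnu _)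
    have h4 := h1 V J hJ (U ∩ U' ∩ f.toFun ⁻¹' V) ((hU.inter hU').inter hVo)
      Set.inter_subset_right X Z
      ⟨hX.smooth.mono fun y hy ↦ hy.1.1, fun y hy ↦ hX.mem y hy.1.1⟩
      ⟨hZ.smooth.mono fun y hy ↦ hy.1.2, fun y hy ↦ hZ.mem y hy.1.2⟩ 0 x ⟨⟨hxU, hxU'⟩, hxV⟩
    rw [h3] at h4
    have h5 := hN.eq_zero_of_mem_nu_of_mem_nuPerp hJ hxV hM.adapted
      (hN.apply_mem_nu hJ hxV hM.adapted 0 (hnu (Z x))) ((Submodule.add_mem_iff_right _ hm).1 h4)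
    exact hJ.injective hxV 0 (h5.trans (map_zero _).symm)

/-- By `g(A_ξ X, w) = g(ξ, B(X, w))`, the first clause says that `B(X, ·)` is orthogonal to `ν^⊥`,
and the second that `B(X, z)` is orthogonal to `ν` for `z` in `D^⊥`. Together they leave `B(X, z) =
0`. -/
theorem secondFormCondition_iff_shape : f.SecondFormCondition σ D ↔
      (∀ (V : Set M) (J : Fin 3 → ∀ p : M, TangentSpace 𝓘(ℝ, E) p →L[ℝ] TangentSpace 𝓘(ℝ, E) p),
        IsCanonicalBasis σ V J →
        ∀ U : Set N, IsOpen U → U ⊆ f.toFun ⁻¹' V → ∀ X Z : ∀ y : N, TangentSpace 𝓘(ℝ, F) y,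
          IsSection (f.perp D) U X → IsSection (f.perp D) U Z →
          ∀ α : Fin 3, ∀ x ∈ U,
            f.shape (fun y ↦ J α (f.toFun y) (f.d y (Z y))) X x = 0) ∧
        (∀ U : Set N, IsOpen U → ∀ X : ∀ y : N, TangentSpace 𝓘(ℝ, F) y,
          IsSection (f.perp D) U X →
          ∀ ξ : ∀ y : N, TangentSpace 𝓘(ℝ, E) (f.toFun y),
            IsSectionAlong F f.toFun (f.nu σ D) U ξ →
            ∀ x ∈ U, f.shape ξ X x ∈ D x) := by
  constructor
  · refine fun h ↦ ⟨fun V J hJ U hU hUV X Z hX hZ α x hx ↦ ?_, fun U hU X hX ξ hξ x hx ↦ ?_⟩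
    · refine f.nondegenerate x _ fun w ↦ ?_
      have hZp := hZ.eventually_mem hU hx
      refine (f.induced_shape (NondegSubmanifold.IsParaquaternionicCR.smoothAlongAt_apply hJ
        (hUV hx) (hZ.smooth.at hU hx) α) (hN.eventually_apply_mem hJ (hUV hx) hZp α) X w).trans ?_
      rw [g.symm]
      exact ((h x _ (hX.mem x hx)).2 w).2 _ (hJ.apply_mem_nuPerp (hUV hx) α (hZ.mem x hx))
    · refine f.mem_of_perp_perp hN.nondegenerate fun z hz ↦ ?_
      rw [f.induced_shape (hξ.smooth.at hU hx)
        (Filter.eventually_of_mem (hU.mem_nhds hx) fun y hy ↦ (hξ.mem y hy).1),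
        (h x _ (hX.mem x hx)).1 z hz, map_zero]
  · rintro ⟨h1, h2⟩ x u hu
    obtain ⟨U, X, hU, hxU, hX, rfl⟩ := f.exists_isSection_perp hN.isDistribution hu
    obtain ⟨V, hxV, J, hJ⟩ := hM.almost (f.toFun x)
    have hVo := hJ.isOpen.preimage f.contMDiff.continuous
    have hnu : ∀ w, f.secondForm x (X x) w ∈ f.nu σ D x := fun w ↦ by
      refine (hJ.mem_nu_iff hxV).2 ⟨f.secondForm_mem x _ _, fun α z hz ↦ ?_⟩
      obtain ⟨U', Z, hU', hxU', hZ, rfl⟩ := f.exists_isSection_perp hN.isDistribution hz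
      have h3 := h1 V J hJ (U ∩ U' ∩ f.toFun ⁻¹' V) ((hU.inter hU').inter hVo)
        Set.inter_subset_right X Z
        ⟨hX.smooth.mono fun y hy ↦ hy.1.1, fun y hy ↦ hX.mem y hy.1.1⟩
        ⟨hZ.smooth.mono fun y hy ↦ hy.1.2, fun y hy ↦ hZ.mem y hy.1.2⟩ α x ⟨⟨hxU, hxU'⟩, hxV⟩
      have h4 := f.induced_shape (NondegSubmanifold.IsParaquaternionicCR.smoothAlongAt_apply hJ
        hxV (hZ.smooth.at hU' hxU') α)
        (hN.eventually_apply_mem hJ hxV (hZ.eventually_mem hU' hxU') α) X w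
      rw [h3, map_zero, LinearMap.zero_apply] at h4
      rw [g.symm, ← h4]
    refine ⟨fun z hz ↦ ?_, hnu⟩
    refine hN.eq_zero_of_mem_normalSpace hJ hxV hM.adapted (f.secondForm_mem x _ _)
      (hnu z).2 fun η hη ↦ ?_
    obtain ⟨U', ξ, hU', hxU', hξ, rfl⟩ := hN.exists_isSectionAlong_nu hM.adapted hJ hxV hη
    have h3 := h2 (U ∩ U') (hU.inter hU') X
      ⟨hX.smooth.mono Set.inter_subset_left, fun y hy ↦ hX.mem y hy.1⟩ ξ
      ⟨hξ.smooth.mono Set.inter_subset_right, fun y hy ↦ hξ.mem y hy.2⟩ x ⟨hxU, hxU'⟩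
    rw [g.symm, ← f.induced_shape (hξ.smooth.at hU' hxU')
      (Filter.eventually_of_mem (hU'.mem_nhds hxU') fun y hy ↦ (hξ.mem y hy).1), f.induced_symm]
    exact hz _ h3

/-- The normal part of `∇_u Z` is `B(u, Z)`. Its products with `D = J_α D` are products of `B(u, ·)`
with `J_α Z`, by `val_covAlong_apply`, so the `D` part vanishes when `B(u, ·)` has values in `ν`.
Conversely, a vector of `D^⊥` is orthogonal to `J_α D` and to `J_α D^⊥`. -/
theorem secondFormCondition_iff_isPerpParallel :
    f.SecondFormCondition σ D ↔ f.IsPerpParallel D := by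
  constructor
  · intro h Z x hZ hZp u hu
    obtain ⟨V, hxV, J, hJ⟩ := hM.almost (f.toFun x)
    have h1 := f.tangentPart_add_normalPart x (g.covAlong f.toFun (fun y ↦ f.d y (Z y)) x u)
    rw [f.normalPart_covAlong hZ, (h x u hu).1 _ hZp.self_of_nhds, add_zero] at h1
    refine ⟨_, fun w hw ↦ ?_, h1.symm⟩
    obtain ⟨w', -, hw'⟩ := hN.exists_eq_apply hJ hxV 0 hw
    rw [f.induced_apply, h1, hw', hN.val_covAlong_apply hJ hxV hZ hZp hM, g.symm]
    exact ((h x u hu).2 w').2 _ (hJ.apply_mem_nuPerp hxV 0 hZp.self_of_nhds)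
  · intro h x u hu
    obtain ⟨V, hxV, J, hJ⟩ := hM.almost (f.toFun x)
    refine ⟨fun z hz ↦ ?_, fun w ↦ (hJ.mem_nu_iff hxV).2
      ⟨f.secondForm_mem x _ _, fun α z hz ↦ ?_⟩⟩
    all_goals
      obtain ⟨U, Z, hU, hxU, hZ, rfl⟩ := f.exists_isSection_perp hN.isDistribution hz
      have hZs := hZ.smooth.at hU hxU
      have hZp := hZ.eventually_mem hU hxU
      obtain ⟨t, ht, hZt⟩ := h Z x hZs hZp u hu
    · rw [← f.normalPart_covAlong hZs, hZt, f.normalPart_d]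
    · rw [g.symm, ← hN.val_covAlong_apply hJ hxV hZs hZp hM, hZt]
      obtain ⟨w, hw, z, hz, rfl⟩ := f.exists_mem_add_mem_perp hN.nondegenerate w
      obtain ⟨w', hw', h3⟩ := hN.exists_apply_eq hJ hxV α hw
      rw [map_add, map_add, map_add, h3, ← f.induced_apply, ht w' hw', g.symm,
        hN.totallyReal V J hJ x hxV α z hz, add_zero]

end NondegSubmanifold

end Equivalences

/-! ### Integrability of `D^⊥` and totally geodesic leaves. -/

section Leaves

variable {E : Type*} [NormedAddCommGroup E] [NormedSpace ℝ E] [FiniteDimensional ℝ E]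
  {M : Type*} [TopologicalSpace M] [ChartedSpace E M] [IsManifold 𝓘(ℝ, E) ∞ M]
  {g : SemiRiemannianMetric E M}
  {F : Type*} [NormedAddCommGroup F] [NormedSpace ℝ F] [FiniteDimensional ℝ F]
  {N : Type u} [TopologicalSpace N] [ChartedSpace F N] [IsManifold 𝓘(ℝ, F) ∞ N]
  {f : NondegSubmanifold g F N} {D : ∀ x : N, Submodule ℝ (TangentSpace 𝓘(ℝ, F) x)}

namespace NondegSubmanifold

/-- If `D^⊥` is parallel in the directions of `D^⊥`, it is integrable. -/
theorem IsPerpParallel.exists_isIntegralManifold (h : f.IsPerpParallel D)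
    (hD : IsDistribution D) (x : N) :
    ∃ (s : ℕ) (L : Type u) (_ : TopologicalSpace L)
      (_ : ChartedSpace (EuclideanSpace ℝ (Fin s)) L)
      (_ : IsManifold 𝓘(ℝ, EuclideanSpace ℝ (Fin s)) ∞ L) (ι : L → N),
      IsIntegralManifold (G := EuclideanSpace ℝ (Fin s)) (f.perp D) ι ∧ x ∈ Set.range ι := by
  obtain ⟨P, U, hU, hxU, hUs, hP, hPP, hPD, hDP⟩ := f.exists_perp_projection hD x
  refine PQ.exists_isIntegralManifold hU hxU hUs hP hPP hPD hDP fun y hy v w ↦ ?_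
  obtain ⟨H, hH, hcov⟩ := g.exists_symm_covAlong_mfderiv f.contMDiff (hUs hy)
  have hY : ∀ v : F, SmoothAlongAt F id y (fun z ↦ ofCoord x z (P z v)) := fun v ↦
    smoothAlongAt_ofCoord (φ := id) (x := y) (hUs hy) contMDiffAt_id
      ((hP y hy).clm_apply contMDiffAt_const)
  have hder : ∀ (v : F) (u : TangentSpace 𝓘(ℝ, F) y),
      mvfderiv 𝓘(ℝ, F) (fun z ↦ toCoord x z (ofCoord x z (P z v))) y u
        = mvfderiv 𝓘(ℝ, F) (fun z ↦ P z v) y u := fun v u ↦ by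
    rw [mvfderiv_congr (k := fun z ↦ P z v)]
    filter_upwards [hU.mem_nhds hy] with z hz using toCoord_ofCoord (hUs hz) _
  have hev : ∀ v : F, ∀ᶠ z in 𝓝 y, ofCoord x z (P z v) ∈ f.perp D z := fun v ↦ by
    filter_upwards [hU.mem_nhds hy] with z hz using hPD z hz v
  obtain ⟨t₁, ht₁, h1⟩ := h _ y (hY w) (hev w) _ (hPD y hy v)
  obtain ⟨t₂, ht₂, h2⟩ := h _ y (hY v) (hev v) _ (hPD y hy w)
  have e1 := (hcov _ (hY w) (ofCoord x y (P y v))).symm.trans h1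
  have e2 := (hcov _ (hY v) (ofCoord x y (P y w))).symm.trans h2
  -- Subtracting the two covariant derivatives cancels the symmetric term `H`, which leaves the
  -- image of the bracket; injectivity of the differential then puts the bracket in `D^⊥`.
  rw [hder] at e1 e2
  rw [hH] at e2
  have e3 : f.d y (ofCoord x y
      (mvfderiv 𝓘(ℝ, F) (fun z ↦ P z w) y (ofCoord x y (P y v))
        - mvfderiv 𝓘(ℝ, F) (fun z ↦ P z v) y (ofCoord x y (P y w)))) = f.d y (t₁ - t₂) := by
    rw [map_sub, map_sub, map_sub, ← e1, ← e2]
    exact (add_sub_add_left_eq_sub _ _ _).symm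
  rw [f.immersion y e3]
  exact sub_mem ht₁ ht₂

variable {G : Type*} [NormedAddCommGroup G] [NormedSpace ℝ G] [FiniteDimensional ℝ G]
  {L : Type*} [TopologicalSpace L] [ChartedSpace G L] [IsManifold 𝓘(ℝ, G) ∞ L]
  {ι : L → N}

omit [FiniteDimensional ℝ E] [FiniteDimensional ℝ F] [FiniteDimensional ℝ G]
  [IsManifold 𝓘(ℝ, G) ∞ L] in
theorem mfderiv_comp_integral (hι : ContMDiff 𝓘(ℝ, G) 𝓘(ℝ, F) ∞ ι) (l : L)
    (u : TangentSpace 𝓘(ℝ, G) l) :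
    mfderiv 𝓘(ℝ, G) 𝓘(ℝ, E) (f.toFun ∘ ι) l u
      = f.d (ι l) (mfderiv 𝓘(ℝ, G) 𝓘(ℝ, F) ι l u) :=
  mfderiv_comp_apply l (f.contMDiff.mdifferentiableAt (by simp))
    (hι.mdifferentiableAt (by simp)) u

/-- A section of `D^⊥` restricts to the integral manifolds of `D^⊥`, with the same covariant
derivatives in `M`. -/
theorem exists_restriction (hι : IsIntegralManifold (G := G) (f.perp D) ι) {l : L}
    {Z : ∀ y : N, TangentSpace 𝓘(ℝ, F) y} (hZ : SmoothAlongAt F id (ι l) Z)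
    (hZp : ∀ᶠ y in 𝓝 (ι l), Z y ∈ f.perp D y) :
    ∃ Y : ∀ l' : L, TangentSpace 𝓘(ℝ, G) l', SmoothAlongAt G id l Y ∧
      mfderiv 𝓘(ℝ, G) 𝓘(ℝ, F) ι l (Y l) = Z (ι l) ∧
      ∀ u : TangentSpace 𝓘(ℝ, G) l, g.covAlong (f.toFun ∘ ι)
          (fun l' ↦ mfderiv 𝓘(ℝ, G) 𝓘(ℝ, E) (f.toFun ∘ ι) l' (Y l')) l u
        = g.covAlong f.toFun (fun y ↦ f.d y (Z y)) (ι l) (mfderiv 𝓘(ℝ, G) 𝓘(ℝ, F) ι l u) := by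
  obtain ⟨Y, hY, hYZ⟩ := exists_pullback hι.contMDiff (hι.immersion l) hZ (by
    filter_upwards [hι.contMDiff.continuous.continuousAt.eventually hZp] with l' hl'
    rw [hι.range_eq]
    exact hl')
  refine ⟨Y, hY, hYZ.self_of_nhds, fun u ↦ ?_⟩
  refine (g.covAlong_congr ?_ u).trans
    (g.covAlong_comp (smoothAlongAt_mfderiv f.contMDiff hZ) hι.contMDiff.contMDiffAt u)
  filter_upwards [hYZ] with l' hl'
  rw [mfderiv_comp_integral hι.contMDiff, hl']
  rfl

/-- An integral manifold of `D^⊥` as a submanifold of `M`. -/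
def leaf (hD : ∀ x, ∀ u ∈ D x, (∀ w ∈ D x, f.induced x u w = 0) → u = 0)
    (hι : IsIntegralManifold (G := G) (f.perp D) ι) : NondegSubmanifold g G L where
  toFun := f.toFun ∘ ι
  contMDiff := f.contMDiff.comp hι.contMDiff
  immersion l a b hab := by
    rw [mfderiv_comp_integral hι.contMDiff, mfderiv_comp_integral hι.contMDiff] at hab
    exact hι.immersion l (f.immersion _ hab)
  nondegenerate l u hu := by
    have hmem : ∀ w, mfderiv 𝓘(ℝ, G) 𝓘(ℝ, F) ι l w ∈ f.perp D (ι l) := fun w ↦ by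
      rw [← hι.range_eq]
      exact ⟨w, rfl⟩
    have h0 : mfderiv 𝓘(ℝ, G) 𝓘(ℝ, F) ι l u = 0 := by
      refine f.perp_nondegenerate hD (hmem u) fun z hz ↦ ?_
      rw [← hι.range_eq] at hz
      obtain ⟨w, rfl⟩ := hz
      have := hu w
      rwa [mfderiv_comp_integral hι.contMDiff, mfderiv_comp_integral hι.contMDiff] at this
    exact hι.immersion l (h0.trans (map_zero _).symm)

/-- If `D^⊥` is parallel in the directions of `D^⊥`, its integral manifolds are totally
geodesic. -/
theorem IsPerpParallel.isTotallyGeodesic_leaf (h : f.IsPerpParallel D) (hdist : IsDistribution D)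
    (hD : ∀ x, ∀ u ∈ D x, (∀ w ∈ D x, f.induced x u w = 0) → u = 0)
    (hι : IsIntegralManifold (G := G) (f.perp D) ι) : (leaf hD hι).IsTotallyGeodesic := by
  refine (leaf hD hι).isTotallyGeodesic_iff.2 fun l u w ↦ ?_
  have hmem : ∀ w, mfderiv 𝓘(ℝ, G) 𝓘(ℝ, F) ι l w ∈ f.perp D (ι l) := fun w ↦ by
    rw [← hι.range_eq]
    exact ⟨w, rfl⟩
  obtain ⟨U, Z, hU, hxU, hZ, hZw⟩ := f.exists_isSection_perp hdist (hmem w)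
  have hZs := hZ.smooth.at hU hxU
  have hZp := hZ.eventually_mem hU hxU
  obtain ⟨Y, hY, hYZ, hcov⟩ := exists_restriction hι hZs hZp
  obtain ⟨t, ht, hZt⟩ := h Z (ι l) hZs hZp _ (hmem u)
  rw [← hι.range_eq] at ht
  obtain ⟨t', rfl⟩ := ht
  have hYw : Y l = w := hι.immersion l (hYZ.trans hZw)
  rw [← hYw, ← (leaf hD hι).normalPart_covAlong hY]
  have h1 : g.covAlong (leaf hD hι).toFun (fun l' ↦ (leaf hD hι).d l' (Y l')) l u
      = (leaf hD hι).d l t' :=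
    ((hcov u).trans hZt).trans (mfderiv_comp_integral hι.contMDiff l t').symm
  rw [h1, normalPart_d]

omit [FiniteDimensional ℝ G] [IsManifold 𝓘(ℝ, G) ∞ L] [TopologicalSpace L] [ChartedSpace G L] in
-- From right to left the leaves come from Frobenius' theorem. From left to right, a section of
-- `D^⊥` is restricted to the leaf through the point: its derivative in `M` is unchanged, and by
-- total geodesy it is tangent to the leaf, that is, in `D^⊥`.
theorem isTotallyRealRuled_iff {σ : ∀ p : M,
    Submodule ℝ (TangentSpace 𝓘(ℝ, E) p →L[ℝ] TangentSpace 𝓘(ℝ, E) p)}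
    (hN : f.IsParaquaternionicCR σ D) : f.IsTotallyRealRuled D ↔ f.IsPerpParallel D := by
  refine ⟨?_, fun h ↦ ⟨h.exists_isIntegralManifold hN.isDistribution, ?_⟩⟩
  · rintro ⟨h1, h2⟩ Z x hZ hZp u hu
    obtain ⟨s, L, _, _, _, ι, hι, l, rfl⟩ := h1 x
    obtain ⟨⟨k, hk, hki, hkn⟩, heq, hgeo⟩ := h2 s L ι hι
    change k = f.toFun ∘ ι at heq
    subst heq
    rw [isTotallyGeodesic_iff] at hgeo
    obtain ⟨Y, hY, -, hcov⟩ := exists_restriction hι hZ hZp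
    rw [← hι.range_eq] at hu
    obtain ⟨u', rfl⟩ := hu
    set h : NondegSubmanifold g (EuclideanSpace ℝ (Fin s)) L := ⟨f.toFun ∘ ι, hk, hki, hkn⟩
    have e1 := h.tangentPart_add_normalPart l (g.covAlong h.toFun (fun l' ↦ h.d l' (Y l')) l u')
    rw [h.normalPart_covAlong hY, hgeo, add_zero] at e1
    refine ⟨mfderiv 𝓘(ℝ, EuclideanSpace ℝ (Fin s)) 𝓘(ℝ, F) ι l _, ?_,
      (hcov u').symm.trans (e1.symm.trans (mfderiv_comp_integral hι.contMDiff l _))⟩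
    rw [← hι.range_eq]
    exact ⟨_, rfl⟩
  · intro s L _ _ _ ι hι
    exact ⟨leaf hN.nondegenerate hι, rfl,
      h.isTotallyGeodesic_leaf hN.isDistribution hN.nondegenerate hι⟩

end NondegSubmanifold

end Leaves

end PQ

end

/-! ### The theorem. -/

theorem mainTheorem6
    {E : Type*} [NormedAddCommGroup E] [NormedSpace ℝ E] [FiniteDimensional ℝ E]
    {M : Type*} [TopologicalSpace M] [ChartedSpace E M] [IsManifold 𝓘(ℝ, E) ∞ M]
    {F : Type*} [NormedAddCommGroup F] [NormedSpace ℝ F] [FiniteDimensional ℝ F]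
    {N : Type*} [TopologicalSpace N] [ChartedSpace F N] [IsManifold 𝓘(ℝ, F) ∞ N]
    (g : PQ.SemiRiemannianMetric E M)
    (σ : ∀ p : M, Submodule ℝ (TangentSpace 𝓘(ℝ, E) p →L[ℝ] TangentSpace 𝓘(ℝ, E) p))
    (hM : PQ.IsParaquaternionicKahler g σ)
    (f : PQ.NondegSubmanifold g F N)
    (D : ∀ x : N, Submodule ℝ (TangentSpace 𝓘(ℝ, F) x))
    (hN : f.IsParaquaternionicCR σ D) :
    List.TFAE [
      f.IsTotallyRealRuled D,
      f.IsPerpGeodesic D ∧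
        ∀ U : Set N, IsOpen U → ∀ X Y : ∀ y : N, TangentSpace 𝓘(ℝ, F) y,
          PQ.IsSection D U X → PQ.IsSection (f.perp D) U Y →
          ∀ x ∈ U, f.secondFundamentalForm X Y x ∈ f.nu σ D x,
      (∀ (V : Set M) (J : Fin 3 → ∀ p : M, TangentSpace 𝓘(ℝ, E) p →L[ℝ] TangentSpace 𝓘(ℝ, E) p),
        PQ.IsCanonicalBasis σ V J →
        ∀ U : Set N, IsOpen U → U ⊆ f.toFun ⁻¹' V → ∀ X Z : ∀ y : N, TangentSpace 𝓘(ℝ, F) y,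
          PQ.IsSection (f.perp D) U X → PQ.IsSection (f.perp D) U Z →
          ∀ α : Fin 3, ∀ x ∈ U,
            f.normalConnection X (fun y ↦ J α (f.toFun y) (f.d y (Z y))) x ∈ f.nuPerp σ D x) ∧
        (∀ U : Set N, IsOpen U → ∀ X Y : ∀ y : N, TangentSpace 𝓘(ℝ, F) y,
          PQ.IsSection (f.perp D) U X → PQ.SmoothOn U Y →
          ∀ x ∈ U, f.secondFundamentalForm X Y x ∈ f.nu σ D x),
      (∀ (V : Set M) (J : Fin 3 → ∀ p : M, TangentSpace 𝓘(ℝ, E) p →L[ℝ] TangentSpace 𝓘(ℝ, E) p),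
        PQ.IsCanonicalBasis σ V J →
        ∀ U : Set N, IsOpen U → U ⊆ f.toFun ⁻¹' V → ∀ X Z : ∀ y : N, TangentSpace 𝓘(ℝ, F) y,
          PQ.IsSection (f.perp D) U X → PQ.IsSection (f.perp D) U Z →
          ∀ α : Fin 3, ∀ x ∈ U,
            f.shape (fun y ↦ J α (f.toFun y) (f.d y (Z y))) X x = 0) ∧
        (∀ U : Set N, IsOpen U → ∀ X : ∀ y : N, TangentSpace 𝓘(ℝ, F) y,
          PQ.IsSection (f.perp D) U X →
          ∀ ξ : ∀ y : N, TangentSpace 𝓘(ℝ, E) (f.toFun y),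
            PQ.IsSectionAlong F f.toFun (f.nu σ D) U ξ →
            ∀ x ∈ U, f.shape ξ X x ∈ D x)] := by
  have h2 := f.secondFormCondition_iff_isPerpGeodesic hN
  have h3 := PQ.NondegSubmanifold.secondFormCondition_iff_nuPerp_parallel hM hN
  have h4 := PQ.NondegSubmanifold.secondFormCondition_iff_shape hM hN
  have h1 := (PQ.NondegSubmanifold.isTotallyRealRuled_iff hN).trans
    (PQ.NondegSubmanifold.secondFormCondition_iff_isPerpParallel hM hN).symm
  tfae_have 1 ↔ 2 := h1.trans h2
  tfae_have 2 ↔ 3 := h2.symm.trans h3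
  tfae_have 3 ↔ 4 := h3.symm.trans h4
  tfae_finish
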